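/- Call $L\subset\mathbb R^2$ a smooth proper multiray if $L$ is the image of a smooth ($C^\infty$) proper embedding $S\times[0,\infty)\to\mathbb R^2$, where $S$ is a countable (finite or infinite) discrete set; the rays of $L$ are the images of the sets $\{i\}\times[0,\infty)$, $i\in S$ (these are the connected components of $L$). Such an $L$ is called radial if each of its rays is contained in a line through the origin and does not contain the origin. Theorem (2-dimensional Multiray Radialization Theorem). Let $L\subset\mathbb R^2$ be a smooth proper multiray. Then $L$ is smoothly ambient isotopic to a radial multiray: there is a smooth family of diffeomorphisms $h_t:\mathbb R^2\to\mathbb R^2$, $0\le t\le 1$ (smooth jointly in $(t,x)$), such that $h_0=\mathrm{id}$ and $h_1(L)$ is a radial multiray. -/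

import Mathlib

open scoped ContDiff Manifold

/-- The Euclidean plane `ℝ²`. -/
abbrev Plane : Type := EuclideanSpace ℝ (Fin 2)

/-- `γ`, restricted to `S × [0,∞)` with `S` discrete, is a smooth proper embedding into the plane:
smooth, immersive, injective and proper. As usual, smoothness on the half-line `[0,∞)` means
being the restriction of a smooth map defined on `ℝ`; the values of `γ i` at negative times play
no other role, and at `t = 0` the derivative is the one-sided derivative of the restriction. -/
structure IsSmoothProperRayEmbedding {S : Type*} [TopologicalSpace S] [DiscreteTopology S]
    (γ : S → ℝ → Plane) : Prop where
  smooth : ∀ i, ContDiff ℝ ∞ (γ i)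
  immersive : ∀ i, ∀ t, 0 ≤ t → deriv (γ i) t ≠ 0
  injective : Function.Injective (fun p : S × Set.Ici (0 : ℝ) => γ p.1 p.2)
  proper : IsProperMap (fun p : S × Set.Ici (0 : ℝ) => γ p.1 p.2)

/-- The ray traced out by `c` on `[0,∞)`. -/
def rayOf (c : ℝ → Plane) : Set Plane := c '' Set.Ici 0

/-- `L` is a smooth proper multiray: the image of a smooth proper embedding of `S × [0,∞)` for a
countable (finite, possibly empty, or infinite) discrete set `S`. Its rays (that is, its connected
components) are the images of the `{i} × [0,∞)`. -/
def IsSmoothProperMultiray (L : Set Plane) : Prop :=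
  ∃ (S : Set ℕ) (γ : S → ℝ → Plane),
    IsSmoothProperRayEmbedding γ ∧ L = ⋃ i, rayOf (γ i)

/-- A set is radial if it lies in a line through the origin and misses the origin. -/
def IsRadial (r : Set Plane) : Prop :=
  (∃ v : Plane, v ≠ 0 ∧ r ⊆ (Submodule.span ℝ {v} : Set Plane)) ∧ (0 : Plane) ∉ r

/-- `L` is a radial multiray: a smooth proper multiray all of whose rays are radial. -/
def IsRadialMultiray (L : Set Plane) : Prop :=
  ∃ (S : Set ℕ) (γ : S → ℝ → Plane),
    IsSmoothProperRayEmbedding γ ∧ L = ⋃ i, rayOf (γ i) ∧ ∀ i, IsRadial (rayOf (γ i))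

/-- `h` is (after restriction to `0 ≤ t ≤ 1`) a smooth ambient isotopy of the plane: `h t x` is
smooth jointly in `(t, x)`, every `h t` with `0 ≤ t ≤ 1` is a diffeomorphism of the plane, and
`h 0` is the identity. -/
structure IsSmoothAmbientIsotopy (h : ℝ → Plane → Plane) : Prop where
  smooth : ContDiff ℝ ∞ (fun p : ℝ × Plane => h p.1 p.2)
  diffeo : ∀ t ∈ Set.Icc (0 : ℝ) 1,
    ∃ Φ : Diffeomorph 𝓘(ℝ, Plane) 𝓘(ℝ, Plane) Plane Plane ∞, ∀ x, Φ x = h t x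
  zero : ∀ x, h 0 x = x

/-- `L` is smoothly ambient isotopic to `L'`. -/
def SmoothlyAmbientIsotopic (L L' : Set Plane) : Prop :=
  ∃ h : ℝ → Plane → Plane, IsSmoothAmbientIsotopy h ∧ h 1 '' L = L'

/-!
The isotopy comes from one diffeomorphism `G` of `ℂ` that is the identity near the origin and makes
the multiray radial, once a point off the multiray has been translated to the origin. The maps
`z ↦ t⁻¹ G (t z)` connect such a `G` with the identity, smoothly down to `t = 0`
(`exists_isotopy`).

`G` is the limit of a sequence of diffeomorphisms, each modified only near and outside a disc that
grows with the sequence, so that the sequence and the sequence of inverses stabilize on discs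
(`exists_limit`). At each stage, with a disc of radius `R`, every ray is either free, that is,
outside the closed disc, or attached: it starts in the disc, goes out radially and never returns.
The next stage is reached in three steps.

* The finitely many free rays that meet the next disc `K` of the domain are attached
  (`IsRayFamily.exists_attach`). A short prolongation of such a ray beyond its origin is pulled into
  the disc without moving any ray. By Sard's theorem its last crossing of the circle can be made
  transversal (`exists_regular_crossing`), then radial by a shear along the circles
  (`exists_make_radial`); finally the ray is pulled back along the prolongation
  (`IsRayFamily.exists_slide`), so that it starts on the radial piece.
* The image of `K` is pulled into the disc (`IsRayFamily.exists_engulf`): after sliding it off the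
  outer parts of the rays, along the rays (`IsRayFamily.exists_avoid`), it can be moved into the disc
  with all rays fixed (`exists_collapse`).
* The disc is stretched to the disc of radius `R + 1` (`exists_stretch`), which preserves radial
  lines.

The topological core is `exists_collapse`: a continuum `K` through the origin, disjoint outside the
disc from a closed set `Z` that has no bounded pieces outside the disc, can be moved into the disc
without moving `Z`. Cover the outer part of `K` by the squares of a fine polar grid that miss `Z`.
Each of these squares is collapsed through its outer side, from the outermost ones inwards. The graph
of the remaining edges has no cycles relative to the initial circle (`eq_zero_of_even_degrees`): no
square would be inside such a cycle, since a square that meets `Z` is connected to infinity by `Z`,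
and any other one has lost its outer side. The inside is defined by a parity count, which replaces the
Jordan curve theorem. So the graph collapses leaf by leaf
(`exists_leaf`) to a part of the circle and isolated points, and a connected set containing the
origin follows the circle into the disc.
-/

open Set Filter Topology

/-! ### Diffeomorphisms of the plane -/

/-- A permutation of `ℂ` is a smooth diffeomorphism if it and its inverse are smooth over `ℝ`. -/
def IsDiffeo (D : Equiv.Perm ℂ) : Prop := ContDiff ℝ ∞ D ∧ ContDiff ℝ ∞ D.symm

namespace IsDiffeo

theorem one : IsDiffeo 1 := ⟨contDiff_id, contDiff_id⟩

theorem mul {D E : Equiv.Perm ℂ} (hD : IsDiffeo D) (hE : IsDiffeo E) : IsDiffeo (D * E) :=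
  ⟨hD.1.comp hE.1, hE.2.comp hD.2⟩

theorem inv {D : Equiv.Perm ℂ} (hD : IsDiffeo D) : IsDiffeo D⁻¹ := ⟨hD.2, hD.1⟩

theorem pow {D : Equiv.Perm ℂ} (hD : IsDiffeo D) (n : ℕ) : IsDiffeo (D ^ n) := by
  induction n with
  | zero => simpa using one
  | succ n ih => rw [pow_succ]; exact ih.mul hD

theorem continuous {D : Equiv.Perm ℂ} (hD : IsDiffeo D) : Continuous D := hD.1.continuous

/-- The homeomorphism underlying a smooth diffeomorphism. -/
def homeo {D : Equiv.Perm ℂ} (hD : IsDiffeo D) : ℂ ≃ₜ ℂ :=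
  ⟨D, hD.1.continuous, hD.2.continuous⟩

end IsDiffeo

theorem Equiv.Perm.inv_fix {D : Equiv.Perm ℂ} {z : ℂ} (h : D z = z) : D⁻¹ z = z := by
  rw [Equiv.Perm.inv_eq_iff_eq]; exact h.symm

theorem Equiv.Perm.pow_fix {D : Equiv.Perm ℂ} {z : ℂ} (h : D z = z) (n : ℕ) : (D ^ n) z = z := by
  induction n with
  | zero => rfl
  | succ n ih => rw [pow_succ, Equiv.Perm.mul_apply, h, ih]

/-- A permutation that is the identity off `O` maps `O` to itself. -/
theorem Equiv.Perm.mem_of_fix {D : Equiv.Perm ℂ} {O : Set ℂ} (h : ∀ z, z ∉ O → D z = z) {z : ℂ}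
    (hz : z ∈ O) : D z ∈ O := by
  by_contra hc
  have := D.injective (h _ hc)
  exact hc (by rw [this]; exact hz)

/-! ### Perturbations of the identity -/

/-- A smooth perturbation of the identity with Lipschitz constant less than one is a
diffeomorphism. -/
theorem exists_diffeo_of_lipschitz {u : ℂ → ℂ} (hu : ContDiff ℝ ∞ u) {K : NNReal}
    (hK : LipschitzWith K u) (hK1 : K < 1) :
    ∃ D : Equiv.Perm ℂ, IsDiffeo D ∧ ∀ z, D z = z + u z := by
  have happ : ApproximatesLinearOn (fun z => z + u z)
      ((ContinuousLinearEquiv.refl ℝ ℂ : ℂ ≃L[ℝ] ℂ) : ℂ →L[ℝ] ℂ) univ K := by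
    intro x _ y _
    have := hK.dist_le_mul x y
    rw [dist_eq_norm, dist_eq_norm] at this
    have h2 : x + u x - (y + u y) -
        ((ContinuousLinearEquiv.refl ℝ ℂ : ℂ ≃L[ℝ] ℂ) : ℂ →L[ℝ] ℂ) (x - y) = u x - u y := by
      simp; ring
    simp only [h2]; exact this
  have hc : Subsingleton ℂ ∨
      K < ‖((ContinuousLinearEquiv.refl ℝ ℂ).symm : ℂ →L[ℝ] ℂ)‖₊⁻¹ := by
    right
    have : ‖((ContinuousLinearEquiv.refl ℝ ℂ).symm : ℂ →L[ℝ] ℂ)‖₊ = 1 := by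
      have : ‖(ContinuousLinearMap.id ℝ ℂ)‖₊ = 1 := by
        ext; simp
      exact this
    rw [this]; simpa using hK1
  let f := happ.toHomeomorph _ hc
  have hf : ∀ z, f z = z + u z := fun z => rfl
  have hsm : ContDiff ℝ ∞ (fun z => z + u z) := contDiff_id.add hu
  have hn : ∀ a, ‖-(fderiv ℝ u a)‖ < 1 := by
    intro a
    rw [norm_neg]
    exact (norm_fderiv_le_of_lipschitz ℝ hK).trans_lt (by exact_mod_cast hK1)
  let A : ℂ → (ℂ ≃L[ℝ] ℂ) := fun a => ContinuousLinearEquiv.unitsEquiv ℝ ℂ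
    (Units.oneSub (-(fderiv ℝ u a)) (hn a))
  have hA : ∀ a, HasFDerivAt f (A a : ℂ →L[ℝ] ℂ) a := by
    intro a
    have h1 : HasFDerivAt (fun z => z + u z) (ContinuousLinearMap.id ℝ ℂ + fderiv ℝ u a) a :=
      (hasFDerivAt_id a).add ((hu.differentiable (by simp)) a).hasFDerivAt
    have h2 : (A a : ℂ →L[ℝ] ℂ) = ContinuousLinearMap.id ℝ ℂ + fderiv ℝ u a := by
      ext v
      simp [A]
    rw [h2]; exact h1
  exact ⟨f.toEquiv, ⟨hsm, f.contDiff_symm hA hsm⟩, fun z => rfl⟩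

/-- Small complex multiples of a compactly supported vector field are displacement fields of
diffeomorphisms. -/
theorem exists_diffeo_small_mul {g : ℂ → ℂ} (hg : ContDiff ℝ ∞ g) (hc : HasCompactSupport g) :
    ∃ ε > 0, ∀ w : ℂ, ‖w‖ < ε → ∃ D : Equiv.Perm ℂ, IsDiffeo D ∧ (∀ z, D z = z + w * g z) ∧
      LipschitzWith 2⁻¹ (fun z => w * g z) := by
  obtain ⟨C, hC⟩ := hg.lipschitzWith_of_hasCompactSupport hc (by simp)
  refine ⟨1 / (2 * (C + 1)), by positivity, fun w hw => ?_⟩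
  have hlip : LipschitzWith 2⁻¹ (fun z => w * g z) := by
    refine LipschitzWith.of_dist_le_mul fun x y => ?_
    have := hC.dist_le_mul x y
    rw [dist_eq_norm, dist_eq_norm] at *
    rw [← mul_sub, norm_mul]
    have h1 : ‖w‖ * C ≤ 1 / 2 := by
      have : ‖w‖ * (C + 1) ≤ 1 / 2 := by
        rw [lt_div_iff₀ (by positivity)] at hw
        nlinarith
      nlinarith [norm_nonneg w]
    calc ‖w‖ * ‖g x - g y‖ ≤ ‖w‖ * (C * ‖x - y‖) := by gcongr
      _ = (‖w‖ * C) * ‖x - y‖ := by ring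
      _ ≤ _ := by
        push_cast
        rw [← one_div]
        gcongr
  obtain ⟨D, hD, hDz⟩ := exists_diffeo_of_lipschitz (contDiff_const.mul hg) hlip
    (by rw [← NNReal.coe_lt_coe]; norm_num)
  exact ⟨D, hD, hDz, hlip⟩

/-- Smooth cutoff functions: `1` near a compact set, compactly supported in an open set. -/
theorem exists_cutoff {C O : Set ℂ} (hC : IsCompact C) (hO : IsOpen O) (h : C ⊆ O) :
    ∃ β : ℂ → ℝ, ContDiff ℝ ∞ β ∧ (∀ z, β z ∈ Icc (0 : ℝ) 1) ∧
      (∃ U, IsOpen U ∧ C ⊆ U ∧ ∀ z ∈ U, β z = 1) ∧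
      ∃ K, IsCompact K ∧ K ⊆ O ∧ ∀ z, z ∉ K → β z = 0 := by
  obtain ⟨K₁, hK₁, hCK, hKO⟩ := exists_compact_between hC hO h
  obtain ⟨K₂, hK₂, hCK₂, hKO₂⟩ := exists_compact_between hC isOpen_interior hCK
  obtain ⟨f, hf, hr, hs, h1⟩ := exists_contMDiff_support_eq_eq_one_iff 𝓘(ℝ, ℂ) (n := ⊤)
    (isOpen_interior (s := K₁)) hK₂.isClosed hKO₂
  refine ⟨f, hf.contDiff, fun z => hr (mem_range_self z), ⟨interior K₂, isOpen_interior, hCK₂,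
    fun z hz => (h1 z).1 (interior_subset hz)⟩, K₁, hK₁, hKO, fun z hz => ?_⟩
  by_contra hne
  have : z ∈ Function.support f := hne
  rw [hs] at this
  exact hz (interior_subset this)

/-! ### Pushing along horizontal lines -/

/-- A rectangle can be pushed horizontally past its left side `re z = v`, by a diffeomorphism
supported in any neighbourhood of the rectangle and preserving each horizontal line together with
its order. -/
theorem exists_push {O : Set ℂ} (hO : IsOpen O) {v t a b : ℝ}
    (hR : ∀ z : ℂ, z.re ∈ Icc v t → z.im ∈ Icc a b → z ∈ O) :
    ∃ D : Equiv.Perm ℂ, IsDiffeo D ∧ (∃ K, IsCompact K ∧ K ⊆ O ∧ ∀ z, z ∉ K → D z = z) ∧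
      (∀ z, (D z).im = z.im) ∧ (∀ z, (D z).re ≤ z.re) ∧
      (∀ z w : ℂ, z.im = w.im → z.re < w.re → (D z).re < (D w).re) ∧
      ∀ z : ℂ, z.re ≤ t → z.im ∈ Icc a b → (D z).re ≤ v := by
  set C : Set ℂ := {z | z.re ∈ Icc v t ∧ z.im ∈ Icc a b} with hCdef
  have hCc : IsCompact C := by
    have : C = Complex.equivRealProdCLM.symm '' (Icc v t ×ˢ Icc a b) := by
      ext z
      simp only [mem_image, hCdef, mem_ofPred]
      constructor
      · intro h
        exact ⟨(z.re, z.im), h, by apply Complex.ext <;> simp⟩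
      · rintro ⟨⟨x, y⟩, h, rfl⟩
        simpa [and_and_and_comm] using h
    rw [this]
    exact (isCompact_Icc.prod isCompact_Icc).image Complex.equivRealProdCLM.symm.continuous
  obtain ⟨β, hβ, h01, ⟨U, -, hCU, hU⟩, K, hK, hKO, hK0⟩ :=
    exists_cutoff hCc hO (fun z hz => hR z hz.1 hz.2)
  have hgs : ContDiff ℝ ∞ (fun z => (β z : ℂ)) := Complex.ofRealCLM.contDiff.comp hβ
  obtain ⟨ε, hε, hD⟩ := exists_diffeo_small_mul (g := fun z => (β z : ℂ)) hgs
    (HasCompactSupport.intro hK (fun z hz => by simp [hK0 z hz]))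
  obtain ⟨D, hDd, hDz, hDl⟩ := hD ((-(ε / 2) : ℝ) : ℂ) (by
    rw [Complex.norm_real, Real.norm_eq_abs, abs_neg, abs_of_pos (by positivity)]; linarith)
  have him : ∀ z, (D z).im = z.im := fun z => by
    rw [hDz, ← Complex.ofReal_mul, Complex.add_im, Complex.ofReal_im, add_zero]
  have hre : ∀ z, (D z).re = z.re - ε / 2 * β z := fun z => by
    rw [hDz, ← Complex.ofReal_mul, Complex.add_re, Complex.ofReal_re]; ring
  have hle : ∀ z, (D z).re ≤ z.re := fun z => by
    rw [hre]; have := (h01 z).1; nlinarith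
  have hmono : ∀ z w : ℂ, z.im = w.im → z.re < w.re → (D z).re < (D w).re := by
    intro z w hi hlt
    have h1 := hDl.dist_le_mul z w
    rw [dist_eq_norm, dist_eq_norm, ← Complex.ofReal_mul, ← Complex.ofReal_mul,
      ← Complex.ofReal_sub, Complex.norm_real, Real.norm_eq_abs] at h1
    have h2 : ‖z - w‖ = w.re - z.re := by
      have : z - w = ((z.re - w.re : ℝ) : ℂ) := by
        apply Complex.ext <;> simp [hi]
      rw [this, Complex.norm_real, Real.norm_eq_abs, abs_of_neg (by linarith)]; ring
    rw [h2] at h1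
    have h3 := (abs_le.1 h1).2
    push_cast at h3
    rw [hre, hre]; linarith
  have key : ∀ n : ℕ, (∀ z, ((D ^ n) z).im = z.im) ∧ (∀ z, ((D ^ n) z).re ≤ z.re) ∧
      (∀ z w : ℂ, z.im = w.im → z.re < w.re → ((D ^ n) z).re < ((D ^ n) w).re) ∧
      ∀ z : ℂ, z.re ≤ t → z.im ∈ Icc a b → ((D ^ n) z).re ≤ max v (z.re - n * (ε / 2)) := by
    intro n
    induction n with
    | zero => simp
    | succ n ih =>
      obtain ⟨i1, i2, i3, i4⟩ := ih
      simp only [pow_succ', Equiv.Perm.mul_apply]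
      refine ⟨fun z => by rw [him, i1], fun z => (hle _).trans (i2 z),
        fun z w h1 h2 => hmono _ _ (by rw [i1, i1, h1]) (i3 z w h1 h2), fun z hz1 hz2 => ?_⟩
      have := i4 z hz1 hz2
      by_cases hv : ((D ^ n) z).re ≤ v
      · exact ((hle _).trans hv).trans (le_max_left _ _)
      · push Not at hv
        have hb : β ((D ^ n) z) = 1 := hU _ (hCU ⟨⟨hv.le, (i2 z).trans hz1⟩, by rw [i1]; exact hz2⟩)
        rw [hre, hb]
        rcases le_max_iff.1 this with h | h
        · linarith
        · refine le_max_of_le_right ?_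
          have : ((n + 1 : ℕ) : ℝ) = n + 1 := by push_cast; ring
          rw [this]; linarith
  obtain ⟨n, hn⟩ := exists_nat_gt ((t - v) / (ε / 2))
  rw [div_lt_iff₀ (by positivity)] at hn
  obtain ⟨k1, k2, k3, k4⟩ := key n
  refine ⟨D ^ n, hDd.pow n, ⟨K, hK, hKO, fun z hz => Equiv.Perm.pow_fix ?_ n⟩, k1, k2, k3,
    fun z hz1 hz2 => ?_⟩
  · rw [hDz, hK0 z hz]; simp
  · have := k4 z hz1 hz2
    rw [max_eq_left (by linarith)] at this
    exact this

/-! ### Charts and transport of diffeomorphisms -/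

/-- `Γ` is a smooth chart on the open set `O`: smooth, injective, with invertible derivative. -/
structure IsChart (Γ : ℂ → ℂ) (O : Set ℂ) : Prop where
  isOpen : IsOpen O
  injOn : InjOn Γ O
  smooth : ContDiffOn ℝ ∞ Γ O
  deriv : ∀ z ∈ O, ∃ A : ℂ ≃L[ℝ] ℂ, HasFDerivAt Γ (A : ℂ →L[ℝ] ℂ) z

theorem IsChart.exists_partialHomeomorph {Γ : ℂ → ℂ} {O : Set ℂ} (h : IsChart Γ O) :
    ∃ e : OpenPartialHomeomorph ℂ ℂ, e.source = O ∧ e.target = Γ '' O ∧ (∀ z, e z = Γ z) ∧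
      ContDiffOn ℝ ∞ e.symm e.target := by
  have hop : IsOpenMap (O.domRestrict Γ) := by
    rw [isOpenMap_iff_nhds_le]
    rintro ⟨z, hz⟩
    obtain ⟨A, hA⟩ := h.deriv z hz
    have hst : HasStrictFDerivAt Γ (A : ℂ →L[ℝ] ℂ) z :=
      (h.smooth.contDiffAt (h.isOpen.mem_nhds hz)).hasStrictFDerivAt' hA (by simp)
    have h1 := hst.map_nhds_eq_of_equiv
    have h2 : Filter.map (O.domRestrict Γ) (𝓝 ⟨z, hz⟩) = Filter.map Γ (𝓝 z) := by
      rw [← map_nhds_subtype_coe_eq_nhds hz (h.isOpen.mem_nhds hz), Filter.map_map]; rfl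
    rw [h2, h1]; rfl
  let pe : PartialEquiv ℂ ℂ := h.injOn.toPartialEquiv
  let e : OpenPartialHomeomorph ℂ ℂ := OpenPartialHomeomorph.ofContinuousOpenRestrict pe
    h.smooth.continuousOn hop h.isOpen
  refine ⟨e, rfl, rfl, fun z => rfl, fun w hw => ?_⟩
  obtain ⟨A, hA⟩ := h.deriv (e.symm w) (e.map_target hw)
  exact (e.contDiffAt_symm hw hA
    (h.smooth.contDiffAt (h.isOpen.mem_nhds (e.map_target hw)))).contDiffWithinAt

/-- A diffeomorphism compactly supported in the domain of a chart can be transported to the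
plane. -/
theorem IsChart.transport {Γ : ℂ → ℂ} {O : Set ℂ} (h : IsChart Γ O) {ψ : Equiv.Perm ℂ}
    (hψ : IsDiffeo ψ) {K : Set ℂ} (hK : IsCompact K) (hKO : K ⊆ O) (hψK : ∀ z, z ∉ K → ψ z = z) :
    ∃ D : Equiv.Perm ℂ, IsDiffeo D ∧ (∀ z ∈ O, D (Γ z) = Γ (ψ z)) ∧
      ∀ w, w ∉ Γ '' K → D w = w := by
  classical
  obtain ⟨e, hes, het, heΓ, hesm⟩ := h.exists_partialHomeomorph
  let T : Equiv.Perm ℂ → ℂ → ℂ := fun φ w => if w ∈ e.target then Γ (φ (e.symm w)) else w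
  have hΓK : IsCompact (Γ '' K) := hK.image_of_continuousOn (h.smooth.continuousOn.mono hKO)
  have hsymm : ∀ z ∈ O, e.symm (Γ z) = z := fun z hz => by
    rw [← heΓ]; exact e.left_inv (hes ▸ hz)
  have htgt : ∀ z ∈ O, Γ z ∈ e.target := fun z hz => by rw [het]; exact mem_image_of_mem _ hz
  have hTO : ∀ φ : Equiv.Perm ℂ, ∀ z ∈ O, T φ (Γ z) = Γ (φ z) := fun φ z hz => by
    simp only [T, if_pos (htgt z hz), hsymm z hz]
  have hfix : ∀ φ : Equiv.Perm ℂ, (∀ z, z ∉ K → φ z = z) → ∀ w, w ∉ Γ '' K → T φ w = w := by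
    intro φ hφ w hw
    by_cases hwt : w ∈ e.target
    · rw [het] at hwt
      obtain ⟨z, hz, rfl⟩ := hwt
      rw [hTO φ z hz, hφ z (fun hzK => hw (mem_image_of_mem _ hzK))]
    · simp only [T, if_neg hwt]
  have hmem : ∀ φ : Equiv.Perm ℂ, (∀ z, z ∉ K → φ z = z) → ∀ z ∈ O, φ z ∈ O := fun φ hφ z hz =>
    Equiv.Perm.mem_of_fix (fun y hy => hφ y (fun hyK => hy (hKO hyK))) hz
  have hsmooth : ∀ φ : Equiv.Perm ℂ, IsDiffeo φ → (∀ z, z ∉ K → φ z = z) →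
      ContDiff ℝ ∞ (T φ) := by
    intro φ hφ hφK
    rw [contDiff_iff_contDiffAt]
    intro w
    by_cases hw : w ∈ Γ '' K
    · have hwt : w ∈ e.target := by rw [het]; exact image_mono hKO hw
      have hwO : e.symm w ∈ O := by rw [← hes]; exact e.map_target hwt
      have h1 : ContDiffAt ℝ ∞ (fun w => Γ (φ (e.symm w))) w := by
        have h2 : ContDiffAt ℝ ∞ e.symm w := hesm.contDiffAt (e.open_target.mem_nhds hwt)
        have h3 : ContDiffAt ℝ ∞ Γ (φ (e.symm w)) :=
          h.smooth.contDiffAt (h.isOpen.mem_nhds (hmem φ hφK _ hwO))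
        exact h3.comp w (hφ.1.contDiffAt.comp w h2)
      refine h1.congr_of_eventuallyEq ?_
      filter_upwards [e.open_target.mem_nhds hwt] with y hy
      simp only [T, if_pos hy]
    · refine contDiffAt_id.congr_of_eventuallyEq ?_
      filter_upwards [hΓK.isClosed.isOpen_compl.mem_nhds hw] with y hy
      exact hfix φ hφK y hy
  have hinvK : ∀ z, z ∉ K → ψ⁻¹ z = z := fun z hz => Equiv.Perm.inv_fix (hψK z hz)
  have hcomp : ∀ φ φ' : Equiv.Perm ℂ, (∀ z, φ (φ' z) = z) → (∀ z, z ∉ K → φ z = z) →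
      (∀ z, z ∉ K → φ' z = z) → ∀ w, T φ (T φ' w) = w := by
    intro φ φ' hφφ hφ hφ' w
    by_cases hwt : w ∈ e.target
    · rw [het] at hwt
      obtain ⟨z, hz, rfl⟩ := hwt
      rw [hTO φ' z hz, hTO φ _ (hmem φ' hφ' z hz), hφφ]
    · have : T φ' w = w := by simp only [T, if_neg hwt]
      rw [this]; simp only [T, if_neg hwt]
  let D : Equiv.Perm ℂ := ⟨T ψ, T ψ⁻¹, hcomp _ _ (fun z => by simp) hinvK hψK,
    hcomp _ _ (fun z => by simp) hψK hinvK⟩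
  exact ⟨D, ⟨hsmooth ψ hψ hψK, hsmooth ψ⁻¹ hψ.inv hinvK⟩, hTO ψ, hfix ψ hψK⟩

/-- Pushing along the horizontal lines of a chart. The rectangle `[v, t] × [a, b]` is pushed past
its left side inside any open set `O₁` of the chart domain. -/
theorem IsChart.exists_push {Γ : ℂ → ℂ} {O : Set ℂ} (h : IsChart Γ O) {O₁ : Set ℂ}
    (hO₁ : IsOpen O₁) (hO₁O : O₁ ⊆ O) {v t a b : ℝ}
    (hR : ∀ z : ℂ, z.re ∈ Icc v t → z.im ∈ Icc a b → z ∈ O₁) :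
    ∃ D ψ : Equiv.Perm ℂ, IsDiffeo D ∧ IsDiffeo ψ ∧ (∀ z ∈ O, D (Γ z) = Γ (ψ z)) ∧
      (∀ w, w ∉ Γ '' O₁ → D w = w) ∧ (∀ z, z ∉ O₁ → ψ z = z) ∧
      (∀ z, (ψ z).im = z.im) ∧ (∀ z, (ψ z).re ≤ z.re) ∧
      (∀ z w : ℂ, z.im = w.im → z.re < w.re → (ψ z).re < (ψ w).re) ∧
      ∀ z : ℂ, z.re ≤ t → z.im ∈ Icc a b → (ψ z).re ≤ v := by
  obtain ⟨ψ, hψ, ⟨K, hK, hKO, hψK⟩, h1, h2, h3, h4⟩ := _root_.exists_push hO₁ hR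
  obtain ⟨D, hD, hD1, hD2⟩ := h.transport hψ hK (hKO.trans hO₁O) hψK
  exact ⟨D, ψ, hD, hψ, hD1, fun w hw => hD2 w (fun hc => hw (image_mono hKO hc)),
    fun z hz => hψK z (fun hc => hz (hKO hc)), h1, h2, h3, h4⟩

/-! ### Radial stretching -/

/-- A diffeomorphism preserving each ray from the origin, equal to the identity on the disc of
radius `ρ < R`, and taking the disc of radius `R` to that of radius `R + 1`. -/
theorem exists_stretch {ρ R : ℝ} (hρ : 0 ≤ ρ) (hρR : ρ < R) :
    ∃ D : Equiv.Perm ℂ, IsDiffeo D ∧ (∀ z : ℂ, ‖z‖ ≤ ρ → D z = z) ∧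
      (∀ z, ∃ a : ℝ, D z = a • z) ∧ (∀ z, ∃ a : ℝ, z = a • D z) ∧
      (∀ z, ‖D z‖ < R + 1 ↔ ‖z‖ < R) ∧ (∀ z, R < ‖z‖ → R + 1 < ‖D z‖) := by
  have hR : 0 < R := hρ.trans_lt hρR
  set b : ℝ → ℝ := fun s => Real.smoothTransition ((s - ρ ^ 2) / (R ^ 2 - ρ ^ 2)) *
    Real.smoothTransition (((R + 2) ^ 2 - s) / ((R + 2) ^ 2 - (R + 1) ^ 2)) with hb
  have hd1 : 0 < R ^ 2 - ρ ^ 2 := by nlinarith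
  have hd2 : 0 < (R + 2) ^ 2 - (R + 1) ^ 2 := by nlinarith
  have hb0 : ∀ s, 0 ≤ b s := fun s =>
    mul_nonneg (Real.smoothTransition.nonneg _) (Real.smoothTransition.nonneg _)
  have hbs : ContDiff ℝ ∞ b := by
    apply ContDiff.mul
    · exact Real.smoothTransition.contDiff.comp (by fun_prop)
    · exact Real.smoothTransition.contDiff.comp (by fun_prop)
  have hbρ : ∀ s, s ≤ ρ ^ 2 → b s = 0 := fun s hs => by
    simp only [hb]
    rw [Real.smoothTransition.zero_of_nonpos (div_nonpos_of_nonpos_of_nonneg (by linarith) hd1.le),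
      zero_mul]
  have hb2 : ∀ s, (R + 2) ^ 2 ≤ s → b s = 0 := fun s hs => by
    simp only [hb]
    rw [Real.smoothTransition.zero_of_nonpos (x := ((R + 2) ^ 2 - s) / _)
      (div_nonpos_of_nonpos_of_nonneg (by linarith) hd2.le), mul_zero]
  have hb1 : ∀ s, R ^ 2 ≤ s → s ≤ (R + 1) ^ 2 → b s = 1 := fun s hs hs' => by
    simp only [hb]
    rw [Real.smoothTransition.one_of_one_le (by rw [le_div_iff₀ hd1]; linarith),
      Real.smoothTransition.one_of_one_le (by rw [le_div_iff₀ hd2]; linarith), mul_one]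
  -- the field `b (‖z‖ ^ 2) z` equals `z` for `R ≤ ‖z‖ ≤ R + 1`, so one small step multiplies there
  -- by a constant `q`; `n` steps with `q ^ n = (R + 1) / R` do what is wanted
  obtain ⟨ε, hε, hD⟩ := exists_diffeo_small_mul (g := fun z => (b (‖z‖ ^ 2) : ℂ) * z)
    ((Complex.ofRealCLM.contDiff.comp (hbs.comp (contDiff_norm_sq ℝ))).mul contDiff_id)
    (HasCompactSupport.intro (isCompact_closedBall (0 : ℂ) (R + 2)) (fun z hz => by
      rw [mem_closedBall_zero_iff, not_le] at hz
      simp [hb2 (‖z‖ ^ 2) (by nlinarith [norm_nonneg z])]))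
  have ht : Tendsto (fun n : ℕ => ((R + 1) / R) ^ ((1 : ℝ) / n) - 1) atTop (𝓝 0) := by
    have h1 : Tendsto (fun n : ℕ => (1 : ℝ) / n) atTop (𝓝 0) := tendsto_one_div_atTop_nhds_zero_nat
    have h2 := (Real.continuous_const_rpow (a := (R + 1) / R) (by positivity)).tendsto 0 |>.comp h1
    simpa using h2.sub_const 1
  obtain ⟨n, hn, hn0⟩ := ((ht.eventually (Metric.ball_mem_nhds 0 hε)).and
    (eventually_gt_atTop 0)).exists
  set q : ℝ := ((R + 1) / R) ^ ((1 : ℝ) / n) with hq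
  have hqn : R * q ^ n = R + 1 := by
    rw [hq, ← Real.rpow_natCast, ← Real.rpow_mul (by positivity), one_div,
      inv_mul_cancel₀ (by exact_mod_cast hn0.ne'), Real.rpow_one]
    field_simp
  have hq1 : 1 ≤ q := Real.one_le_rpow (by rw [le_div_iff₀ hR]; linarith) (by positivity)
  obtain ⟨D, hDd, hDz, hDl⟩ := hD ((q - 1 : ℝ) : ℂ) (by
    rw [Complex.norm_real]; simpa using hn)
  have hform : ∀ z, D z = (1 + (q - 1) * b (‖z‖ ^ 2)) • z := fun z => by
    rw [hDz, Complex.real_smul]; push_cast; ring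
  have hpos : ∀ z : ℂ, 0 < 1 + (q - 1) * b (‖z‖ ^ 2) := fun z => by
    have := mul_nonneg (sub_nonneg.2 hq1) (hb0 (‖z‖ ^ 2)); linarith
  have hnorm : ∀ z, ‖D z‖ = (1 + (q - 1) * b (‖z‖ ^ 2)) * ‖z‖ := fun z => by
    rw [hform, norm_smul, Real.norm_of_nonneg (hpos z).le]
  have hmono : ∀ z w, ‖z‖ < ‖w‖ → ‖D z‖ < ‖D w‖ := by
    intro z w hzw
    have h1 := hDl.dist_le_mul (‖z‖ : ℂ) (‖w‖ : ℂ)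
    simp only [Complex.norm_real, norm_norm] at h1
    rw [dist_eq_norm, dist_eq_norm, ← Complex.ofReal_mul, ← Complex.ofReal_mul,
      ← Complex.ofReal_mul, ← Complex.ofReal_mul, ← Complex.ofReal_sub, ← Complex.ofReal_sub,
      Complex.norm_real, Complex.norm_real, Real.norm_eq_abs, Real.norm_eq_abs,
      abs_sub_comm ‖z‖, abs_of_pos (by linarith : 0 < ‖w‖ - ‖z‖)] at h1
    have h2 := (abs_le.1 h1).2
    push_cast at h2
    rw [hnorm, hnorm]; nlinarith
  have heq : ∀ z w, ‖z‖ = ‖w‖ → ‖D z‖ = ‖D w‖ := fun z w h => by rw [hnorm, hnorm, h]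
  have key : ∀ k : ℕ, (∀ z w, ‖z‖ < ‖w‖ → ‖(D ^ k) z‖ < ‖(D ^ k) w‖) ∧
      (∀ z w, ‖z‖ = ‖w‖ → ‖(D ^ k) z‖ = ‖(D ^ k) w‖) ∧
      (∀ z, ∃ a : ℝ, a ≠ 0 ∧ (D ^ k) z = a • z) ∧
      (k ≤ n → ‖(D ^ k) (R : ℂ)‖ = R * q ^ k) := by
    intro k
    induction k with
    | zero => exact ⟨fun z w h => h, fun z w h => h, fun z => ⟨1, one_ne_zero, by simp⟩,
        fun _ => by simp [abs_of_pos hR]⟩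
    | succ k ih =>
      obtain ⟨i1, i2, i3, i4⟩ := ih
      simp only [pow_succ' D, Equiv.Perm.mul_apply]
      refine ⟨fun z w h => hmono _ _ (i1 z w h), fun z w h => heq _ _ (i2 z w h), fun z => ?_,
        fun hk => ?_⟩
      · obtain ⟨a, ha0, ha⟩ := i3 z
        exact ⟨_, mul_ne_zero (hpos _).ne' ha0, by rw [hform ((D ^ k) z), ha, smul_smul]⟩
      · have h4 := i4 ((Nat.le_succ k).trans hk)
        have hk1 : 1 ≤ q ^ k := one_le_pow₀ hq1
        have hk2 : R * q ^ k ≤ R + 1 := by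
          rw [← hqn]
          gcongr
          omega
        rw [hnorm, h4, hb1 _ (by gcongr; nlinarith) (by gcongr)]
        ring
  obtain ⟨k1, k2, k3, k4⟩ := key n
  have hRn : ‖(D ^ n) (R : ℂ)‖ = R + 1 := by rw [k4 le_rfl, hqn]
  have hRR : ‖(R : ℂ)‖ = R := by rw [Complex.norm_real, Real.norm_of_nonneg hR.le]
  refine ⟨D ^ n, hDd.pow n, fun z hz => Equiv.Perm.pow_fix ?_ n, fun z => ?_, fun z => ?_,
    fun z => ⟨fun h => ?_, fun h => ?_⟩, fun z hz => ?_⟩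
  · rw [hform, hbρ _ (by gcongr)]; simp
  · obtain ⟨a, -, ha⟩ := k3 z; exact ⟨a, ha⟩
  · obtain ⟨a, ha0, ha⟩ := k3 z
    exact ⟨a⁻¹, by rw [ha, smul_smul, inv_mul_cancel₀ ha0, one_smul]⟩
  · by_contra hle
    push Not at hle
    rcases hle.lt_or_eq with hlt | he
    · have := k1 (R : ℂ) z (by rw [hRR]; exact hlt)
      linarith
    · have := k2 (R : ℂ) z (by rw [hRR]; exact he)
      linarith
  · have := k1 z (R : ℂ) (by rw [hRR]; exact h)
    linarith
  · have := k1 (R : ℂ) z (by rw [hRR]; exact hz)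
    linarith

/-! ### Families of rays in `ℂ` -/

/-- A smooth proper embedding of `S × [0, ∞)` into `ℂ`, `S` discrete. -/
structure IsRayFamily {S : Type*} [TopologicalSpace S] [DiscreteTopology S]
    (c : S → ℝ → ℂ) : Prop where
  smooth : ∀ i, ContDiff ℝ ∞ (c i)
  immersive : ∀ i, ∀ t, 0 ≤ t → deriv (c i) t ≠ 0
  injective : Function.Injective (fun p : S × Ici (0 : ℝ) => c p.1 p.2)
  proper : IsProperMap (fun p : S × Ici (0 : ℝ) => c p.1 p.2)

/-- The union of the rays of a family. -/
def rayUnion {S : Type*} (c : S → ℝ → ℂ) : Set ℂ := {z | ∃ i, ∃ t, 0 ≤ t ∧ c i t = z}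

/-- The points of the rays of a family that are at distance at least `R` from the origin. -/
def outerPart {S : Type*} (c : S → ℝ → ℂ) (R : ℝ) : Set ℂ :=
  {z | R ≤ ‖z‖ ∧ z ∈ rayUnion c}

/-- Diffeomorphisms have invertible derivatives. -/
theorem IsDiffeo.hasFDerivAt {D : Equiv.Perm ℂ} (hD : IsDiffeo D) (z : ℂ) :
    ∃ A : ℂ ≃L[ℝ] ℂ, HasFDerivAt D (A : ℂ →L[ℝ] ℂ) z := by
  have h1 := (hD.1.differentiable (by simp) z).hasFDerivAt
  have h2 := (hD.2.differentiable (by simp) (D z)).hasFDerivAt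
  have h2' : HasFDerivAt D.symm (fderiv ℝ D.symm (D z)) (D z) := h2
  have h3 : HasFDerivAt (D.symm ∘ D) _ z := h2'.comp z h1
  have h1' : HasFDerivAt D (fderiv ℝ D z) (D.symm (D z)) := by rwa [Equiv.symm_apply_apply]
  have h4 : HasFDerivAt (D ∘ D.symm) _ (D z) := h1'.comp (D z) h2'
  rw [Equiv.symm_comp_self] at h3
  rw [Equiv.self_comp_symm] at h4
  have e3 := h3.unique (hasFDerivAt_id z)
  have e4 := h4.unique (hasFDerivAt_id (D z))
  refine ⟨ContinuousLinearEquiv.equivOfInverse (fderiv ℝ D z) (fderiv ℝ D.symm (D z))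
    (fun v => ?_) (fun v => ?_), h1⟩
  · exact DFunLike.congr_fun e3 v
  · exact DFunLike.congr_fun e4 v

namespace IsRayFamily

variable {S : Type*} [TopologicalSpace S] [DiscreteTopology S] {c : S → ℝ → ℂ}

theorem comp (hc : IsRayFamily c) {D : Equiv.Perm ℂ} (hD : IsDiffeo D) :
    IsRayFamily (fun i t => D (c i t)) where
  smooth i := hD.1.comp (hc.smooth i)
  immersive i t ht := by
    obtain ⟨A, hA⟩ := hD.hasFDerivAt (c i t)
    have h1 : HasDerivAt (c i) (deriv (c i) t) t :=
      ((hc.smooth i).differentiable (by simp) t).hasDerivAt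
    have h2 : HasDerivAt (fun t => D (c i t)) (A (deriv (c i) t)) t := hA.comp_hasDerivAt t h1
    rw [h2.deriv]
    simpa using hc.immersive i t ht
  injective := D.injective.comp hc.injective
  proper := hD.homeo.isProperMap.comp hc.proper

theorem eq_of_apply_eq (hc : IsRayFamily c) {i j : S} {s t : ℝ} (hs : 0 ≤ s) (ht : 0 ≤ t)
    (h : c i s = c j t) : i = j ∧ s = t := by
  obtain ⟨h1, h2⟩ := Prod.mk.inj (hc.injective (a₁ := (i, ⟨s, hs⟩)) (a₂ := (j, ⟨t, ht⟩)) h)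
  exact ⟨h1, congrArg Subtype.val h2⟩

theorem isClosed_image (hc : IsRayFamily c) {T : S → Set ℝ} (hT : ∀ i, IsClosed (T i)) :
    IsClosed {z | ∃ i, ∃ t, 0 ≤ t ∧ t ∈ T i ∧ c i t = z} := by
  have h1 : IsClosed {p : S × Ici (0 : ℝ) | (p.2 : ℝ) ∈ T p.1} := by
    rw [← isOpen_compl_iff, isOpen_prod_iff]
    intro i t ht
    exact ⟨{i}, (fun x : Ici (0 : ℝ) => (x : ℝ)) ⁻¹' (T i)ᶜ, isOpen_discrete _,
      (hT i).isOpen_compl.preimage continuous_subtype_val, rfl, ht, by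
        rintro ⟨j, s⟩ ⟨hj, hs⟩
        rw [mem_singleton_iff] at hj
        subst hj
        exact hs⟩
  have h2 := hc.proper.isClosedMap _ h1
  convert h2 using 1
  ext z
  constructor
  · rintro ⟨i, t, ht, hT, rfl⟩
    exact ⟨(i, ⟨t, ht⟩), hT, rfl⟩
  · rintro ⟨⟨i, t⟩, hT, rfl⟩
    exact ⟨i, t, t.2, hT, rfl⟩

theorem isClosed_rayUnion (hc : IsRayFamily c) : IsClosed (rayUnion c) := by
  have := hc.isClosed_image (T := fun _ => univ) (fun _ => isClosed_univ)
  simpa [rayUnion] using this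

theorem finite_meeting (hc : IsRayFamily c) {K : Set ℂ} (hK : IsCompact K) :
    ∃ F : Finset S, ∃ T : ℝ, 0 ≤ T ∧ ∀ i t, 0 ≤ t → c i t ∈ K → i ∈ F ∧ t < T := by
  have h1 := hc.proper.isCompact_preimage hK
  have h2 := (h1.image continuous_fst).finite_of_discrete
  have h3 := h1.image (continuous_subtype_val.comp continuous_snd)
  obtain ⟨T, hT⟩ := h3.bddAbove
  refine ⟨h2.toFinset, max 0 (T + 1), le_max_left _ _, fun i t ht hK => ⟨?_, ?_⟩⟩
  · simp only [Finite.mem_toFinset]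
    exact ⟨(i, ⟨t, ht⟩), hK, rfl⟩
  · have : t ≤ T := hT ⟨(i, ⟨t, ht⟩), hK, rfl⟩
    exact lt_max_of_lt_right (by linarith)

theorem exists_gt_norm (hc : IsRayFamily c) (i : S) (M : ℝ) :
    ∃ T, 0 ≤ T ∧ ∀ t, T ≤ t → M < ‖c i t‖ := by
  obtain ⟨F, T, hT, h⟩ := hc.finite_meeting (isCompact_closedBall (0 : ℂ) M)
  refine ⟨T, hT, fun t ht => ?_⟩
  by_contra hle
  push Not at hle
  have := (h i t (hT.trans ht) (by simpa using hle)).2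
  linarith

/-! ### Tubes and slides along a ray -/

/-- A tubular chart around a compact initial piece of a ray of the family: the real axis
parametrizes the ray, slightly extended beyond its origin, and no other point of the chart lies on
a ray. -/
theorem exists_tube (hc : IsRayFamily c) (i : S) {T : ℝ} (hT : 0 ≤ T) :
    ∃ (Γ : ℂ → ℂ) (O : Set ℂ), IsChart Γ O ∧ (∃ δ > 0, ∀ x : ℝ, x ∈ Icc (-δ) T → (x : ℂ) ∈ O) ∧
      (∀ x : ℝ, Γ x = c i x) ∧
      (∀ z ∈ O, ∀ j t, 0 ≤ t → Γ z = c j t → j = i ∧ z = (t : ℂ)) := by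
  have hci := hc.smooth i
  have hc1 : ContDiff ℝ ∞ (deriv (c i)) := by
    have h := hci.iterate_deriv 1
    simpa using h
  set Γ : ℂ → ℂ := fun z => c i z.re + Complex.I * z.im * deriv (c i) z.re with hΓ
  have hΓs : ContDiff ℝ ∞ Γ := by
    have h1 : ContDiff ℝ ∞ (fun z : ℂ => c i z.re) := hci.comp Complex.reCLM.contDiff
    have h2 : ContDiff ℝ ∞ (fun z : ℂ => deriv (c i) z.re) := hc1.comp Complex.reCLM.contDiff
    have h3 : ContDiff ℝ ∞ (fun z : ℂ => Complex.I * z.im) :=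
      contDiff_const.mul (Complex.ofRealCLM.contDiff.comp Complex.imCLM.contDiff)
    exact h1.add (h3.mul h2)
  have hΓx : ∀ x : ℝ, Γ x = c i x := fun x => by simp [hΓ]
  have hder : ∀ x : ℝ, HasFDerivAt Γ ((deriv (c i) x) • ContinuousLinearMap.id ℝ ℂ) (x : ℂ) := by
    intro x
    have h1 : HasDerivAt (c i) (deriv (c i) x) ((x : ℂ).re) :=
      (hci.differentiable (by simp) _).hasDerivAt
    have h2 : HasDerivAt (deriv (c i)) (deriv (deriv (c i)) x) ((x : ℂ).re) :=
      (hc1.differentiable (by simp) _).hasDerivAt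
    have e1 : HasFDerivAt (fun z : ℂ => c i z.re) _ (x : ℂ) :=
      h1.hasFDerivAt.comp (x : ℂ) Complex.reCLM.hasFDerivAt
    have e2 : HasFDerivAt (fun z : ℂ => deriv (c i) z.re) _ (x : ℂ) :=
      h2.hasFDerivAt.comp (x : ℂ) Complex.reCLM.hasFDerivAt
    have e3 : HasFDerivAt (fun z : ℂ => Complex.I * (z.im : ℂ)) _ (x : ℂ) :=
      (Complex.ofRealCLM.hasFDerivAt.comp (x : ℂ) Complex.imCLM.hasFDerivAt).const_mul Complex.I
    have e4 := e1.add (e3.mul e2)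
    refine e4.congr_fderiv ?_
    ext v
    simp
    conv_rhs => rw [← Complex.re_add_im v]
    ring
  have hdet : IsOpen {z : ℂ | ∃ A : ℂ ≃L[ℝ] ℂ, (A : ℂ →L[ℝ] ℂ) = fderiv ℝ Γ z} := by
    have h1 : IsOpen (range ((↑) : (ℂ ≃L[ℝ] ℂ) → ℂ →L[ℝ] ℂ)) := ContinuousLinearEquiv.isOpen
    exact h1.preimage (hΓs.continuous_fderiv (by simp))
  have hunit : ∀ x : ℝ, 0 ≤ x →
      ∃ A : ℂ ≃L[ℝ] ℂ, (A : ℂ →L[ℝ] ℂ) = (deriv (c i) x) • ContinuousLinearMap.id ℝ ℂ := by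
    intro x hx
    have h0 := hc.immersive i x hx
    refine ⟨ContinuousLinearEquiv.equivOfInverse ((deriv (c i) x) • ContinuousLinearMap.id ℝ ℂ)
      ((deriv (c i) x)⁻¹ • ContinuousLinearMap.id ℝ ℂ) (fun v => ?_) (fun v => ?_), rfl⟩
    · simp [h0]
    · simp [h0]
  set K : Set ℂ := (fun x : ℝ => (x : ℂ)) '' Icc 0 (T + 1) with hK
  have hKc : IsCompact K := isCompact_Icc.image Complex.continuous_ofReal
  have hinj : InjOn Γ K := by
    rintro _ ⟨x, hx, rfl⟩ _ ⟨y, hy, rfl⟩ hxy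
    rw [hΓx, hΓx] at hxy
    rw [(hc.eq_of_apply_eq hx.1 hy.1 hxy).2]
  have hloc : ∀ z ∈ K, ∃ u ∈ 𝓝 z, InjOn Γ u := by
    rintro _ ⟨x, hx, rfl⟩
    obtain ⟨A, hA⟩ := hunit x hx.1
    have hst : HasStrictFDerivAt Γ (A : ℂ →L[ℝ] ℂ) (x : ℂ) :=
      hΓs.contDiffAt.hasStrictFDerivAt' (hA ▸ hder x) (by simp)
    exact ⟨_, (hst.toOpenPartialHomeomorph Γ).open_source.mem_nhds
      hst.mem_toOpenPartialHomeomorph_source, (hst.toOpenPartialHomeomorph Γ).injOn⟩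
  obtain ⟨U, hUo, hKU, hUinj⟩ :=
    hinj.exists_isOpen_superset hKc (fun z _ => hΓs.continuous.continuousAt) hloc
  classical
  have hYc := hc.isClosed_image (T := fun j => if j = i then Ici (T + 1) else univ)
    (fun j => by by_cases h : j = i <;> simp [h, isClosed_Ici])
  set Y := {z | ∃ j, ∃ t, 0 ≤ t ∧ t ∈ (if j = i then Ici (T + 1) else univ) ∧ c j t = z} with hY
  set O : Set ℂ := U ∩ Γ ⁻¹' Yᶜ ∩ {z : ℂ | ∃ A : ℂ ≃L[ℝ] ℂ, (A : ℂ →L[ℝ] ℂ) = fderiv ℝ Γ z}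
    with hO
  have hOo : IsOpen O := (hUo.inter (hYc.isOpen_compl.preimage hΓs.continuous)).inter hdet
  have hOx : ∀ x : ℝ, x ∈ Icc 0 T → (x : ℂ) ∈ O := by
    intro x hx
    refine ⟨⟨hKU ⟨x, ⟨hx.1, by linarith [hx.2]⟩, rfl⟩, ?_⟩, ?_⟩
    · rintro ⟨j, t, ht, htT, hjt⟩
      rw [hΓx] at hjt
      obtain ⟨rfl, rfl⟩ := hc.eq_of_apply_eq ht hx.1 hjt
      rw [if_pos rfl, mem_Ici] at htT
      linarith [hx.2]
    · obtain ⟨A, hA⟩ := hunit x hx.1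
      exact ⟨A, by rw [hA, (hder x).fderiv]⟩
  refine ⟨Γ, O, ⟨hOo, hUinj.mono (fun z hz => hz.1.1), hΓs.contDiffOn, fun z hz => ?_⟩, ?_, hΓx,
    ?_⟩
  · obtain ⟨A, hA⟩ := hz.2
    exact ⟨A, hA ▸ (hΓs.differentiable (by simp) z).hasFDerivAt⟩
  · have h0 : (fun x : ℝ => (x : ℂ)) ⁻¹' O ∈ 𝓝 (0 : ℝ) :=
      (hOo.preimage Complex.continuous_ofReal).mem_nhds (hOx 0 ⟨le_rfl, hT⟩)
    obtain ⟨δ, hδ, hb⟩ := Metric.mem_nhds_iff.1 h0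
    refine ⟨δ / 2, by positivity, fun x hx => ?_⟩
    by_cases hx0 : 0 ≤ x
    · exact hOx x ⟨hx0, hx.2⟩
    · apply hb
      rw [Metric.mem_ball, dist_zero_right, Real.norm_eq_abs, abs_lt]
      push Not at hx0
      constructor <;> linarith [hx.1]
  · intro z hz j t ht hzt
    have hzY := hz.1.2
    have hj : j = i ∧ t < T + 1 := by
      by_contra hcon
      apply hzY
      refine ⟨j, t, ht, ?_, hzt.symm⟩
      by_cases hji : j = i
      · simp only [hji, true_and, not_lt] at hcon
        simpa [hji] using hcon
      · simp [hji]
    refine ⟨hj.1, hUinj hz.1.1 (hKU ⟨t, ⟨ht, hj.2.le⟩, rfl⟩) ?_⟩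
    rw [hzt, hΓx, hj.1]

end IsRayFamily

namespace IsRayFamily

variable {S : Type*} [TopologicalSpace S] [DiscreteTopology S] {c : S → ℝ → ℂ}

/-- Sliding along the `i`-th ray: the point with parameter `T` is pulled back below the parameter
`s`, near the piece of the ray between the two, while all other rays stay fixed pointwise. If
`s = 0`, the ray is pulled out of itself beyond its origin. -/
theorem exists_slide (hc : IsRayFamily c) (i : S) {s T : ℝ} (hs : 0 ≤ s) (hsT : s ≤ T) {W : Set ℂ}
    (hW : IsOpen W) (hcW : ∀ t ∈ Icc s T, c i t ∈ W) :
    ∃ (D : Equiv.Perm ℂ) (m : ℝ ≃o ℝ), IsDiffeo D ∧ (∀ z, z ∉ W → D z = z) ∧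
      (∀ t, 0 ≤ t → D (c i t) = c i (m t)) ∧ m T < s ∧ (0 < s → m 0 = 0) ∧
      ∀ j, j ≠ i → ∀ t, 0 ≤ t → D (c j t) = c j t := by
  obtain ⟨Γ, O, hΓ, ⟨δ, hδ, hδO⟩, hΓx, hΓc⟩ := hc.exists_tube i (hs.trans hsT)
  have hOW : IsOpen (O ∩ Γ ⁻¹' W) := hΓ.smooth.continuousOn.isOpen_inter_preimage hΓ.isOpen hW
  have hmem : ∀ x ∈ Icc s T, (x : ℂ) ∈ O ∩ Γ ⁻¹' W := fun x hx =>
    ⟨hδO x ⟨by linarith [hx.1], hx.2⟩, by rw [mem_preimage, hΓx]; exact hcW x hx⟩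
  obtain ⟨v', hv's, hv'0, hv'⟩ : ∃ v', v' < s ∧ (0 < s → 0 ≤ v') ∧
      ∀ x ∈ Ioc v' s, (x : ℂ) ∈ O ∩ Γ ⁻¹' W := by
    have h0 : (fun x : ℝ => (x : ℂ)) ⁻¹' (O ∩ Γ ⁻¹' W) ∈ 𝓝 s :=
      (hOW.preimage Complex.continuous_ofReal).mem_nhds (hmem s ⟨le_rfl, hsT⟩)
    obtain ⟨l, hl, hls⟩ := exists_Ioc_subset_of_mem_nhds h0 ⟨s - 1, by linarith⟩
    by_cases h : 0 < s
    · exact ⟨max l 0, max_lt hl h, fun _ => le_max_right _ _, fun x hx =>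
        hls ⟨(le_max_left _ _).trans_lt hx.1, hx.2⟩⟩
    · exact ⟨l, hl, fun h' => absurd h' h, fun x hx => hls hx⟩
  set O₁ : Set ℂ := (O ∩ Γ ⁻¹' W) ∩ {z | v' < z.re} with hO₁
  have hO₁o : IsOpen O₁ := hOW.inter (isOpen_lt continuous_const Complex.continuous_re)
  obtain ⟨D, ψ, hD, hψ, hDΓ, hDfix, hψfix, him, -, hmono, hpush⟩ :=
    hΓ.exists_push hO₁o (fun z hz => hz.1.1) (v := (v' + s) / 2) (t := T) (a := 0) (b := 0) (by
      intro z hz1 hz2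
      have hz : z = (z.re : ℂ) := by
        apply Complex.ext
        · simp
        · simpa using le_antisymm hz2.2 hz2.1
      refine ⟨?_, show v' < z.re by linarith [hz1.1]⟩
      rw [hz]
      rcases le_total z.re s with h | h
      · exact hv' _ ⟨by linarith [hz1.1], h⟩
      · exact hmem _ ⟨h, hz1.2⟩)
  set m : ℝ → ℝ := fun x => (ψ x).re with hm
  have hψm : ∀ x : ℝ, ψ x = (m x : ℂ) := fun x => by
    apply Complex.ext
    · simp [hm]
    · simp [him]
  have hmm : StrictMono m := fun x y hxy => hmono x y (by simp) (by simpa using hxy)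
  have hms : Function.Surjective m := fun y => by
    refine ⟨(ψ.symm y).re, ?_⟩
    have h1 : (((ψ.symm y).re : ℝ) : ℂ) = ψ.symm y := by
      apply Complex.ext
      · simp
      · have := him (ψ.symm y)
        simp only [Equiv.apply_symm_apply, Complex.ofReal_im] at this ⊢
        exact this
    simp only [hm, h1, Equiv.apply_symm_apply, Complex.ofReal_re]
  refine ⟨D, hmm.orderIsoOfSurjective m hms, hD, fun z hz => hDfix z ?_, fun t ht => ?_,
    ?_, fun h => ?_, fun j hj t ht => hDfix _ ?_⟩
  · rintro ⟨y, hy, rfl⟩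
    exact hz hy.1.2
  · change D (c i t) = c i (m t)
    by_cases htO : (t : ℂ) ∈ O
    · rw [← hΓx, hDΓ _ htO, hψm, hΓx]
    · have h1 : m t = t := by
        simp only [hm]
        rw [hψfix _ (fun h => htO h.1.1), Complex.ofReal_re]
      rw [h1]
      refine hDfix _ ?_
      rintro ⟨y, hy, hyt⟩
      have := (hΓc y hy.1.1 i t ht hyt).2
      exact htO (this ▸ hy.1.1)
  · change m T < s
    have := hpush T (by simp) (by simp)
    have h2 : m T ≤ (v' + s) / 2 := this
    linarith
  · change m 0 = 0
    simp only [hm]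
    rw [hψfix]
    · simp
    · rintro ⟨-, h2⟩
      have := hv'0 h
      simp only [mem_ofPred, Complex.ofReal_re] at h2
      linarith
  · rintro ⟨y, hy, hyt⟩
    exact hj (hΓc y hy.1.1 j t ht hyt).1

end IsRayFamily

/-! ### Free and attached rays -/

/-- A ray is free at radius `R` if it stays strictly outside the closed disc of radius `R`. -/
def IsFreeRay (γ : ℝ → ℂ) (R : ℝ) : Prop := ∀ t, 0 ≤ t → R < ‖γ t‖

/-- A ray is attached at radius `R` if its part in the open disc of radius `R` is a nonempty
initial piece, along which (and up to the circle) it is radial. -/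
def IsAttachedRay (γ : ℝ → ℂ) (R : ℝ) : Prop :=
  ∃ s, 0 < s ∧ (∀ t, 0 ≤ t → (‖γ t‖ < R ↔ t < s)) ∧ ∀ t ∈ Icc 0 s, ∃ r : ℝ, γ t = r • γ 0

/-- All rays of the family are free or attached. -/
def IsGoodFamily {S : Type*} (c : S → ℝ → ℂ) (R : ℝ) : Prop :=
  ∀ i, IsFreeRay (c i) R ∨ IsAttachedRay (c i) R

theorem IsAttachedRay.slide {γ γ' : ℝ → ℂ} {R : ℝ} (h : IsAttachedRay γ R) {m : ℝ ≃o ℝ}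
    (hm : m 0 = 0) (hγ : ∀ t, 0 ≤ t → γ' t = γ (m t)) : IsAttachedRay γ' R := by
  obtain ⟨s, hs, h1, h2⟩ := h
  have hm0 : ∀ t, 0 ≤ t → 0 ≤ m t := fun t ht => by rw [← hm]; exact m.monotone ht
  refine ⟨m.symm s, ?_, fun t ht => ?_, fun t ht => ?_⟩
  · rw [m.lt_symm_apply, hm]; exact hs
  · rw [hγ t ht, h1 _ (hm0 t ht), m.lt_symm_apply]
  · rw [hγ t ht.1, hγ 0 le_rfl, hm]
    exact h2 _ ⟨hm0 t ht.1, (m.le_symm_apply).1 ht.2⟩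

/-- A compact set can be moved off the outer part of a good family, by sliding it along the rays. -/
theorem IsRayFamily.exists_avoid {S : Type*} [TopologicalSpace S] [DiscreteTopology S]
    {c : S → ℝ → ℂ} (hc : IsRayFamily c) {R : ℝ} (hg : IsGoodFamily c R) {K F : Set ℂ}
    (hK : IsCompact K) (hF : IsClosed F) (hdis : ∀ z ∈ outerPart c R, z ∉ F) :
    ∃ D : Equiv.Perm ℂ, IsDiffeo D ∧ (∀ z ∈ F, D z = z) ∧
      (∀ i, (∀ t, 0 ≤ t → c i t ∉ K) → ∀ t, 0 ≤ t → D (c i t) = c i t) ∧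
      (∀ i, IsAttachedRay (c i) R → ∃ m : ℝ ≃o ℝ, m 0 = 0 ∧ ∀ t, 0 ≤ t → D (c i t) = c i (m t)) ∧
      ∀ z ∈ K, D z ∉ outerPart c R := by
  classical
  obtain ⟨A, T, hT0, hA⟩ : ∃ A : Finset S, ∃ T : ℝ, 0 ≤ T ∧
      (∀ i t, 0 ≤ t → c i t ∈ K → i ∈ A ∧ t < T) ∧ ∀ i ∈ A, ∃ t, 0 ≤ t ∧ c i t ∈ K := by
    obtain ⟨A, T, hT0, hA⟩ := hc.finite_meeting hK
    exact ⟨A.filter (fun i => ∃ t, 0 ≤ t ∧ c i t ∈ K), T, hT0, fun i t ht h =>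
      ⟨Finset.mem_filter.2 ⟨(hA i t ht h).1, t, ht, h⟩, (hA i t ht h).2⟩,
      fun i hi => (Finset.mem_filter.1 hi).2⟩
  obtain ⟨hA, hA'⟩ := hA
  -- the outer part of the `i`-th ray is `c i '' Ici (s i)`
  have hs : ∀ i, ∃ s, 0 ≤ s ∧ (∀ t, 0 ≤ t → (‖c i t‖ < R ↔ t < s)) ∧
      (IsAttachedRay (c i) R → 0 < s) := by
    intro i
    by_cases h : IsAttachedRay (c i) R
    · obtain ⟨s, h1, h2, -⟩ := h
      exact ⟨s, h1.le, h2, fun _ => h1⟩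
    · have h' := (hg i).resolve_right h
      exact ⟨0, le_rfl, fun t ht => iff_of_false (h' t ht).le.not_gt ht.not_gt,
        fun h'' => absurd h'' h⟩
  choose s hs0 hsR hsa using hs
  have key : ∀ B : Finset S, ∃ D : Equiv.Perm ℂ, IsDiffeo D ∧ (∀ z ∈ F, D z = z) ∧
      (∀ i, i ∉ B → ∀ t, 0 ≤ t → D (c i t) = c i t) ∧
      (∀ i, IsAttachedRay (c i) R →
        ∃ m : ℝ ≃o ℝ, m 0 = 0 ∧ ∀ t, 0 ≤ t → D (c i t) = c i (m t)) ∧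
      ∀ i, i ∈ B → ∀ t, s i ≤ t → ∀ z ∈ K, D z ≠ c i t := by
    intro B
    induction B using Finset.induction_on with
    | empty => exact ⟨1, IsDiffeo.one, by simp, by simp,
        fun i _ => ⟨OrderIso.refl ℝ, rfl, fun t _ => rfl⟩, by simp⟩
    | insert i B hi ih =>
      obtain ⟨D, hD, hDF, hDc, hDm, hDK⟩ := ih
      obtain ⟨E, m, hE, hEfix, hEm, hmT, hm0, hEc⟩ := hc.exists_slide i (hs0 i)
        (le_max_left (s i) T) hF.isOpen_compl (fun t ht => by
          have ht0 : 0 ≤ t := (hs0 i).trans ht.1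
          exact hdis _ ⟨not_lt.1 ((hsR i t ht0).not.2 ht.1.not_gt), i, t, ht0, rfl⟩)
      refine ⟨E * D, hE.mul hD, fun z hz => ?_, fun j hj t ht => ?_, fun j hj => ?_,
        fun j hj t ht z hz => ?_⟩
      · rw [Equiv.Perm.mul_apply, hDF z hz, hEfix z (fun h => h hz)]
      · rw [Finset.mem_insert, not_or] at hj
        rw [Equiv.Perm.mul_apply, hDc j hj.2 t ht, hEc j hj.1 t ht]
      · simp only [Equiv.Perm.mul_apply]
        rcases eq_or_ne j i with rfl | hji
        · exact ⟨m, hm0 (hsa j hj), fun t ht => by rw [hDc j hi t ht, hEm t ht]⟩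
        · obtain ⟨m', h2, h3⟩ := hDm j hj
          refine ⟨m', h2, fun t ht => ?_⟩
          rw [h3 t ht]
          refine hEc j hji _ ?_
          rw [← h2]
          exact m'.monotone ht
      · have ht0 : 0 ≤ t := (hs0 j).trans ht
        rw [Equiv.Perm.mul_apply]
        intro heq
        rcases eq_or_ne j i with rfl | hji
        · have h1 : max (s j) T < m.symm t := by
            rw [m.lt_symm_apply]; exact hmT.trans_le ht
          have h2 : 0 ≤ m.symm t := (le_max_of_le_right hT0).trans h1.le
          have h3 : D z = c j (m.symm t) := by
            apply E.injective
            rw [heq, hEm _ h2, m.apply_symm_apply]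
          rw [← hDc j hi _ h2] at h3
          have h4 := (hA j _ h2 (D.injective h3 ▸ hz)).2
          exact absurd h1 (not_lt.2 (h4.le.trans (le_max_right _ _)))
        · have hjB : j ∈ B := (Finset.mem_insert.1 hj).resolve_left hji
          refine hDK j hjB t ht z hz (E.injective ?_)
          rw [heq, hEc j hji t ht0]
  obtain ⟨D, hD, hDF, hDc, hDm, hDK⟩ := key A
  refine ⟨D, hD, hDF, fun i hi => hDc i fun hiA => ?_, hDm, fun z hz => ?_⟩
  · obtain ⟨t, ht, h⟩ := hA' i hiA
    exact hi t ht h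
  · rintro ⟨hzR, i, t, ht, hzt⟩
    by_cases hiA : i ∈ A
    · refine hDK i hiA t ?_ z hz hzt.symm
      have := (hsR i t ht).not.1 (by rw [hzt]; exact hzR.not_gt)
      exact not_lt.1 this
    · rw [← hDc i hiA t ht] at hzt
      exact hiA (hA i t ht (D.injective hzt ▸ hz)).1

/-! ### Shrinking a set towards another one -/

/-- `A` can be moved into every neighbourhood of `B` by diffeomorphisms fixing `F` pointwise. -/
def ShrinksTo (F A B : Set ℂ) : Prop :=
  ∀ N, IsOpen N → B ⊆ N → ∃ D : Equiv.Perm ℂ, IsDiffeo D ∧ (∀ z ∈ F, D z = z) ∧ ∀ z ∈ A, D z ∈ N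

theorem ShrinksTo.of_subset {F A B : Set ℂ} (h : A ⊆ B) : ShrinksTo F A B :=
  fun _ _ hN => ⟨1, IsDiffeo.one, fun _ _ => rfl, fun _ hz => hN (h hz)⟩

theorem ShrinksTo.trans {F A B C : Set ℂ} (h : ShrinksTo F A B) (h' : ShrinksTo F B C) :
    ShrinksTo F A C := by
  intro N hN hC
  obtain ⟨D, hD, hDF, hDB⟩ := h' N hN hC
  obtain ⟨E, hE, hEF, hEA⟩ := h (D ⁻¹' N) (hN.preimage hD.continuous) hDB
  exact ⟨D * E, hD.mul hE, fun z hz => by rw [Equiv.Perm.mul_apply, hEF z hz, hDF z hz], hEA⟩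

/-- A rectangle of a chart is pushed into the part of it that lies in `N`, without moving
`F ∪ P`. -/
theorem IsChart.exists_push_into {Γ : ℂ → ℂ} {O F P N : Set ℂ} (h : IsChart Γ O) (hF : IsClosed F)
    (hP : IsClosed P) {x₀ x₁ y₀ y₁ v a b : ℝ}
    (hS : ∀ z : ℂ, z.re ∈ Icc x₀ x₁ → z.im ∈ Icc y₀ y₁ → z ∈ O) (hv : x₀ < v)
    (hab : Icc a b ⊆ Icc y₀ y₁)
    (hfree : ∀ z : ℂ, z.re ∈ Icc v x₁ → z.im ∈ Icc a b → Γ z ∉ F ∪ P)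
    (hN : ∀ z : ℂ, z.re ∈ Icc x₀ x₁ → z.im ∈ Icc y₀ y₁ → (z.re ≤ v ∨ z.im ∉ Icc a b) → Γ z ∈ N) :
    ∃ D : Equiv.Perm ℂ, IsDiffeo D ∧ (∀ z ∈ F ∪ P, D z = z) ∧
      ∀ z : ℂ, z.re ∈ Icc x₀ x₁ → z.im ∈ Icc y₀ y₁ → D (Γ z) ∈ N := by
  set O₁ : Set ℂ := (O ∩ Γ ⁻¹' (F ∪ P)ᶜ) ∩ {z | x₀ < z.re} with hO₁
  have hO₁o : IsOpen O₁ :=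
    (h.smooth.continuousOn.isOpen_inter_preimage h.isOpen (hF.union hP).isOpen_compl).inter
      (isOpen_lt continuous_const Complex.continuous_re)
  obtain ⟨D, ψ, hD, -, hDΓ, hDfix, hψfix, him, hre, -, hpush⟩ :=
    h.exists_push hO₁o (fun z hz => hz.1.1) (v := v) (t := x₁) (a := a) (b := b) (by
      intro z hz1 hz2
      exact ⟨⟨hS z ⟨hv.le.trans hz1.1, hz1.2⟩ (hab hz2), hfree z hz1 hz2⟩, hv.trans_le hz1.1⟩)
  refine ⟨D, hD, fun z hz => hDfix z ?_, fun z hz1 hz2 => ?_⟩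
  · rintro ⟨y, hy, rfl⟩
    exact hy.1.2 hz
  · rw [hDΓ z (hS z hz1 hz2)]
    refine hN _ ⟨?_, (hre z).trans hz1.2⟩ (by rw [him]; exact hz2) ?_
    · by_cases hzO : z ∈ O₁
      · exact (Equiv.Perm.mem_of_fix hψfix hzO).2.le
      · rw [hψfix z hzO]; exact hz1.1
    · rw [him]
      by_cases hi : z.im ∈ Icc a b
      · exact Or.inl (hpush z hz1.2 hi)
      · exact Or.inr hi

theorem isCompact_rect (x₀ x₁ y₀ y₁ : ℝ) :
    IsCompact {z : ℂ | z.re ∈ Icc x₀ x₁ ∧ z.im ∈ Icc y₀ y₁} := by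
  have : {z : ℂ | z.re ∈ Icc x₀ x₁ ∧ z.im ∈ Icc y₀ y₁} =
      Complex.equivRealProdCLM.symm '' (Icc x₀ x₁ ×ˢ Icc y₀ y₁) := by
    ext z
    simp only [mem_image, mem_ofPred]
    constructor
    · intro h
      exact ⟨(z.re, z.im), h, by apply Complex.ext <;> simp⟩
    · rintro ⟨⟨x, y⟩, h, rfl⟩
      simpa [and_and_and_comm] using h
  rw [this]
  exact (isCompact_Icc.prod isCompact_Icc).image Complex.equivRealProdCLM.symm.continuous

/-- Collapse of a rectangle through a free side onto its other three sides. -/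
theorem IsChart.shrinksTo_square {Γ : ℂ → ℂ} {O F P : Set ℂ} (h : IsChart Γ O) (hF : IsClosed F)
    (hP : IsClosed P) {x₀ x₁ y₀ y₁ : ℝ}
    (hS : ∀ z : ℂ, z.re ∈ Icc x₀ x₁ → z.im ∈ Icc y₀ y₁ → z ∈ O)
    (hside : ∀ z : ℂ, z.re ∈ Icc x₀ x₁ → z.im ∈ Icc y₀ y₁ →
      (z.re = x₀ ∨ z.im = y₀ ∨ z.im = y₁) → Γ z ∈ P)
    (hfree : ∀ z : ℂ, z.re ∈ Icc x₀ x₁ → z.im ∈ Icc y₀ y₁ → Γ z ∈ F ∪ P →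
      (z.re = x₀ ∨ z.im = y₀ ∨ z.im = y₁)) :
    ShrinksTo F (P ∪ Γ '' {z | z.re ∈ Icc x₀ x₁ ∧ z.im ∈ Icc y₀ y₁}) P := by
  intro N hN hPN
  set A : Set ℂ := {z : ℂ | z.re ∈ Icc x₀ x₁ ∧ z.im ∈ Icc y₀ y₁} ∩
    ({z | z.re = x₀} ∪ ({z | z.im = y₀} ∪ {z | z.im = y₁})) with hA
  have hAc : IsCompact A := (isCompact_rect _ _ _ _).inter_right
    ((isClosed_eq Complex.continuous_re continuous_const).union
      ((isClosed_eq Complex.continuous_im continuous_const).union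
        (isClosed_eq Complex.continuous_im continuous_const)))
  have hAN : A ⊆ O ∩ Γ ⁻¹' N := fun z hz => ⟨hS z hz.1.1 hz.1.2, hPN (hside z hz.1.1 hz.1.2 hz.2)⟩
  obtain ⟨η, hη, hthick⟩ := hAc.exists_thickening_subset_open
    (h.smooth.continuousOn.isOpen_inter_preimage h.isOpen hN) hAN
  have hnear : ∀ z w : ℂ, w ∈ A → dist z w ≤ η / 2 → Γ z ∈ N := fun z w hw hd =>
    (hthick (Metric.mem_thickening_iff.2 ⟨w, hw, by linarith⟩)).2
  obtain ⟨D, hD, hDfix, hDN⟩ := h.exists_push_into (N := N) hF hP hS (v := x₀ + η / 2)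
    (a := y₀ + η / 2) (b := y₁ - η / 2) (by linarith)
    (Icc_subset_Icc (by linarith) (by linarith)) (by
      intro z hz1 hz2 hz
      rcases hfree z ⟨by linarith [hz1.1], hz1.2⟩ ⟨by linarith [hz2.1], by linarith [hz2.2]⟩ hz
        with h | h | h <;> linarith [hz1.1, hz2.1, hz2.2]) (by
      intro z hz1 hz2 hz
      rcases hz with hz | hz
      · refine hnear z ⟨x₀, z.im⟩ ⟨⟨⟨le_rfl, hz1.1.trans hz1.2⟩, hz2⟩, Or.inl rfl⟩ ?_
        rw [Complex.dist_of_im_eq (by rfl), Real.dist_eq, abs_of_nonneg (by linarith [hz1.1])]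
        change z.re - x₀ ≤ η / 2
        linarith
      · rw [mem_Icc, not_and_or, not_le, not_le] at hz
        rcases hz with hz | hz
        · refine hnear z ⟨z.re, y₀⟩ ⟨⟨hz1, ⟨le_rfl, hz2.1.trans hz2.2⟩⟩, Or.inr (Or.inl rfl)⟩ ?_
          rw [Complex.dist_of_re_eq (by rfl), Real.dist_eq, abs_of_nonneg (by linarith [hz2.1])]
          change z.im - y₀ ≤ η / 2
          linarith
        · refine hnear z ⟨z.re, y₁⟩ ⟨⟨hz1, ⟨hz2.1.trans hz2.2, le_rfl⟩⟩, Or.inr (Or.inr rfl)⟩ ?_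
          rw [Complex.dist_of_re_eq (by rfl), Real.dist_eq, abs_of_nonpos (by linarith [hz2.2])]
          change -(z.im - y₁) ≤ η / 2
          linarith)
  refine ⟨D, hD, fun z hz => hDfix z (Or.inl hz), ?_⟩
  rintro _ (hz | ⟨z, hz, rfl⟩)
  · rw [hDfix _ (Or.inr hz)]; exact hPN hz
  · exact hDN z hz.1 hz.2

/-- Collapse of a segment through a free end onto its other end. -/
theorem IsChart.shrinksTo_segment {Γ : ℂ → ℂ} {O F P : Set ℂ} (h : IsChart Γ O) (hF : IsClosed F)
    (hP : IsClosed P) (hS : ∀ x : ℝ, x ∈ Icc (0 : ℝ) 1 → (x : ℂ) ∈ O) (h0 : Γ 0 ∈ P)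
    (hfree : ∀ x : ℝ, x ∈ Ioc (0 : ℝ) 1 → Γ x ∉ F ∪ P) :
    ShrinksTo F (P ∪ (fun x : ℝ => Γ x) '' Icc 0 1) P := by
  intro N hN hPN
  have hz : ∀ z : ℂ, z.im ∈ Icc (0 : ℝ) 0 → z = (z.re : ℂ) := fun z hz => by
    apply Complex.ext
    · simp
    · simpa using le_antisymm hz.2 hz.1
  have h0N : O ∩ Γ ⁻¹' N ∈ 𝓝 (0 : ℂ) :=
    (h.smooth.continuousOn.isOpen_inter_preimage h.isOpen hN).mem_nhds
      ⟨by simpa using hS 0 (by simp), hPN h0⟩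
  obtain ⟨η, hη, hball⟩ := Metric.mem_nhds_iff.1 h0N
  obtain ⟨D, hD, hDfix, hDN⟩ := h.exists_push_into (N := N) hF hP (x₀ := 0) (x₁ := 1) (y₀ := 0)
    (y₁ := 0) (fun z h1 h2 => by rw [hz z h2]; exact hS _ h1) (v := η / 2)
    (a := 0) (b := 0) (by linarith) subset_rfl
    (fun z h1 h2 => by rw [hz z h2]; exact hfree _ ⟨by linarith [h1.1], h1.2⟩) (by
      intro z h1 h2 h3
      have h4 := h3.resolve_right (fun h => h h2)
      refine (hball ?_).2
      rw [hz z h2, Metric.mem_ball, dist_zero_right, Complex.norm_real, Real.norm_eq_abs,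
        abs_of_nonneg h1.1]
      linarith)
  refine ⟨D, hD, fun z hz => hDfix z (Or.inl hz), ?_⟩
  rintro _ (hz | ⟨x, hx, rfl⟩)
  · rw [hDfix _ (Or.inr hz)]; exact hPN hz
  · exact hDN x (by simpa using hx) (by simp)

/-! ### Leaves of forests -/

/-- A finite graph, given by the two ends of each edge and relative to a set `C` of vertices, in
which every nonempty set of edges has a vertex of odd degree outside `C`, has a leaf outside `C`.

If every vertex outside `C` that is touched had degree at least two, there would be at most as many
touched vertices as edges; but the boundary map modulo two is injective on sets of edges, and its
values have even sum if no edge ends in `C`. -/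
theorem exists_leaf {ε V : Type*} [DecidableEq ε] [DecidableEq V] (a b : ε → V)
    (C : Set V) (E : Finset ε) (hE : E.Nonempty)
    (hodd : ∀ x : ε → ZMod 2, (∃ e ∈ E, x e ≠ 0) → (∀ e, e ∉ E → x e = 0) →
      ∃ v, v ∉ C ∧ ∑ e ∈ E, ((if a e = v then x e else 0) + if b e = v then x e else 0) ≠ 0) :
    ∃ e ∈ E, ∃ v, v ∉ C ∧ (a e = v ∨ b e = v) ∧ ∀ e' ∈ E, (a e' = v ∨ b e' = v) → e' = e := by
  classical
  by_contra hcon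
  push Not at hcon
  set V' : Finset V := (E.image a ∪ E.image b).filter (fun v => v ∉ C) with hV'
  have hmem : ∀ v, v ∈ V' ↔ v ∉ C ∧ ∃ e ∈ E, a e = v ∨ b e = v := by
    intro v
    simp only [hV', Finset.mem_filter, Finset.mem_union, Finset.mem_image]
    constructor
    · rintro ⟨⟨e, he, h⟩ | ⟨e, he, h⟩, hC⟩
      · exact ⟨hC, e, he, Or.inl h⟩
      · exact ⟨hC, e, he, Or.inr h⟩
    · rintro ⟨hC, e, he, h | h⟩
      · exact ⟨Or.inl ⟨e, he, h⟩, hC⟩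
      · exact ⟨Or.inr ⟨e, he, h⟩, hC⟩
  -- the boundary map modulo two
  let ι : E → V' → ZMod 2 := fun e v => (if a e = v then 1 else 0) + if b e = v then 1 else 0
  let d : (E → ZMod 2) →ₗ[ZMod 2] (V' → ZMod 2) :=
    { toFun := fun x v => ∑ e, ι e v * x e
      map_add' := fun x y => by
        ext v
        simp only [Pi.add_apply, mul_add, Finset.sum_add_distrib]
      map_smul' := fun r x => by
        ext v
        simp only [Pi.smul_apply, smul_eq_mul, RingHom.id_apply, Finset.mul_sum]
        exact Finset.sum_congr rfl fun e _ => by ring }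
  have hd : ∀ x v, d x v = ∑ e, ι e v * x e := fun x v => rfl
  have hinj : Function.Injective d := by
    rw [injective_iff_map_eq_zero]
    intro x hx
    by_contra hne
    obtain ⟨e₀, he₀⟩ := Function.ne_iff.1 hne
    obtain ⟨v, hvC, hv⟩ := hodd (fun e => if h : e ∈ E then x ⟨e, h⟩ else 0)
      ⟨e₀, e₀.2, by simpa using he₀⟩ (fun e he => by simp [he])
    have hvV : v ∈ V' := by
      rw [hmem]
      refine ⟨hvC, ?_⟩
      by_contra hno
      push Not at hno
      exact hv (Finset.sum_eq_zero fun e he => by simp [hno e he])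
    apply hv
    have h1 := congrFun hx ⟨v, hvV⟩
    rw [hd] at h1
    rw [← Finset.sum_coe_sort E]
    rw [Pi.zero_apply] at h1
    refine Eq.trans (Finset.sum_congr rfl fun e _ => ?_) h1
    simp [ι, add_mul]
  have hle : E.card ≤ V'.card := by
    have := LinearMap.finrank_le_finrank_of_injective hinj
    simpa [Module.finrank_fintype_fun_eq_card] using this
  -- counting incidences
  let n : ε → V → ℕ := fun e v => (if a e = v then 1 else 0) + if b e = v then 1 else 0
  have h2 : ∀ v ∈ V', 2 ≤ ∑ e ∈ E, n e v := by
    intro v hv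
    obtain ⟨hvC, e, he, hev⟩ := (hmem v).1 hv
    obtain ⟨e', he', hev', hne⟩ := hcon e he v hvC hev
    have h1 : ∀ e, (a e = v ∨ b e = v) → 1 ≤ n e v := by
      rintro e (h | h) <;> simp [n, h]
    calc 2 ≤ n e v + n e' v := add_le_add (h1 e hev) (h1 e' hev')
      _ = ∑ f ∈ {e, e'}, n f v := by rw [Finset.sum_pair hne.symm]
      _ ≤ _ := Finset.sum_le_sum_of_subset (by
        intro f hf
        simp only [Finset.mem_insert, Finset.mem_singleton] at hf
        rcases hf with rfl | rfl <;> assumption)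
  have hn : ∀ e, ∑ v ∈ V', n e v = (if a e ∈ V' then 1 else 0) + if b e ∈ V' then 1 else 0 := by
    intro e
    simp only [n, Finset.sum_add_distrib, Finset.sum_ite_eq]
  have h3 : 2 * V'.card ≤ ∑ e ∈ E, ∑ v ∈ V', n e v := by
    rw [Finset.sum_comm, mul_comm, ← smul_eq_mul]
    exact Finset.card_nsmul_le_sum _ _ _ h2
  have h4 : ∀ e ∈ E, ∑ v ∈ V', n e v ≤ 2 := by
    intro e _
    rw [hn]
    split_ifs <;> simp
  have h5 : ∀ e ∈ E, ∑ v ∈ V', n e v = 2 := by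
    have h6 : ∑ e ∈ E, ∑ v ∈ V', n e v = ∑ e ∈ E, 2 := by
      apply le_antisymm (Finset.sum_le_sum h4)
      rw [Finset.sum_const, smul_eq_mul]
      linarith
    exact (Finset.sum_eq_sum_iff_of_le h4).1 h6
  have hcard : E.card = V'.card := by
    apply le_antisymm hle
    have := Finset.sum_le_sum h4
    rw [Finset.sum_const, smul_eq_mul] at this
    linarith
  have hsurj : Function.Surjective d :=
    (LinearMap.injective_iff_surjective_of_finrank_eq_finrank (by
      simp [Module.finrank_fintype_fun_eq_card, hcard])).1 hinj
  obtain ⟨e, he⟩ := hE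
  have hV : a e ∈ V' := by
    have := h5 e he
    rw [hn] at this
    by_contra hne
    rw [if_neg hne] at this
    split_ifs at this <;> omega
  obtain ⟨x, hx⟩ := hsurj (Pi.single ⟨a e, hV⟩ 1)
  have h7 : ∑ v, d x v = 1 := by rw [hx]; simp
  have h8 : ∑ v, d x v = 0 := by
    simp only [hd]
    rw [Finset.sum_comm]
    refine Finset.sum_eq_zero fun f _ => ?_
    rw [← Finset.sum_mul]
    have : ∑ v : V', ι f v = ((∑ v ∈ V', n f v : ℕ) : ZMod 2) := by
      rw [← Finset.sum_coe_sort V']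
      push_cast
      refine Finset.sum_congr rfl fun v _ => ?_
      simp [ι, n]
    rw [this, h5 f f.2]
    have : ((2 : ℕ) : ZMod 2) = 0 := by decide
    rw [this, zero_mul]
  rw [h8] at h7
  exact absurd h7 (by decide)

/-! ### Polar grids -/

/-- Logarithmic polar coordinates outside the disc of radius `R`: the circle of radius `R` is the
image of the imaginary axis, the circle of radius `R * exp H` that of the line `re = N`, and the map
has the period `N` in the imaginary direction. -/
noncomputable def polarMap (R H : ℝ) (N : ℕ) (ζ : ℂ) : ℂ :=
  R * Complex.exp (ζ.re • ((H / N : ℝ) : ℂ) + ζ.im • (2 * Real.pi / N * Complex.I))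

section PolarMap

variable {R H : ℝ} {N : ℕ}

theorem norm_polarMap (hR : 0 < R) (ζ : ℂ) :
    ‖polarMap R H N ζ‖ = R * Real.exp (ζ.re * (H / N)) := by
  have : (ζ.re • ((H / N : ℝ) : ℂ) + ζ.im • (2 * Real.pi / N * Complex.I)).re = ζ.re * (H / N) := by
    have h : (2 * Real.pi / N * Complex.I : ℂ) = ((2 * Real.pi / N : ℝ) : ℂ) * Complex.I := by
      push_cast; ring
    rw [h]
    simp
  rw [polarMap, norm_mul, Complex.norm_exp, this, Complex.norm_real, Real.norm_eq_abs,
    abs_of_pos hR]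

theorem polarMap_eq_iff (hR : 0 < R) (hH : 0 < H) (hN : N ≠ 0) {ζ ξ : ℂ} :
    polarMap R H N ζ = polarMap R H N ξ ↔ ζ.re = ξ.re ∧ ∃ n : ℤ, ζ.im = ξ.im + n * N := by
  have hN' : (0 : ℝ) < N := by positivity
  have hNC : (N : ℂ) ≠ 0 := by exact_mod_cast hN
  have hpi : (Real.pi : ℂ) ≠ 0 := by exact_mod_cast Real.pi_ne_zero
  constructor
  · intro h
    have hre : ζ.re = ξ.re := by
      have h1 := congrArg norm h
      rw [norm_polarMap hR, norm_polarMap hR] at h1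
      have h2 := Real.exp_injective (mul_left_cancel₀ hR.ne' h1)
      exact mul_right_cancel₀ (by positivity) h2
    refine ⟨hre, ?_⟩
    have h1 := mul_left_cancel₀ (by exact_mod_cast hR.ne') h
    obtain ⟨n, hn⟩ := Complex.exp_eq_exp_iff_exists_int.1 h1
    refine ⟨n, ?_⟩
    rw [hre] at hn
    simp only [Complex.real_smul] at hn
    have h3 : (ζ.im : ℂ) = ξ.im + n * N := by
      have h4 : (2 * Real.pi * Complex.I / N : ℂ) ≠ 0 :=
        div_ne_zero (mul_ne_zero (mul_ne_zero two_ne_zero hpi) Complex.I_ne_zero) hNC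
      apply mul_right_cancel₀ h4
      have h5 : (ξ.im + n * N : ℂ) * (2 * Real.pi * Complex.I / N) =
        ξ.im * (2 * Real.pi / N * Complex.I) + n * (2 * Real.pi * Complex.I) := by
        field_simp
      rw [h5]
      linear_combination hn
    exact_mod_cast h3
  · rintro ⟨hre, n, hn⟩
    simp only [polarMap]
    congr 1
    apply Complex.exp_eq_exp_iff_exists_int.2
    refine ⟨n, ?_⟩
    rw [hre, hn]
    simp only [Complex.real_smul]
    push_cast
    field_simp
    ring

theorem exists_polarMap_eq (hR : 0 < R) (hH : 0 < H) (hN : N ≠ 0) {z : ℂ} (hz : R ≤ ‖z‖) :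
    ∃ ζ : ℂ, 0 ≤ ζ.re ∧ polarMap R H N ζ = z := by
  have hN' : (0 : ℝ) < N := by positivity
  have hNC : (N : ℂ) ≠ 0 := by exact_mod_cast hN
  have hpi : (Real.pi : ℂ) ≠ 0 := by exact_mod_cast Real.pi_ne_zero
  have hz0 : 0 < ‖z‖ := hR.trans_le hz
  refine ⟨⟨Real.log (‖z‖ / R) * (N / H), z.arg * (N / (2 * Real.pi))⟩, ?_, ?_⟩
  · have : 0 ≤ Real.log (‖z‖ / R) := Real.log_nonneg ((one_le_div hR).2 hz)
    positivity
  · have h1 : (Real.log (‖z‖ / R) * (N / H)) * (H / N) = Real.log (‖z‖ / R) := by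
      field_simp
    have h2 : (((z.arg * (N / (2 * Real.pi)) : ℝ) : ℂ)) * (2 * Real.pi / N * Complex.I) =
        z.arg * Complex.I := by
      push_cast
      field_simp
    simp only [polarMap, Complex.real_smul]
    rw [h2, ← Complex.ofReal_mul, h1, Complex.exp_add, ← Complex.ofReal_exp,
      Real.exp_log (by positivity), ← mul_assoc, ← Complex.ofReal_mul, mul_div_cancel₀ _ hR.ne',
      Complex.norm_mul_exp_arg_mul_I]

/-- Polar coordinates, composed with a rotation and a translation, are a chart on a disc narrower
than the period. -/
theorem isChart_polarMap (hR : 0 < R) (hH : 0 < H) (hN : 3 ≤ N) (ζ₀ : ℂ) {u : ℂ} (hu : ‖u‖ = 1) :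
    IsChart (fun x => polarMap R H N (ζ₀ + u * x)) (Metric.ball 0 (3 / 2)) := by
  have hN0 : N ≠ 0 := by omega
  have hN' : (0 : ℝ) < N := by positivity
  have hu0 : u ≠ 0 := by intro h; simp [h] at hu
  set ℓ : ℂ →L[ℝ] ℂ := Complex.reCLM.smulRight ((H / N : ℝ) : ℂ) +
    Complex.imCLM.smulRight (2 * Real.pi / N * Complex.I : ℂ) with hℓ
  have hℓx : ∀ ζ, polarMap R H N ζ = R * Complex.exp (ℓ ζ) := fun ζ => by
    simp [polarMap, hℓ]
  have hℓi : ∀ v, ℓ v = 0 → v = 0 := by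
    intro v hv
    have h : (2 * Real.pi / N * Complex.I : ℂ) = ((2 * Real.pi / N : ℝ) : ℂ) * Complex.I := by
      push_cast; ring
    simp only [hℓ, add_apply, ContinuousLinearMap.smulRight_apply,
      Complex.reCLM_apply, Complex.imCLM_apply, h] at hv
    have h1 := congrArg Complex.re hv
    have h2 := congrArg Complex.im hv
    simp at h1 h2
    apply Complex.ext
    · rcases h1 with h1 | h1 | h1
      · exact h1
      · exact absurd h1 hH.ne'
      · exact absurd h1 hN0
    · rcases h2 with h2 | h2
      · exact h2
      · exact absurd h2 hN0
  have hder : ∀ x, HasFDerivAt (fun x => polarMap R H N (ζ₀ + u * x))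
      ((R * Complex.exp (ℓ (ζ₀ + u * x))) • ℓ.comp (u • ContinuousLinearMap.id ℝ ℂ)) x := by
    intro x
    have h1 : HasFDerivAt (fun x : ℂ => ζ₀ + u * x) (u • ContinuousLinearMap.id ℝ ℂ) x :=
      ((hasFDerivAt_id (𝕜 := ℝ) x).const_mul u).const_add ζ₀
    have h2 : HasFDerivAt (fun x => ℓ (ζ₀ + u * x)) (ℓ.comp (u • ContinuousLinearMap.id ℝ ℂ)) x :=
      ℓ.hasFDerivAt.comp x h1
    have h3 := (h2.cexp).const_mul (R : ℂ)
    simp only [hℓx]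
    refine h3.congr_fderiv ?_
    ext v
    simp [mul_assoc]
  refine ⟨Metric.isOpen_ball, ?_, ?_, fun x _ => ?_⟩
  · intro x hx y hy hxy
    obtain ⟨h1, n, h2⟩ := (polarMap_eq_iff hR hH hN0).1 hxy
    rw [mem_ball_zero_iff] at hx hy
    have h3 : ‖u * x - u * y‖ < 3 := by
      rw [← mul_sub, norm_mul, hu, one_mul]
      linarith [norm_sub_le x y]
    have h4 : |(u * x - u * y).im| < 3 := (Complex.abs_im_le_norm _).trans_lt h3
    have h5 : (u * x - u * y).im = n * N := by
      rw [Complex.add_im, Complex.add_im] at h2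
      rw [Complex.sub_im]
      linarith
    have hn : n = 0 := by
      by_contra hne
      have h6 : (1 : ℝ) ≤ |(n : ℝ)| := by exact_mod_cast Int.one_le_abs hne
      rw [h5, abs_mul, Nat.abs_cast] at h4
      have h7 : (3 : ℝ) ≤ N := by exact_mod_cast hN
      nlinarith
    have h6 : ζ₀ + u * x = ζ₀ + u * y := by
      apply Complex.ext h1
      rw [h2, hn]; simp
    exact mul_left_cancel₀ hu0 (add_left_cancel h6)
  · apply ContDiff.contDiffOn
    simp only [hℓx]
    have h1 : ContDiff ℝ ∞ (fun x : ℂ => ζ₀ + u * x) := contDiff_const.add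
      (contDiff_const.mul contDiff_id)
    exact contDiff_const.mul (ℓ.contDiff.comp h1).cexp
  · set A : ℂ →L[ℝ] ℂ :=
      (R * Complex.exp (ℓ (ζ₀ + u * x))) • ℓ.comp (u • ContinuousLinearMap.id ℝ ℂ) with hA
    have hinj : Function.Injective (A : ℂ →ₗ[ℝ] ℂ) := by
      rw [injective_iff_map_eq_zero]
      intro v hv
      have h1 : (R * Complex.exp (ℓ (ζ₀ + u * x))) * ℓ (u * v) = 0 := by simpa [hA] using hv
      have h2 : (R : ℂ) * Complex.exp (ℓ (ζ₀ + u * x)) ≠ 0 :=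
        mul_ne_zero (by exact_mod_cast hR.ne') (Complex.exp_ne_zero _)
      have h3 := hℓi _ ((mul_eq_zero.1 h1).resolve_left h2)
      exact (mul_eq_zero.1 h3).resolve_left hu0
    refine ⟨(LinearEquiv.ofInjectiveEndo (A : ℂ →ₗ[ℝ] ℂ) hinj).toContinuousLinearEquiv, ?_⟩
    have : (((LinearEquiv.ofInjectiveEndo (A : ℂ →ₗ[ℝ] ℂ) hinj).toContinuousLinearEquiv :
        ℂ ≃L[ℝ] ℂ) : ℂ →L[ℝ] ℂ) = A := by
      ext v; rfl
    rw [this]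
    exact hder x

theorem continuous_polarMap : Continuous (polarMap R H N) := by
  unfold polarMap
  have h1 : Continuous (fun ζ : ℂ => ζ.re • ((H / N : ℝ) : ℂ)) :=
    Complex.continuous_re.smul continuous_const
  have h2 : Continuous (fun ζ : ℂ => ζ.im • (2 * Real.pi / N * Complex.I : ℂ)) :=
    Complex.continuous_im.smul continuous_const
  exact continuous_const.mul (h1.add h2).cexp

/-- The polar map changes little over distances of the order of one, if `N` is large. -/
theorem dist_polarMap_le (hR : 0 < R) (hH : 0 < H) (hN : H + 2 * Real.pi ≤ N) {ζ ξ : ℂ}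
    (hξ : ξ.re ≤ N) (h1 : |ζ.re - ξ.re| ≤ 1) (h2 : |ζ.im - ξ.im| ≤ 1) :
    dist (polarMap R H N ζ) (polarMap R H N ξ) ≤
      R * Real.exp H * (2 * ((H + 2 * Real.pi) / N)) := by
  have hpi := Real.pi_pos
  have hN' : (0 : ℝ) < N := by linarith
  set a : ℂ := ξ.re • ((H / N : ℝ) : ℂ) + ξ.im • (2 * Real.pi / N * Complex.I) with ha
  set d : ℂ := (ζ.re - ξ.re) • ((H / N : ℝ) : ℂ) + (ζ.im - ξ.im) • (2 * Real.pi / N * Complex.I)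
    with hd
  have hζ : polarMap R H N ζ = R * Complex.exp a * Complex.exp d := by
    rw [polarMap, mul_assoc, ← Complex.exp_add]
    congr 2
    simp only [ha, hd, Complex.real_smul]
    push_cast
    ring
  have hξ' : polarMap R H N ξ = R * Complex.exp a := rfl
  have hdn : ‖d‖ ≤ (H + 2 * Real.pi) / N := by
    have h : (2 * Real.pi / N * Complex.I : ℂ) = ((2 * Real.pi / N : ℝ) : ℂ) * Complex.I := by
      push_cast; ring
    rw [hd, h]
    refine (norm_add_le _ _).trans ?_
    rw [norm_smul, norm_smul, norm_mul, Complex.norm_I, mul_one, Complex.norm_real,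
      Complex.norm_real, Real.norm_eq_abs, Real.norm_eq_abs, Real.norm_eq_abs, Real.norm_eq_abs,
      abs_of_pos (show 0 < H / N by positivity),
      abs_of_pos (show 0 < 2 * Real.pi / N by positivity), add_div]
    gcongr
    · exact mul_le_of_le_one_left (by positivity) h1
    · exact mul_le_of_le_one_left (by positivity) h2
  have hd1 : ‖d‖ ≤ 1 := hdn.trans ((div_le_one hN').2 hN)
  have hexp : ‖(R : ℂ) * Complex.exp a‖ ≤ R * Real.exp H := by
    rw [← hξ', norm_polarMap hR]
    gcongr
    rw [mul_div_assoc', div_le_iff₀ hN']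
    nlinarith
  rw [dist_eq_norm, hζ, hξ']
  have h3 : (R : ℂ) * Complex.exp a * Complex.exp d - R * Complex.exp a =
    (R * Complex.exp a) * (Complex.exp d - 1) := by ring
  rw [h3, norm_mul]
  have h4 := Complex.norm_exp_sub_one_le hd1
  gcongr
  exact h4.trans (by linarith)

end PolarMap

/-- The real numbers in the `j`-th unit interval modulo `N`. -/
def gridCol {N : ℕ} (j : ZMod N) : Set ℝ :=
  {y | ∃ J : ℤ, (J : ZMod N) = j ∧ y ∈ Icc (J : ℝ) (J + 1)}

/-- The integers congruent to `j` modulo `N`, as real numbers. -/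
def gridLine {N : ℕ} (j : ZMod N) : Set ℝ := {y | ∃ J : ℤ, (J : ZMod N) = j ∧ y = J}

theorem gridCol_add {N : ℕ} {j : ZMod N} {y : ℝ} (h : y ∈ gridCol j) (n : ℤ) :
    y + n * N ∈ gridCol j := by
  obtain ⟨J, hJ, h1, h2⟩ := h
  refine ⟨J + n * N, by simp [hJ], ?_, ?_⟩ <;> push_cast <;> linarith

theorem gridLine_add {N : ℕ} {j : ZMod N} {y : ℝ} (h : y ∈ gridLine j) (n : ℤ) :
    y + n * N ∈ gridLine j := by
  obtain ⟨J, hJ, h1⟩ := h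
  exact ⟨J + n * N, by simp [hJ], by push_cast; rw [h1]⟩

theorem exists_int_add {N : ℕ} {J J' : ℤ} (h : (J : ZMod N) = J') : ∃ n : ℤ, J' = J + n * N := by
  have := (ZMod.intCast_eq_intCast_iff_dvd_sub J J' N).1 h
  obtain ⟨n, hn⟩ := this
  exact ⟨n, by linarith [mul_comm (N : ℤ) n]⟩

/-- The edges of the polar grid: `(true, j, k)` is the radial edge on the `j`-th half-line from
level `k` to level `k + 1`, and `(false, j, k)` is the arc on the `k`-th circle from the `j`-th to
the next half-line. -/
abbrev GridEdge (N : ℕ) := Bool × ZMod N × ℕ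

section Grid

variable (R H : ℝ) (N : ℕ)

/-- The image of a product set under the polar map. -/
def polarBox (A B : Set ℝ) : Set ℂ := polarMap R H N '' {ζ | ζ.re ∈ A ∧ ζ.im ∈ B}

/-- The closed cells of the polar grid: `(j, k)` is the cell between the `j`-th half-line and the
next one, and between the levels `k` and `k + 1`. -/
def gridSquare (q : ZMod N × ℕ) : Set ℂ := polarBox R H N (Icc q.2 (q.2 + 1)) (gridCol q.1)

/-- The closed edges of the polar grid. -/
def gridEdge (e : GridEdge N) : Set ℂ :=
  if e.1 then polarBox R H N (Icc e.2.2 (e.2.2 + 1)) (gridLine e.2.1)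
  else polarBox R H N {(e.2.2 : ℝ)} (gridCol e.2.1)

/-- The vertices of the polar grid, as one-point sets. -/
def gridVertex (v : ZMod N × ℕ) : Set ℂ := polarBox R H N {(v.2 : ℝ)} (gridLine v.1)

variable {R H N}

theorem mem_polarBox (hR : 0 < R) (hH : 0 < H) (hN : N ≠ 0) {A B : Set ℝ}
    (hB : ∀ y ∈ B, ∀ n : ℤ, y + n * N ∈ B) {ζ : ℂ} :
    polarMap R H N ζ ∈ polarBox R H N A B ↔ ζ.re ∈ A ∧ ζ.im ∈ B := by
  constructor
  · rintro ⟨ξ, hξ, h⟩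
    obtain ⟨h1, n, h2⟩ := (polarMap_eq_iff hR hH hN).1 h.symm
    exact ⟨h1 ▸ hξ.1, h2 ▸ hB _ hξ.2 n⟩
  · exact fun h => ⟨ζ, h, rfl⟩

theorem polarBox_gridCol (hR : 0 < R) (hH : 0 < H) (hN : N ≠ 0) (A : Set ℝ) (J : ℤ) :
    polarBox R H N A (gridCol (J : ZMod N)) = polarBox R H N A (Icc (J : ℝ) (J + 1)) := by
  apply Subset.antisymm
  · rintro _ ⟨ζ, ⟨h1, J', hJ', h2⟩, rfl⟩
    obtain ⟨n, rfl⟩ := exists_int_add hJ'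
    refine ⟨⟨ζ.re, ζ.im + n * N⟩, ⟨h1, ?_⟩, ?_⟩
    · push_cast
      exact ⟨by linarith [h2.1], by linarith [h2.2]⟩
    · exact (polarMap_eq_iff hR hH hN).2 ⟨rfl, n, rfl⟩
  · rintro _ ⟨ζ, ⟨h1, h2⟩, rfl⟩
    exact ⟨ζ, ⟨h1, J, rfl, h2⟩, rfl⟩

theorem polarBox_gridLine (hR : 0 < R) (hH : 0 < H) (hN : N ≠ 0) (A : Set ℝ) (J : ℤ) :
    polarBox R H N A (gridLine (J : ZMod N)) = polarBox R H N A {(J : ℝ)} := by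
  apply Subset.antisymm
  · rintro _ ⟨ζ, ⟨h1, J', hJ', h2⟩, rfl⟩
    obtain ⟨n, rfl⟩ := exists_int_add hJ'
    refine ⟨⟨ζ.re, ζ.im + n * N⟩, ⟨h1, ?_⟩, ?_⟩
    · simp [h2]
    · exact (polarMap_eq_iff hR hH hN).2 ⟨rfl, n, rfl⟩
  · rintro _ ⟨ζ, ⟨h1, h2⟩, rfl⟩
    exact ⟨ζ, ⟨h1, J, rfl, h2⟩, rfl⟩

theorem isCompact_polarBox (x₀ x₁ y₀ y₁ : ℝ) :
    IsCompact (polarBox R H N (Icc x₀ x₁) (Icc y₀ y₁)) :=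
  (isCompact_rect x₀ x₁ y₀ y₁).image continuous_polarMap

theorem isCompact_gridSquare (hR : 0 < R) (hH : 0 < H) (hN : N ≠ 0) (q : ZMod N × ℕ) :
    IsCompact (gridSquare R H N q) := by
  obtain ⟨J, hJ⟩ := ZMod.intCast_surjective q.1
  rw [gridSquare, ← hJ, polarBox_gridCol hR hH hN]
  exact isCompact_polarBox _ _ _ _

theorem isCompact_gridEdge (hR : 0 < R) (hH : 0 < H) (hN : N ≠ 0) (e : GridEdge N) :
    IsCompact (gridEdge R H N e) := by
  obtain ⟨J, hJ⟩ := ZMod.intCast_surjective e.2.1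
  rw [gridEdge, ← hJ, polarBox_gridCol hR hH hN, polarBox_gridLine hR hH hN, ← Icc_self,
    ← Icc_self]
  split_ifs <;> exact isCompact_polarBox _ _ _ _

theorem isCompact_gridVertex (hR : 0 < R) (hH : 0 < H) (hN : N ≠ 0) (v : ZMod N × ℕ) :
    IsCompact (gridVertex R H N v) := by
  obtain ⟨J, hJ⟩ := ZMod.intCast_surjective v.1
  rw [gridVertex, ← hJ, polarBox_gridLine hR hH hN, ← Icc_self, ← Icc_self]
  exact isCompact_polarBox _ _ _ _

theorem mem_gridSquare (hR : 0 < R) (hH : 0 < H) (hN : N ≠ 0) {q : ZMod N × ℕ} {ζ : ℂ} :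
    polarMap R H N ζ ∈ gridSquare R H N q ↔
      ζ.re ∈ Icc (q.2 : ℝ) (q.2 + 1) ∧ ζ.im ∈ gridCol q.1 :=
  mem_polarBox hR hH hN fun _ hy n => gridCol_add hy n

theorem mem_gridEdge_true (hR : 0 < R) (hH : 0 < H) (hN : N ≠ 0) {q : ZMod N × ℕ} {ζ : ℂ} :
    polarMap R H N ζ ∈ gridEdge R H N (true, q) ↔
      ζ.re ∈ Icc (q.2 : ℝ) (q.2 + 1) ∧ ζ.im ∈ gridLine q.1 :=
  mem_polarBox hR hH hN fun _ hy n => gridLine_add hy n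

theorem mem_gridEdge_false (hR : 0 < R) (hH : 0 < H) (hN : N ≠ 0) {q : ZMod N × ℕ} {ζ : ℂ} :
    polarMap R H N ζ ∈ gridEdge R H N (false, q) ↔ ζ.re = q.2 ∧ ζ.im ∈ gridCol q.1 :=
  mem_polarBox hR hH hN fun _ hy n => gridCol_add hy n

theorem mem_gridVertex (hR : 0 < R) (hH : 0 < H) (hN : N ≠ 0) {v : ZMod N × ℕ} {ζ : ℂ} :
    polarMap R H N ζ ∈ gridVertex R H N v ↔ ζ.re = v.2 ∧ ζ.im ∈ gridLine v.1 :=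
  mem_polarBox hR hH hN fun _ hy n => gridLine_add hy n

end Grid

/-! ### Incidences in a polar grid, and parity -/

section Incidence

variable {R H : ℝ} {N : ℕ}

theorem eq_or_eq_of_int_add {J J' : ℤ} {x : ℝ} (hx : x ∈ Icc (0 : ℝ) 1) (h : (J : ℝ) + x = J') :
    x = 0 ∨ x = 1 := by
  have h1 : x = ((J' - J : ℤ) : ℝ) := by push_cast; linarith
  rw [h1] at hx ⊢
  have h2 : 0 ≤ J' - J := by exact_mod_cast hx.1
  have h3 : J' - J ≤ 1 := by exact_mod_cast hx.2
  rcases (by omega : J' - J = 0 ∨ J' - J = 1) with h | h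
  · left; rw [h]; simp
  · right; rw [h]; simp

theorem int_adjacent {J J' : ℤ} {y : ℝ} (h : y ∈ Icc (J : ℝ) (J + 1))
    (h' : y ∈ Icc (J' : ℝ) (J' + 1)) :
    J = J' ∨ (J' = J + 1 ∧ y = J') ∨ (J = J' + 1 ∧ y = J) := by
  have h1 : J ≤ J' + 1 := by exact_mod_cast h.1.trans h'.2
  have h2 : J' ≤ J + 1 := by exact_mod_cast h'.1.trans h.2
  rcases (by omega : J = J' ∨ J' = J + 1 ∨ J = J' + 1) with h3 | h3 | h3
  · exact Or.inl h3
  · refine Or.inr (Or.inl ⟨h3, le_antisymm ?_ h'.1⟩)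
    rw [h3]; push_cast; exact h.2
  · refine Or.inr (Or.inr ⟨h3, le_antisymm ?_ h.1⟩)
    rw [h3]; push_cast; exact h'.2

theorem nat_adjacent {k k' : ℕ} {y : ℝ} (h : y ∈ Icc (k : ℝ) (k + 1))
    (h' : y ∈ Icc (k' : ℝ) (k' + 1)) :
    k = k' ∨ (k' = k + 1 ∧ y = k') ∨ (k = k' + 1 ∧ y = k) := by
  rcases int_adjacent (J := k) (J' := k') (by simpa using h) (by simpa using h') with h1 | h1 | h1
  · exact Or.inl (by exact_mod_cast h1)
  · exact Or.inr (Or.inl ⟨by exact_mod_cast h1.1, by exact_mod_cast h1.2⟩)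
  · exact Or.inr (Or.inr ⟨by exact_mod_cast h1.1, by exact_mod_cast h1.2⟩)

/-- The end of an edge of the polar grid from which the edge starts. -/
def gridFst (e : GridEdge N) : ZMod N × ℕ := e.2

/-- The other end of an edge of the polar grid. -/
def gridSnd (e : GridEdge N) : ZMod N × ℕ :=
  if e.1 then (e.2.1, e.2.2 + 1) else (e.2.1 + 1, e.2.2)

theorem gridCol_eq_or {j j' : ZMod N} {y : ℝ} (h : y ∈ gridCol j) (h' : y ∈ gridCol j') :
    j = j' ∨ (j' = j + 1 ∧ y ∈ gridLine j') ∨ (j = j' + 1 ∧ y ∈ gridLine j) := by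
  obtain ⟨J, rfl, h1⟩ := h
  obtain ⟨J', rfl, h2⟩ := h'
  rcases int_adjacent h1 h2 with h3 | ⟨h3, h4⟩ | ⟨h3, h4⟩
  · exact Or.inl (by rw [h3])
  · exact Or.inr (Or.inl ⟨by rw [h3]; push_cast; rfl, J', rfl, h4⟩)
  · exact Or.inr (Or.inr ⟨by rw [h3]; push_cast; rfl, J, rfl, h4⟩)

theorem gridLine_col {j j' : ZMod N} {y : ℝ} (h : y ∈ gridLine j) (h' : y ∈ gridCol j') :
    j = j' ∨ j = j' + 1 := by
  obtain ⟨J, rfl, rfl⟩ := h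
  obtain ⟨J', rfl, h2⟩ := h'
  have h3 : J' ≤ J := by exact_mod_cast h2.1
  have h4 : J ≤ J' + 1 := by exact_mod_cast h2.2
  rcases (by omega : J = J' ∨ J = J' + 1) with h | h
  · left; rw [h]
  · right; rw [h]; push_cast; rfl

theorem gridLine_inj {j j' : ZMod N} {y : ℝ} (h : y ∈ gridLine j) (h' : y ∈ gridLine j') :
    j = j' := by
  obtain ⟨J, rfl, rfl⟩ := h
  obtain ⟨J', rfl, h2⟩ := h'
  rw [show J = J' by exact_mod_cast h2]

theorem gridLine_subset_gridCol (j : ZMod N) : gridLine j ⊆ gridCol j := by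
  rintro _ ⟨J, rfl, rfl⟩
  exact ⟨J, rfl, le_rfl, by linarith⟩

theorem gridLine_subset_gridCol' (j : ZMod N) : gridLine (j + 1) ⊆ gridCol j := by
  rintro _ ⟨J, hJ, rfl⟩
  refine ⟨J - 1, by push_cast; rw [hJ]; ring, ?_, ?_⟩ <;> push_cast <;> linarith

theorem nat_of_mem_Icc {k l : ℕ} (h : (l : ℝ) ∈ Icc (k : ℝ) (k + 1)) : l = k ∨ l = k + 1 := by
  have h1 : k ≤ l := by exact_mod_cast h.1
  have h2 : l ≤ k + 1 := by exact_mod_cast h.2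
  omega

/-- A vertex on an edge is one of its ends. -/
theorem eq_end_of_mem (hR : 0 < R) (hH : 0 < H) (hN : N ≠ 0) {e : GridEdge N} {v : ZMod N × ℕ}
    {ζ : ℂ} (he : polarMap R H N ζ ∈ gridEdge R H N e)
    (hv : polarMap R H N ζ ∈ gridVertex R H N v) :
    gridFst e = v ∨ gridSnd e = v := by
  obtain ⟨b, j, k⟩ := e
  obtain ⟨j', l⟩ := v
  rw [mem_gridVertex hR hH hN] at hv
  cases b
  · rw [mem_gridEdge_false hR hH hN] at he
    have h1 : l = k := by exact_mod_cast hv.1.symm.trans he.1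
    rcases gridLine_col hv.2 he.2 with h2 | h2 <;> simp_all [gridFst, gridSnd]
  · rw [mem_gridEdge_true hR hH hN] at he
    have h1 := gridLine_inj he.2 hv.2
    rw [hv.1] at he
    rcases nat_of_mem_Icc he.1 with h2 | h2 <;> simp_all [gridFst, gridSnd]

/-- Two distinct edges only meet at common ends. -/
theorem exists_common_end (hR : 0 < R) (hH : 0 < H) (hN : N ≠ 0) {e e' : GridEdge N} (hne : e ≠ e')
    {ζ : ℂ} (he : polarMap R H N ζ ∈ gridEdge R H N e)
    (he' : polarMap R H N ζ ∈ gridEdge R H N e') :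
    ∃ v, polarMap R H N ζ ∈ gridVertex R H N v := by
  obtain ⟨b, j, k⟩ := e
  obtain ⟨b', j', k'⟩ := e'
  cases b <;> cases b'
  · rw [mem_gridEdge_false hR hH hN] at he he'
    rcases gridCol_eq_or he.2 he'.2 with h | h | h
    · have : k = k' := by exact_mod_cast he.1.symm.trans he'.1
      simp_all
    · exact ⟨(j', k'), (mem_gridVertex hR hH hN).2 ⟨he'.1, h.2⟩⟩
    · exact ⟨(j, k), (mem_gridVertex hR hH hN).2 ⟨he.1, h.2⟩⟩
  · rw [mem_gridEdge_false hR hH hN] at he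
    rw [mem_gridEdge_true hR hH hN] at he'
    exact ⟨(j', k), (mem_gridVertex hR hH hN).2 ⟨he.1, he'.2⟩⟩
  · rw [mem_gridEdge_true hR hH hN] at he
    rw [mem_gridEdge_false hR hH hN] at he'
    exact ⟨(j, k'), (mem_gridVertex hR hH hN).2 ⟨he'.1, he.2⟩⟩
  · rw [mem_gridEdge_true hR hH hN] at he he'
    have h1 := gridLine_inj he.2 he'.2
    rcases nat_adjacent he.1 he'.1 with h | h | h
    · simp_all
    · exact ⟨(j', k'), (mem_gridVertex hR hH hN).2 ⟨h.2, he'.2⟩⟩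
    · exact ⟨(j, k), (mem_gridVertex hR hH hN).2 ⟨h.2, he.2⟩⟩

/-- The squares of the first `N` levels of the grid that are disjoint from `Z`. -/
def IsGoodSquare (R H : ℝ) (N : ℕ) (Z : Set ℂ) (q : ZMod N × ℕ) : Prop :=
  q.2 < N ∧ Disjoint (gridSquare R H N q) Z

/-- The edges of the first `N` levels of the grid, off the initial circle, that are disjoint from
`Z`. -/
def IsGoodEdge (R H : ℝ) (N : ℕ) (Z : Set ℂ) (e : GridEdge N) : Prop :=
  (if e.1 then e.2.2 < N else 1 ≤ e.2.2 ∧ e.2.2 ≤ N) ∧ Disjoint (gridEdge R H N e) Z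

/-- Every point of `Z` off the open disc of radius `R` is connected to infinity inside `Z` off that
disc. -/
def IsEndless (Z : Set ℂ) (R : ℝ) : Prop :=
  ∀ z ∈ Z, R ≤ ‖z‖ → ∃ C ⊆ Z ∩ {z | R ≤ ‖z‖}, IsPreconnected C ∧ z ∈ C ∧ ∀ B : ℝ, ∃ y ∈ C, B < ‖y‖

/-- If `Z` is endless, then the good edges that are not the outer side of a good square do not
contain any nonempty set of edges with all vertices off the initial circle of even degree.

Such a set of edges splits the squares into two classes, distinguished by the parity `p` of the
number of its arcs above a square. The class changes exactly across the edges of the set. It does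
not change along `Z`, nor from a good square to the one above it; so every square is in the class of
the outermost ones. -/
theorem eq_zero_of_even_degrees (hR : 0 < R) (hH : 0 < H) [NeZero N] {Z : Set ℂ}
    (hZ : IsEndless Z R) {x : GridEdge N → ZMod 2}
    (hx : ∀ e, x e ≠ 0 → IsGoodEdge R H N Z e ∧
      ∀ q : ZMod N × ℕ, e = (false, q.1, q.2 + 1) → ¬ IsGoodSquare R H N Z q)
    (hv : ∀ (j : ZMod N) (k : ℕ), x (true, j, k + 1) + x (true, j, k) + x (false, j, k + 1) +
      x (false, j - 1, k + 1) = 0) (e : GridEdge N) : x e = 0 := by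
  have hN : N ≠ 0 := NeZero.ne N
  -- the class of the square `(j, k)`
  set p : ZMod N → ℕ → ZMod 2 := fun j k => ∑ l ∈ Finset.Ico (k + 1) (N + 1), x (false, j, l)
    with hp
  have hxt : ∀ j k, N ≤ k → x (true, j, k) = 0 := by
    intro j k hk
    by_contra h
    have := (hx _ h).1.1
    simp only [if_true] at this
    omega
  have hxf : ∀ j k, N < k → x (false, j, k) = 0 := by
    intro j k hk
    by_contra h
    have := (hx _ h).1.1
    simp at this
    omega
  have hbad : ∀ e, ∀ z ∈ Z, z ∈ gridEdge R H N e → x e = 0 := by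
    intro e z hz hze
    by_contra h
    exact disjoint_left.1 (hx _ h).1.2 hze hz
  have hp0 : ∀ j k, N ≤ k → p j k = 0 := by
    intro j k hk
    simp only [hp]
    rw [Finset.Ico_eq_empty (by omega), Finset.sum_empty]
  have hup : ∀ j k, p j k = x (false, j, k + 1) + p j (k + 1) := by
    intro j k
    by_cases hk : k < N
    · simp only [hp]
      rw [Finset.sum_eq_sum_Ico_succ_bot (by omega)]
    · rw [hp0 j k (by omega), hp0 j (k + 1) (by omega), hxf j (k + 1) (by omega), add_zero]
  have hside : ∀ n k, N ≤ k + n → ∀ j, p j k + p (j - 1) k = x (true, j, k) := by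
    intro n
    induction n with
    | zero =>
      intro k hk j
      rw [hp0 _ _ hk, hp0 _ _ hk, hxt j k hk, add_zero]
    | succ n ih =>
      intro k hk j
      have h1 := ih (k + 1) (by omega) j
      have h2 := hv j k
      rw [← h1] at h2
      rw [hup j k, hup (j - 1) k]
      generalize x (false, j, k + 1) = a at *
      generalize x (false, j - 1, k + 1) = b at *
      generalize x (true, j, k) = c at *
      generalize p j (k + 1) = d at *
      generalize p (j - 1) (k + 1) = f at *
      clear * - h2
      revert a b c d f
      decide
  have hside' : ∀ j k, x (true, j + 1, k) = 0 → p j k = p (j + 1) k := by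
    intro j k h
    have h1 := hside N k (by omega) (j + 1)
    rw [h, add_sub_cancel_right] at h1
    generalize p (j + 1) k = a at *
    generalize p j k = b at *
    clear * - h1
    revert a b
    decide
  -- squares with a common point in `Z` are in the same class
  have hsame : ∀ ζ : ℂ, polarMap R H N ζ ∈ Z → ∀ (j : ZMod N) (k : ℕ) (j' : ZMod N) (k' : ℕ),
      ζ.re ∈ Icc (k : ℝ) (k + 1) →
      ζ.im ∈ gridCol j → ζ.re ∈ Icc (k' : ℝ) (k' + 1) → ζ.im ∈ gridCol j' → p j k = p j' k' := by
    intro ζ hζ j k j' k' h1 h2 h3 h4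
    have hA : p j k = p j' k := by
      rcases gridCol_eq_or h2 h4 with h | ⟨h, h'⟩ | ⟨h, h'⟩
      · rw [h]
      · subst h
        exact hside' j k (hbad _ _ hζ ((mem_gridEdge_true hR hH hN).2 ⟨h1, h'⟩))
      · subst h
        exact (hside' j' k (hbad _ _ hζ ((mem_gridEdge_true hR hH hN).2 ⟨h1, h'⟩))).symm
    rw [hA]
    rcases nat_adjacent h1 h3 with h | ⟨h, h'⟩ | ⟨h, h'⟩
    · rw [h]
    · subst h
      rw [hup j' k, hbad (false, j', k + 1) _ hζ ((mem_gridEdge_false hR hH hN).2 ⟨h', h4⟩),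
        zero_add]
    · subst h
      rw [hup j' k', hbad (false, j', k' + 1) _ hζ ((mem_gridEdge_false hR hH hN).2 ⟨h', h4⟩),
        zero_add]
  have hcell : ∀ ζ : ℂ, 0 ≤ ζ.re → ∃ (j : ZMod N) (k : ℕ),
      ζ.re ∈ Icc (k : ℝ) (k + 1) ∧ ζ.im ∈ gridCol j :=
    fun ζ h0 => ⟨((⌊ζ.im⌋ : ℤ) : ZMod N), ⌊ζ.re⌋₊,
      ⟨Nat.floor_le h0, (Nat.lt_floor_add_one _).le⟩, ⌊ζ.im⌋, rfl, Int.floor_le _,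
      (Int.lt_floor_add_one _).le⟩
  -- the two classes, as closed sets
  classical
  set Q : Finset (ZMod N × ℕ) := Finset.univ ×ˢ Finset.range N with hQ
  set Y₁ : Set ℂ := ⋃ q ∈ Q.filter (fun q => p q.1 q.2 ≠ 0), gridSquare R H N q with hY₁
  set Y₀ : Set ℂ := (⋃ q ∈ Q.filter (fun q => p q.1 q.2 = 0), gridSquare R H N q) ∪
    {z | R * Real.exp H ≤ ‖z‖} with hY₀
  have hY₁c : IsClosed Y₁ := isClosed_biUnion_finset fun q _ =>
    (isCompact_gridSquare hR hH hN q).isClosed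
  have hY₀c : IsClosed Y₀ := (isClosed_biUnion_finset fun q _ =>
    (isCompact_gridSquare hR hH hN q).isClosed).union (isClosed_le continuous_const continuous_norm)
  have hN' : (0 : ℝ) < N := by positivity
  have hfar : ∀ ζ : ℂ, R * Real.exp H ≤ ‖polarMap R H N ζ‖ ↔ (N : ℝ) ≤ ζ.re := by
    intro ζ
    rw [norm_polarMap hR, mul_le_mul_iff_right₀ hR, Real.exp_le_exp, mul_div_assoc',
      le_div_iff₀ hN', mul_comm ζ.re, mul_le_mul_iff_right₀ hH]
  have hcover : ∀ z, R ≤ ‖z‖ → z ∈ Y₀ ∪ Y₁ := by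
    intro z hz
    obtain ⟨ζ, h0, rfl⟩ := exists_polarMap_eq hR hH hN hz
    obtain ⟨j, k, h1, h2⟩ := hcell ζ h0
    by_cases hk : k < N
    · have hq : (j, k) ∈ Q := by simp [hQ, hk]
      have hm := (mem_gridSquare hR hH hN (q := (j, k))).2 ⟨h1, h2⟩
      by_cases hpq : p j k = 0
      · exact Or.inl (Or.inl (mem_biUnion (x := (j, k)) (by simp [hQ, hk, hpq]) hm))
      · exact Or.inr (mem_biUnion (x := (j, k)) (by simp [hQ, hk, hpq]) hm)
    · refine Or.inl (Or.inr ((hfar ζ).2 (le_trans ?_ h1.1)))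
      exact_mod_cast not_lt.1 hk
  have hdisj : ∀ z ∈ Z, R ≤ ‖z‖ → z ∈ Y₀ → z ∈ Y₁ → False := by
    intro z hz hzR h0 h1
    obtain ⟨ζ, hζ0, rfl⟩ := exists_polarMap_eq hR hH hN hzR
    simp only [hY₁, mem_iUnion, exists_prop] at h1
    obtain ⟨q, hq, hqz⟩ := h1
    rw [mem_gridSquare hR hH hN] at hqz
    have hpq := (Finset.mem_filter.1 hq).2
    rcases h0 with h0 | h0
    · simp only [mem_iUnion, exists_prop] at h0
      obtain ⟨q', hq', hqz'⟩ := h0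
      rw [mem_gridSquare hR hH hN] at hqz'
      apply hpq
      rw [hsame ζ hz q.1 q.2 q'.1 q'.2 hqz.1 hqz.2 hqz'.1 hqz'.2]
      exact (Finset.mem_filter.1 hq').2
    · obtain ⟨j, k, h1, h2⟩ := hcell ζ hζ0
      have h3 := (hfar ζ).1 h0
      have h4 : q.2 < N := by simpa [hQ] using (Finset.mem_filter.1 hq).1
      have h5 : (q.2 : ℝ) + 1 ≤ N := by exact_mod_cast h4
      apply hpq
      rw [hsame ζ hz q.1 q.2 q.1 N hqz.1 hqz.2 ⟨h3, by linarith [hqz.1.2]⟩ hqz.2]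
      exact hp0 _ _ le_rfl
  have hbadsq : ∀ q : ZMod N × ℕ, ¬ Disjoint (gridSquare R H N q) Z → p q.1 q.2 = 0 := by
    intro q hq
    obtain ⟨z, hzq, hzZ⟩ := not_disjoint_iff.1 hq
    by_contra hpq
    have hk : q.2 < N := by
      by_contra h
      exact hpq (hp0 _ _ (not_lt.1 h))
    have hzR : R ≤ ‖z‖ := by
      obtain ⟨ζ, hζ, rfl⟩ := hzq
      rw [norm_polarMap hR]
      have : 0 ≤ ζ.re := (Nat.cast_nonneg _).trans hζ.1.1
      exact le_mul_of_one_le_right hR.le (Real.one_le_exp (by positivity))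
    have hz1 : z ∈ Y₁ := mem_biUnion (x := q) (by simp [hQ, hk, hpq]) hzq
    obtain ⟨C, hCZ, hC, hzC, hCinf⟩ := hZ z hzZ hzR
    obtain ⟨y, hyC, hy⟩ := hCinf (R * Real.exp H)
    obtain ⟨w, hwC, hw0, hw1⟩ := isPreconnected_closed_iff.1 hC Y₀ Y₁ hY₀c hY₁c
      (fun w hw => hcover w (hCZ hw).2) ⟨y, hyC, Or.inr hy.le⟩ ⟨z, hzC, hz1⟩
    exact hdisj w (hCZ hwC).1 (hCZ hwC).2 hw0 hw1
  have hall : ∀ n k, N ≤ k + n → ∀ j, p j k = 0 := by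
    intro n
    induction n with
    | zero => exact fun k hk j => hp0 j k hk
    | succ n ih =>
      intro k hk j
      by_cases hq : Disjoint (gridSquare R H N (j, k)) Z
      · by_cases hkN : k < N
        · rw [hup, ih (k + 1) (by omega) j, add_zero]
          by_contra h
          exact (hx _ h).2 (j, k) rfl ⟨hkN, hq⟩
        · exact hp0 j k (not_lt.1 hkN)
      · exact hbadsq (j, k) hq
  have hall' : ∀ j k, p j k = 0 := fun j k => hall N k (by omega) j
  obtain ⟨b, j, k⟩ := e
  cases b
  · by_contra h
    have hk : 1 ≤ k := by
      have := (hx _ h).1.1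
      simp at this
      omega
    obtain ⟨k, rfl⟩ := Nat.exists_eq_add_of_le' hk
    have := hup j k
    rw [hall', hall', add_zero] at this
    exact h this.symm
  · rw [← hside N k (by omega) j, hall', hall', add_zero]

/-- The degree of a vertex off the initial circle in a set of edges, modulo two. -/
theorem sum_incidences [DecidableEq (ZMod N × ℕ)] {E : Finset (GridEdge N)}
    {x : GridEdge N → ZMod 2}
    (h0 : ∀ e, e ∉ E → x e = 0) (j : ZMod N) (k : ℕ) :
    ∑ e ∈ E, ((if gridFst e = (j, k + 1) then x e else 0) +
      if gridSnd e = (j, k + 1) then x e else 0) =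
    x (true, j, k + 1) + x (true, j, k) + x (false, j, k + 1) + x (false, j - 1, k + 1) := by
  classical
  have key : ∀ (P : GridEdge N → Prop) [DecidablePred P] (e₁ e₂ : GridEdge N), e₁ ≠ e₂ →
      (∀ e, P e ↔ e = e₁ ∨ e = e₂) → ∑ e ∈ E, (if P e then x e else 0) = x e₁ + x e₂ := by
    intro P _ e₁ e₂ hne hP
    rw [← Finset.sum_filter, ← Finset.sum_pair hne]
    refine Finset.sum_subset (fun e he => ?_) (fun e he he' => h0 e fun hE => he' ?_)
    · have := (hP e).1 (Finset.mem_filter.1 he).2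
      simpa using this
    · exact Finset.mem_filter.2 ⟨hE, (hP e).2 (by simpa using he)⟩
  rw [Finset.sum_add_distrib, key _ (true, j, k + 1) (false, j, k + 1) (by simp),
    key _ (true, j, k) (false, j - 1, k + 1) (by simp)]
  · ring
  · rintro ⟨b, j', k'⟩
    cases b
    · simp [gridSnd, eq_sub_iff_add_eq]
    · simp [gridSnd]
  · rintro ⟨b, j', k'⟩
    cases b <;> simp [gridFst]

end Incidence

/-! ### Collapsing the cells of a polar grid -/

section Collapse

variable {R H : ℝ} {N : ℕ}

/-- The union of a set `C` and of given vertices, edges and squares of the polar grid. -/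
def gridComplex (R H : ℝ) (N : ℕ) (C : Set ℂ) (X : Finset (ZMod N × ℕ)) (E : Finset (GridEdge N))
    (Q : Finset (ZMod N × ℕ)) : Set ℂ :=
  C ∪ ((⋃ v ∈ X, gridVertex R H N v) ∪ ((⋃ e ∈ E, gridEdge R H N e) ∪ ⋃ q ∈ Q, gridSquare R H N q))

theorem mem_gridComplex {C : Set ℂ} {X : Finset (ZMod N × ℕ)} {E : Finset (GridEdge N)}
    {Q : Finset (ZMod N × ℕ)} {z : ℂ} : z ∈ gridComplex R H N C X E Q ↔
      z ∈ C ∨ (∃ v ∈ X, z ∈ gridVertex R H N v) ∨ (∃ e ∈ E, z ∈ gridEdge R H N e) ∨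
        ∃ q ∈ Q, z ∈ gridSquare R H N q := by
  simp only [gridComplex, mem_union, mem_iUnion, exists_prop]

theorem isClosed_gridComplex (hR : 0 < R) (hH : 0 < H) (hN : N ≠ 0) {C : Set ℂ} (hC : IsClosed C)
    (X : Finset (ZMod N × ℕ)) (E : Finset (GridEdge N)) (Q : Finset (ZMod N × ℕ)) :
    IsClosed (gridComplex R H N C X E Q) :=
  hC.union ((isClosed_biUnion_finset fun v _ => (isCompact_gridVertex hR hH hN v).isClosed).union
    ((isClosed_biUnion_finset fun e _ => (isCompact_gridEdge hR hH hN e).isClosed).union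
      (isClosed_biUnion_finset fun q _ => (isCompact_gridSquare hR hH hN q).isClosed)))

theorem norm_polarMap_le_iff (hR : 0 < R) (hH : 0 < H) (hN : N ≠ 0) {ζ : ℂ} :
    ‖polarMap R H N ζ‖ ≤ R ↔ ζ.re ≤ 0 := by
  have hN' : (0 : ℝ) < N := by positivity
  rw [norm_polarMap hR, mul_le_iff_le_one_right hR, Real.exp_le_one_iff]
  exact ⟨fun h => by_contra fun h' => (mul_pos (not_le.1 h') (div_pos hH hN')).not_ge h,
    fun h => mul_nonpos_of_nonpos_of_nonneg h (by positivity)⟩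

theorem norm_polarMap_eq_iff (hR : 0 < R) (hH : 0 < H) (hN : N ≠ 0) {ζ : ℂ} :
    ‖polarMap R H N ζ‖ = R ↔ ζ.re = 0 := by
  have hN' : (0 : ℝ) < N := by positivity
  rw [norm_polarMap hR, mul_eq_left₀ hR.ne', Real.exp_eq_one_iff]
  simp [hH.ne', hN]

theorem gridEdge_left_subset (q : ZMod N × ℕ) : gridEdge R H N (true, q) ⊆ gridSquare R H N q := by
  rintro _ ⟨ζ, ⟨h1, h2⟩, rfl⟩
  exact ⟨ζ, ⟨h1, gridLine_subset_gridCol _ h2⟩, rfl⟩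

theorem gridEdge_right_subset (q : ZMod N × ℕ) :
    gridEdge R H N (true, q.1 + 1, q.2) ⊆ gridSquare R H N q := by
  rintro _ ⟨ζ, ⟨h1, h2⟩, rfl⟩
  exact ⟨ζ, ⟨h1, gridLine_subset_gridCol' _ h2⟩, rfl⟩

theorem gridEdge_bot_subset (q : ZMod N × ℕ) : gridEdge R H N (false, q) ⊆ gridSquare R H N q := by
  rintro _ ⟨ζ, ⟨h1, h2⟩, rfl⟩
  have h1' : ζ.re = q.2 := h1
  exact ⟨ζ, ⟨⟨h1'.ge, by linarith⟩, h2⟩, rfl⟩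

theorem gridEdge_top_subset (q : ZMod N × ℕ) :
    gridEdge R H N (false, q.1, q.2 + 1) ⊆ gridSquare R H N q := by
  rintro _ ⟨ζ, ⟨h1, h2⟩, rfl⟩
  have h1' : ζ.re = ((q.2 + 1 : ℕ) : ℝ) := h1
  push_cast at h1'
  exact ⟨ζ, ⟨⟨by linarith, h1'.le⟩, h2⟩, rfl⟩

/-- Collapse of a square of the grid through its outer side. -/
theorem shrinksTo_gridSquare (hR : 0 < R) (hH : 0 < H) (hN : 3 ≤ N) {Z C : Set ℂ} (hZ : IsClosed Z)
    (hC : IsClosed C) (hCR : ∀ z ∈ C, ‖z‖ = R) {X : Finset (ZMod N × ℕ)} {E : Finset (GridEdge N)}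
    {Q : Finset (ZMod N × ℕ)} {q : ZMod N × ℕ} (hq : q ∉ Q) (hqZ : Disjoint (gridSquare R H N q) Z)
    (hQ : ∀ q' ∈ Q, q'.2 ≤ q.2) (htop : ((false, q.1, q.2 + 1) : GridEdge N) ∉ E)
    (hqC : ∀ z ∈ gridSquare R H N q, ‖z‖ = R → z ∈ C)
    (hbot : q.2 ≠ 0 → ((false, q) : GridEdge N) ∈ E)
    (hleft : ((true, q) : GridEdge N) ∈ E) (hright : ((true, q.1 + 1, q.2) : GridEdge N) ∈ E) :
    ShrinksTo (Z ∪ Metric.closedBall 0 R) (gridComplex R H N C X E Q ∪ gridSquare R H N q)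
      (gridComplex R H N C X E Q) := by
  have hN0 : N ≠ 0 := by omega
  obtain ⟨j, k⟩ := q
  obtain ⟨J, rfl⟩ := ZMod.intCast_surjective j
  simp only at hQ htop hbot hright
  set Γ : ℂ → ℂ := fun x => polarMap R H N (⟨k, J⟩ + 1 * x) with hΓ
  have hchart : IsChart Γ (Metric.ball 0 (3 / 2)) := isChart_polarMap hR hH hN _ (by simp)
  have hre : ∀ x : ℂ, ((⟨k, J⟩ : ℂ) + 1 * x).re = k + x.re := fun x => by simp
  have him : ∀ x : ℂ, ((⟨k, J⟩ : ℂ) + 1 * x).im = J + x.im := fun x => by simp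
  have himg : gridSquare R H N ((J : ZMod N), k) =
      Γ '' {z | z.re ∈ Icc (0 : ℝ) 1 ∧ z.im ∈ Icc (0 : ℝ) 1} := by
    rw [gridSquare, polarBox_gridCol hR hH hN0]
    apply Subset.antisymm
    · rintro _ ⟨ζ, ⟨h1, h2⟩, rfl⟩
      refine ⟨ζ - ⟨k, J⟩, ⟨?_, ?_⟩, ?_⟩
      · rw [Complex.sub_re]
        exact ⟨by linarith [h1.1], by linarith [h1.2]⟩
      · rw [Complex.sub_im]
        exact ⟨by linarith [h2.1], by linarith [h2.2]⟩
      · simp [hΓ]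
    · rintro _ ⟨x, ⟨h1, h2⟩, rfl⟩
      refine ⟨⟨k, J⟩ + 1 * x, ⟨?_, ?_⟩, rfl⟩
      · rw [hre]
        exact ⟨by linarith [h1.1], by linarith [h1.2]⟩
      · rw [him]
        exact ⟨by linarith [h2.1], by linarith [h2.2]⟩
  have hcol : ∀ x : ℂ, x.im ∈ Icc (0 : ℝ) 1 → J + x.im ∈ gridCol (J : ZMod N) := fun x hx =>
    ⟨J, rfl, by linarith [hx.1], by linarith [hx.2]⟩
  -- a point of the square that is over another cell of the grid is over its boundary
  have hcol' : ∀ x : ℂ, x.im ∈ Icc (0 : ℝ) 1 → ∀ j' : ZMod N, j' ≠ J → J + x.im ∈ gridCol j' →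
      x.im = 0 ∨ x.im = 1 := by
    intro x hx j' hj' h
    rcases gridCol_eq_or (hcol x hx) h with h1 | ⟨-, J', -, h1⟩ | ⟨-, J', -, h1⟩
    · exact absurd h1.symm hj'
    · exact eq_or_eq_of_int_add hx h1
    · exact eq_or_eq_of_int_add hx h1
  rw [himg]
  refine hchart.shrinksTo_square (hZ.union Metric.isClosed_closedBall)
    (isClosed_gridComplex hR hH hN0 hC X E Q) (fun z h1 h2 => ?_) (fun z h1 h2 h3 => ?_)
    (fun z h1 h2 h3 => ?_)
  · rw [mem_ball_zero_iff]
    have h3 : ‖z‖ ^ 2 ≤ 2 := by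
      rw [Complex.sq_norm, Complex.normSq_apply]
      nlinarith [h1.1, h1.2, h2.1, h2.2]
    nlinarith [norm_nonneg z]
  · have hzq : Γ z ∈ gridSquare R H N ((J : ZMod N), k) := by
      rw [himg]; exact ⟨z, ⟨h1, h2⟩, rfl⟩
    have hkz : (k : ℝ) + z.re ∈ Icc (k : ℝ) (k + 1) := ⟨by linarith [h1.1], by linarith [h1.2]⟩
    rw [mem_gridComplex]
    rcases h3 with h3 | h3 | h3
    · by_cases hk : k = 0
      · left
        refine hqC _ hzq ((norm_polarMap_eq_iff hR hH hN0).2 ?_)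
        rw [hre, h3, hk]; simp
      · refine Or.inr (Or.inr (Or.inl ⟨_, hbot hk, (mem_gridEdge_false hR hH hN0).2 ⟨?_, ?_⟩⟩))
        · rw [hre, h3, add_zero]
        · rw [him]; exact hcol z h2
    · refine Or.inr (Or.inr (Or.inl ⟨_, hleft, (mem_gridEdge_true hR hH hN0).2 ⟨?_, ?_⟩⟩))
      · rw [hre]; exact hkz
      · rw [him, h3]; exact ⟨J, rfl, add_zero _⟩
    · refine Or.inr (Or.inr (Or.inl ⟨_, hright, (mem_gridEdge_true hR hH hN0).2 ⟨?_, ?_⟩⟩))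
      · rw [hre]; exact hkz
      · rw [him, h3]; exact ⟨J + 1, by push_cast; rfl, by push_cast; rfl⟩
  · have hzero : ((⟨k, J⟩ : ℂ) + 1 * z).re ≤ 0 → z.re = 0 := by
      rw [hre]
      intro h
      have : (0 : ℝ) ≤ k := Nat.cast_nonneg k
      linarith [h1.1]
    rcases h3 with (h3 | h3) | h3
    · refine absurd h3 (disjoint_left.1 hqZ ?_)
      rw [himg]; exact ⟨z, ⟨h1, h2⟩, rfl⟩
    · rw [Metric.mem_closedBall, dist_zero_right] at h3
      exact Or.inl (hzero ((norm_polarMap_le_iff hR hH hN0).1 h3))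
    · rw [mem_gridComplex] at h3
      rcases h3 with h3 | ⟨v, -, h3⟩ | ⟨⟨b, j', l⟩, he, h3⟩ | ⟨⟨j', l⟩, hq', h3⟩
      · exact Or.inl (hzero ((norm_polarMap_eq_iff hR hH hN0).1 (hCR _ h3)).le)
      · obtain ⟨-, J', -, h3⟩ := (mem_gridVertex hR hH hN0).1 h3
        rw [him] at h3
        exact Or.inr (eq_or_eq_of_int_add h2 h3)
      · cases b
        · obtain ⟨h4, h5⟩ := (mem_gridEdge_false hR hH hN0).1 h3
          rw [hre] at h4
          rw [him] at h5
          rcases eq_or_eq_of_int_add (J := k) (J' := l) h1 (by simpa using h4) with h6 | h6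
          · exact Or.inl h6
          · refine Or.inr (hcol' z h2 j' ?_ h5)
            rintro rfl
            have : l = k + 1 := by
              rw [h6] at h4; exact_mod_cast h4.symm
            exact htop (this ▸ he)
        · obtain ⟨-, J', -, h3⟩ := (mem_gridEdge_true hR hH hN0).1 h3
          rw [him] at h3
          exact Or.inr (eq_or_eq_of_int_add h2 h3)
      · obtain ⟨h4, h5⟩ := (mem_gridSquare hR hH hN0).1 h3
        have hle := hQ _ hq'
        simp only at hle h4 h5
        rw [hre] at h4
        rw [him] at h5
        rcases hle.lt_or_eq with h6 | h6
        · have : (l : ℝ) + 1 ≤ k := by exact_mod_cast h6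
          exact Or.inl (by linarith [h1.1, h4.2])
        · refine Or.inr (hcol' z h2 j' ?_ h5)
          rintro rfl
          exact hq (h6 ▸ hq')

/-- Each edge of the grid is parametrized by a segment in a polar chart, from any of its ends. -/
theorem exists_edge_chart (hR : 0 < R) (hH : 0 < H) (hN : 3 ≤ N) (e : GridEdge N)
    {u w : ZMod N × ℕ} (h : (u = gridFst e ∧ w = gridSnd e) ∨ (u = gridSnd e ∧ w = gridFst e)) :
    ∃ Γ : ℂ → ℂ, IsChart Γ (Metric.ball 0 (3 / 2)) ∧ Γ 0 ∈ gridVertex R H N u ∧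
      Γ 1 ∈ gridVertex R H N w ∧ gridEdge R H N e = (fun x : ℝ => Γ x) '' Icc 0 1 := by
  have hN0 : N ≠ 0 := by omega
  obtain ⟨b, j, k⟩ := e
  obtain ⟨J, rfl⟩ := ZMod.intCast_surjective j
  -- the parametrization from the first end
  have key : ∃ ζ₀ d : ℂ, ‖d‖ = 1 ∧
      polarMap R H N ζ₀ ∈ gridVertex R H N (gridFst (b, (J : ZMod N), k)) ∧
      polarMap R H N (ζ₀ + d) ∈ gridVertex R H N (gridSnd (b, (J : ZMod N), k)) ∧
      gridEdge R H N (b, (J : ZMod N), k) =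
        (fun x : ℝ => polarMap R H N (ζ₀ + d * x)) '' Icc 0 1 := by
    cases b
    · refine ⟨⟨k, J⟩, Complex.I, by simp, (mem_gridVertex hR hH hN0).2 ⟨rfl, J, rfl, rfl⟩,
        (mem_gridVertex hR hH hN0).2 ⟨by simp [gridSnd], J + 1, by simp [gridSnd], by simp⟩, ?_⟩
      simp only [gridEdge, Bool.false_eq_true, if_false]
      rw [polarBox_gridCol hR hH hN0]
      apply Subset.antisymm
      · rintro _ ⟨ζ, ⟨h1, h2⟩, rfl⟩
        refine ⟨ζ.im - J, ⟨by linarith [h2.1], by linarith [h2.2]⟩, ?_⟩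
        beta_reduce
        congr 1
        have h1' : ζ.re = k := h1
        apply Complex.ext <;> simp [h1']
      · rintro _ ⟨x, hx, rfl⟩
        refine ⟨⟨k, J⟩ + Complex.I * x, ⟨by simp, ?_⟩, rfl⟩
        simp only [Complex.add_im, Complex.mul_im, Complex.I_re, Complex.I_im, Complex.ofReal_re,
          Complex.ofReal_im, zero_mul, one_mul, zero_add]
        exact ⟨by linarith [hx.1], by linarith [hx.2]⟩
    · refine ⟨⟨k, J⟩, 1, by simp, (mem_gridVertex hR hH hN0).2 ⟨rfl, J, rfl, rfl⟩,
        (mem_gridVertex hR hH hN0).2 ⟨by simp [gridSnd], J, by simp [gridSnd], by simp⟩, ?_⟩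
      simp only [gridEdge, if_true]
      rw [polarBox_gridLine hR hH hN0]
      apply Subset.antisymm
      · rintro _ ⟨ζ, ⟨h1, h2⟩, rfl⟩
        refine ⟨ζ.re - k, ⟨by linarith [h1.1], by linarith [h1.2]⟩, ?_⟩
        beta_reduce
        congr 1
        have h2' : ζ.im = J := h2
        apply Complex.ext <;> simp [h2']
      · rintro _ ⟨x, hx, rfl⟩
        have h1 : ((⟨k, J⟩ : ℂ) + 1 * x).re = k + x := by simp
        have h2 : ((⟨k, J⟩ : ℂ) + 1 * x).im = J := by simp
        refine mem_image_of_mem _ ⟨?_, h2⟩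
        rw [h1]
        exact ⟨by linarith [hx.1], by linarith [hx.2]⟩
  obtain ⟨ζ₀, d, hd, h0, h1, himg⟩ := key
  rcases h with ⟨rfl, rfl⟩ | ⟨rfl, rfl⟩
  · refine ⟨fun x => polarMap R H N (ζ₀ + d * x), isChart_polarMap hR hH hN ζ₀ hd, ?_, ?_, himg⟩
    · beta_reduce; rw [mul_zero, add_zero]; exact h0
    · beta_reduce; rw [mul_one]; exact h1
  · refine ⟨fun x => polarMap R H N (ζ₀ + d + -d * x),
      isChart_polarMap hR hH hN (ζ₀ + d) (by rw [norm_neg]; exact hd), ?_, ?_, ?_⟩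
    · beta_reduce; rw [mul_zero, add_zero]; exact h1
    · beta_reduce; rw [mul_one, add_neg_cancel_right]; exact h0
    rw [himg]
    apply Subset.antisymm
    · rintro _ ⟨x, hx, rfl⟩
      refine ⟨1 - x, ⟨by linarith [hx.2], by linarith [hx.1]⟩, ?_⟩
      beta_reduce
      congr 1
      push_cast
      ring
    · rintro _ ⟨x, hx, rfl⟩
      refine ⟨1 - x, ⟨by linarith [hx.2], by linarith [hx.1]⟩, ?_⟩
      beta_reduce
      congr 1
      push_cast
      ring

theorem gridVertex_subsingleton (hR : 0 < R) (hH : 0 < H) (hN : N ≠ 0) (v : ZMod N × ℕ) :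
    (gridVertex R H N v).Subsingleton := by
  obtain ⟨j, k⟩ := v
  obtain ⟨J, rfl⟩ := ZMod.intCast_surjective j
  rw [gridVertex, polarBox_gridLine hR hH hN]
  rintro _ ⟨ζ, ⟨h1, h2⟩, rfl⟩ _ ⟨ξ, ⟨h3, h4⟩, rfl⟩
  congr 1
  exact Complex.ext (h1.trans h3.symm) (h2.trans h4.symm)

theorem exists_polarMap_of_mem_edge {e : GridEdge N} {z : ℂ} (hz : z ∈ gridEdge R H N e) :
    ∃ ζ, polarMap R H N ζ = z := by
  rw [gridEdge] at hz
  split_ifs at hz <;> obtain ⟨ζ, -, h⟩ := hz <;> exact ⟨ζ, h⟩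

/-- Collapse of an edge of the grid from a leaf. -/
theorem shrinksTo_gridEdge (hR : 0 < R) (hH : 0 < H) (hN : 3 ≤ N) {Z C : Set ℂ} (hZ : IsClosed Z)
    (hC : IsClosed C) (hCR : ∀ z ∈ C, ‖z‖ = R) {X : Finset (ZMod N × ℕ)} {E : Finset (GridEdge N)}
    {e : GridEdge N} (he : e ∉ E) (heZ : Disjoint (gridEdge R H N e) Z)
    (hlev : e.1 = false → e.2.2 ≠ 0) {u w : ZMod N × ℕ}
    (huw : (u = gridFst e ∧ w = gridSnd e) ∨ (u = gridSnd e ∧ w = gridFst e)) (hw : w.2 ≠ 0)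
    (hleaf : ∀ e' ∈ E, gridFst e' ≠ w ∧ gridSnd e' ≠ w) (hwX : w ∉ X)
    (hu : gridVertex R H N u ⊆ gridComplex R H N C X E ∅) :
    ShrinksTo (Z ∪ Metric.closedBall 0 R) (gridComplex R H N C X E ∅ ∪ gridEdge R H N e)
      (gridComplex R H N C X E ∅) := by
  have hN0 : N ≠ 0 := by omega
  obtain ⟨Γ, hchart, h0, h1, himg⟩ := exists_edge_chart hR hH hN e huw
  rw [himg]
  have hO : ∀ x : ℝ, x ∈ Icc (0 : ℝ) 1 → (x : ℂ) ∈ Metric.ball (0 : ℂ) (3 / 2) := by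
    intro x hx
    rw [mem_ball_zero_iff, Complex.norm_real, Real.norm_eq_abs, abs_of_nonneg hx.1]
    linarith [hx.2]
  refine hchart.shrinksTo_segment (hZ.union Metric.isClosed_closedBall)
    (isClosed_gridComplex hR hH hN0 hC X E ∅) hO (hu h0) (fun x hx => ?_)
  have hx' : x ∈ Icc (0 : ℝ) 1 := ⟨hx.1.le, hx.2⟩
  have hxe : Γ x ∈ gridEdge R H N e := by rw [himg]; exact ⟨x, hx', rfl⟩
  have hxu : Γ x ∉ gridVertex R H N u := by
    intro h
    have h2 := gridVertex_subsingleton hR hH hN0 u h h0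
    have h3 := hchart.injOn (hO x hx') (by simp) h2
    exact hx.1.ne' (by exact_mod_cast h3)
  obtain ⟨ζ, hζ⟩ := exists_polarMap_of_mem_edge hxe
  rw [← hζ] at hxe hxu ⊢
  have hend : ∀ v, polarMap R H N ζ ∈ gridVertex R H N v → v = w := by
    intro v hv
    have h2 := eq_end_of_mem hR hH hN0 hxe hv
    rcases huw with ⟨h3, h4⟩ | ⟨h3, h4⟩ <;> rcases h2 with h2 | h2
    · exact absurd (h3 ▸ h2 ▸ hv) hxu
    · rw [h4, h2]
    · rw [h4, h2]
    · exact absurd (h3 ▸ h2 ▸ hv) hxu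
  have hre : 0 < ζ.re := by
    obtain ⟨b, j, k⟩ := e
    cases b
    · rw [((mem_gridEdge_false hR hH hN0).1 hxe).1]
      have := hlev rfl
      exact_mod_cast Nat.pos_of_ne_zero this
    · obtain ⟨h2, h3⟩ := (mem_gridEdge_true hR hH hN0).1 hxe
      have h4 : 0 ≤ ζ.re := (Nat.cast_nonneg _).trans h2.1
      refine lt_of_le_of_ne h4 (fun h => ?_)
      have h5 := hend (j, 0) ((mem_gridVertex hR hH hN0).2 ⟨by simp [← h], h3⟩)
      rw [← h5] at hw
      exact hw rfl
  rintro ((h2 | h2) | h2)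
  · exact disjoint_left.1 heZ hxe h2
  · rw [Metric.mem_closedBall, dist_zero_right, norm_polarMap_le_iff hR hH hN0] at h2
    linarith
  · rw [mem_gridComplex] at h2
    rcases h2 with h2 | ⟨v, hv, h2⟩ | ⟨e', he', h2⟩ | ⟨q, hq, -⟩
    · have := (norm_polarMap_eq_iff hR hH hN0).1 (hCR _ h2)
      linarith
    · exact hwX (hend v h2 ▸ hv)
    · obtain ⟨v, hv⟩ := exists_common_end hR hH hN0 (by rintro rfl; exact he he') hxe h2
      have h3 := hend v hv
      subst h3
      rcases eq_end_of_mem hR hH hN0 h2 hv with h4 | h4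
      · exact (hleaf e' he').1 h4
      · exact (hleaf e' he').2 h4
    · simp at hq

end Collapse

/-! ### Collapsing a continuum into a disc -/

theorem isGoodEdge_of_subset {R H : ℝ} {N : ℕ} {Z : Set ℂ} {q : ZMod N × ℕ}
    (hq : IsGoodSquare R H N Z q) {e : GridEdge N} (he : gridEdge R H N e ⊆ gridSquare R H N q)
    (hlev : if e.1 then e.2.2 < N else 1 ≤ e.2.2 ∧ e.2.2 ≤ N) : IsGoodEdge R H N Z e :=
  ⟨hlev, hq.2.mono_left he⟩

/-- The good squares of a polar grid shrink to a part of the initial circle and the vertices off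
this circle: the squares are collapsed through their outer sides, by decreasing level; the graph
of the remaining edges is a forest, and is collapsed leaf by leaf. -/
theorem exists_shrinksTo_circle {R H : ℝ} {N : ℕ} (hR : 0 < R) (hH : 0 < H) (hN : 3 ≤ N) {Z : Set ℂ}
    (hZ : IsClosed Z) (hZe : IsEndless Z R) :
    ∃ C : Set ℂ, IsClosed C ∧ (∀ z ∈ C, ‖z‖ = R ∧ z ∉ Z) ∧
      ∃ X : Set ℂ, (∀ z ∈ X, R * Real.exp (H / N) ≤ ‖z‖) ∧
      ShrinksTo (Z ∪ Metric.closedBall 0 R)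
        {z | ∃ q, IsGoodSquare R H N Z q ∧ z ∈ gridSquare R H N q} (C ∪ X) := by
  classical
  have hN0 : N ≠ 0 := by omega
  have : NeZero N := ⟨hN0⟩
  set Q₀ : Finset (ZMod N × ℕ) :=
    (Finset.univ ×ˢ Finset.range N).filter (IsGoodSquare R H N Z) with hQ₀
  set E₀ : Finset (GridEdge N) :=
    (Finset.univ ×ˢ (Finset.univ ×ˢ Finset.range (N + 1))).filter (IsGoodEdge R H N Z) with hE₀
  set X₀ : Finset (ZMod N × ℕ) := Finset.univ ×ˢ Finset.Icc 1 N with hX₀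
  have hQm : ∀ q, q ∈ Q₀ ↔ IsGoodSquare R H N Z q := by
    rintro ⟨j, k⟩
    simp only [hQ₀, Finset.mem_filter, Finset.mem_product, Finset.mem_univ, true_and,
      Finset.mem_range, and_iff_right_iff_imp]
    exact fun h => h.1
  have hEm : ∀ e, e ∈ E₀ ↔ IsGoodEdge R H N Z e := by
    rintro ⟨b, j, k⟩
    simp only [hE₀, Finset.mem_filter, Finset.mem_product, Finset.mem_univ, true_and,
      Finset.mem_range, and_iff_right_iff_imp]
    intro h
    have := h.1
    cases b <;> simp at this <;> omega
  set C : Set ℂ := {z | ‖z‖ = R} ∩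
    ((⋃ q ∈ Q₀, gridSquare R H N q) ∪ ⋃ e ∈ E₀, gridEdge R H N e) with hC
  have hCc : IsClosed C := (isClosed_eq continuous_norm continuous_const).inter
    ((isClosed_biUnion_finset fun q _ => (isCompact_gridSquare hR hH hN0 q).isClosed).union
      (isClosed_biUnion_finset fun e _ => (isCompact_gridEdge hR hH hN0 e).isClosed))
  have hCR : ∀ z ∈ C, ‖z‖ = R := fun z hz => hz.1
  have hCq : ∀ q ∈ Q₀, ∀ z ∈ gridSquare R H N q, ‖z‖ = R → z ∈ C := fun q hq z hz h =>
    ⟨h, Or.inl (mem_biUnion (x := q) hq hz)⟩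
  have hCe : ∀ e ∈ E₀, ∀ z ∈ gridEdge R H N e, ‖z‖ = R → z ∈ C := fun e he z hz h =>
    ⟨h, Or.inr (mem_biUnion (x := e) he hz)⟩
  -- the edges left once the squares outside `Q` are collapsed
  let E : Finset (ZMod N × ℕ) → Finset (GridEdge N) := fun Q =>
    E₀.filter (fun e => ∀ q ∈ Q₀ \ Q, e ≠ (false, q.1, q.2 + 1))
  have squares : ∀ n, ∀ Q : Finset (ZMod N × ℕ), Q.card = n → Q ⊆ Q₀ →
      (∀ q ∈ Q₀ \ Q, ∀ q' ∈ Q, q'.2 ≤ q.2) → ShrinksTo (Z ∪ Metric.closedBall 0 R)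
        (gridComplex R H N C X₀ (E Q) Q) (gridComplex R H N C X₀ (E ∅) ∅) := by
    intro n
    induction n with
    | zero =>
      intro Q hQ _ _
      rw [Finset.card_eq_zero.1 hQ]
      exact ShrinksTo.of_subset subset_rfl
    | succ n ih =>
      intro Q hcard hQ hlev
      obtain ⟨q, hq, hqmax⟩ := Q.exists_max_image (fun q => q.2)
        (Finset.card_pos.1 (by omega))
      have hqg := (hQm q).1 (hQ hq)
      have hq1 : q ∈ Q₀ \ Q.erase q := by simp [hQ hq]
      have hcases : ∀ q' ∈ Q₀ \ Q.erase q, q' = q ∨ q' ∈ Q₀ \ Q := by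
        intro q' hq'
        simp only [Finset.mem_sdiff, Finset.mem_erase, not_and] at hq' ⊢
        by_cases h : q' = q
        · exact Or.inl h
        · exact Or.inr ⟨hq'.1, hq'.2 h⟩
      have hlev' : ∀ q' ∈ Q₀ \ Q.erase q, q.2 ≤ q'.2 := by
        intro q' hq'
        rcases hcases q' hq' with rfl | h
        · exact le_rfl
        · exact hlev q' h q hq
      refine ShrinksTo.trans (B := gridComplex R H N C X₀ (E (Q.erase q)) (Q.erase q)) ?_
        (ih _ (by rw [Finset.card_erase_of_mem hq, hcard]; rfl)
          ((Finset.erase_subset _ _).trans hQ)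
          (fun q' hq' q'' hq'' => (hqmax q'' (Finset.mem_of_mem_erase hq'')).trans (hlev' q' hq')))
      have hmemE : ∀ e, IsGoodEdge R H N Z e →
          (∀ q' : ZMod N × ℕ, q.2 ≤ q'.2 → e ≠ (false, q'.1, q'.2 + 1)) → e ∈ E (Q.erase q) :=
        fun e he h => Finset.mem_filter.2 ⟨(hEm e).2 he, fun q' hq' => h q' (hlev' q' hq')⟩
      refine ShrinksTo.trans (ShrinksTo.of_subset ?_)
        (shrinksTo_gridSquare (q := q) hR hH hN hZ hCc hCR (Finset.notMem_erase _ _) hqg.2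
          (fun q' hq' => hqmax q' (Finset.mem_of_mem_erase hq'))
          (fun h => (Finset.mem_filter.1 h).2 q hq1 rfl) (hCq q (hQ hq))
          (fun h => hmemE _ (isGoodEdge_of_subset hqg (gridEdge_bot_subset q) ?_) ?_)
          (hmemE _ (isGoodEdge_of_subset hqg (gridEdge_left_subset q) ?_) ?_)
          (hmemE _ (isGoodEdge_of_subset hqg (gridEdge_right_subset q) ?_) ?_))
      · intro z hz
        rw [mem_gridComplex] at hz
        rw [mem_union, mem_gridComplex]
        rcases hz with hz | hz | ⟨e, he, hz⟩ | ⟨q', hq', hz⟩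
        · exact Or.inl (Or.inl hz)
        · exact Or.inl (Or.inr (Or.inl hz))
        · by_cases hetop : e = (false, q.1, q.2 + 1)
          · subst hetop
            exact Or.inr (gridEdge_top_subset q hz)
          · refine Or.inl (Or.inr (Or.inr (Or.inl ⟨e, Finset.mem_filter.2
              ⟨(Finset.mem_filter.1 he).1, fun q' hq' => ?_⟩, hz⟩)))
            rcases hcases q' hq' with rfl | h
            · exact hetop
            · exact (Finset.mem_filter.1 he).2 q' h
        · by_cases hqq : q' = q
          · subst hqq
            exact Or.inr hz
          · exact Or.inl (Or.inr (Or.inr (Or.inr ⟨q', Finset.mem_erase.2 ⟨hqq, hq'⟩, hz⟩)))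
      · have := hqg.1
        simp only [Bool.false_eq_true, if_false]
        omega
      · rintro q' hq' heq
        simp only [Prod.mk.injEq, true_and] at heq
        have := congrArg Prod.snd heq
        simp only at this
        omega
      · simpa using hqg.1
      · simp
      · simpa using hqg.1
      · simp
  -- without its squares, the complex is a forest relative to the initial circle
  have edges : ∀ n, ∀ F : Finset (GridEdge N), F.card = n → F ⊆ E ∅ →
      ShrinksTo (Z ∪ Metric.closedBall 0 R) (gridComplex R H N C X₀ F ∅)
        (gridComplex R H N C X₀ ∅ ∅) := by
    intro n
    induction n with
    | zero =>
      intro F hF _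
      rw [Finset.card_eq_zero.1 hF]
      exact ShrinksTo.of_subset subset_rfl
    | succ n ih =>
      intro F hcard hF
      obtain ⟨e, he, w, hwC, hew, hleaf⟩ := exists_leaf (gridFst (N := N)) gridSnd {v | v.2 = 0} F
        (Finset.card_pos.1 (by omega)) (by
          intro x hx hx0
          by_contra hcon
          push Not at hcon
          obtain ⟨e, he, hxe⟩ := hx
          refine hxe (eq_zero_of_even_degrees hR hH hZe (x := x) (fun f hf => ?_)
            (fun j k => ?_) e)
          · have hfF : f ∈ F := by
              by_contra h
              exact hf (hx0 f h)
            have hfE := Finset.mem_filter.1 (hF hfF)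
            refine ⟨(hEm f).1 hfE.1, fun q hfq hq => hfE.2 q ?_ hfq⟩
            simpa using (hQm q).2 hq
          · rw [← sum_incidences hx0]
            exact hcon (j, k + 1) (by simp))
      have hwC' : w.2 ≠ 0 := hwC
      have heE := Finset.mem_filter.1 (hF he)
      have heg := (hEm e).1 heE.1
      obtain ⟨u, huw⟩ : ∃ u, (u = gridFst e ∧ w = gridSnd e) ∨ (u = gridSnd e ∧ w = gridFst e) := by
        rcases hew with h | h
        · exact ⟨_, Or.inr ⟨rfl, h.symm⟩⟩
        · exact ⟨_, Or.inl ⟨rfl, h.symm⟩⟩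
      obtain ⟨Γ, -, h0, h1, himg⟩ := exists_edge_chart hR hH hN e huw
      have hue : gridVertex R H N u ⊆ gridEdge R H N e := by
        intro z hz
        rw [gridVertex_subsingleton hR hH hN0 u hz h0, himg]
        exact ⟨0, by simp, by simp⟩
      have hwe : gridVertex R H N w ⊆ gridEdge R H N e := by
        intro z hz
        rw [gridVertex_subsingleton hR hH hN0 w hz h1, himg]
        exact ⟨1, by simp, by simp⟩
      have hu2 : u.2 ≤ N ∧ u ≠ w := by
        have : Fact (1 < N) := ⟨by omega⟩
        obtain ⟨b, j, k⟩ := e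
        have := heg.1
        cases b <;> simp at this <;> rcases huw with ⟨rfl, rfl⟩ | ⟨rfl, rfl⟩ <;>
          simp [gridFst, gridSnd] <;> omega
      refine ShrinksTo.trans (ShrinksTo.of_subset ?_) (ShrinksTo.trans
        (shrinksTo_gridEdge (X := X₀.erase w) (E := F.erase e) hR hH hN hZ hCc hCR
          (Finset.notMem_erase _ _) heg.2 ?_ huw hwC' (fun e' he' => ?_)
          (Finset.notMem_erase _ _) ?_)
        (ShrinksTo.trans (ShrinksTo.of_subset ?_)
          (ih (F.erase e) (by rw [Finset.card_erase_of_mem he, hcard]; rfl)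
            ((Finset.erase_subset _ _).trans hF))))
      · intro z hz
        rw [mem_gridComplex] at hz
        rw [mem_union, mem_gridComplex]
        rcases hz with hz | ⟨v, hv, hz⟩ | ⟨e', he', hz⟩ | ⟨q', hq', hz⟩
        · exact Or.inl (Or.inl hz)
        · by_cases hvw : v = w
          · subst hvw
            exact Or.inr (hwe hz)
          · exact Or.inl (Or.inr (Or.inl ⟨v, Finset.mem_erase.2 ⟨hvw, hv⟩, hz⟩))
        · by_cases hee : e' = e
          · subst hee
            exact Or.inr hz
          · exact Or.inl (Or.inr (Or.inr (Or.inl ⟨e', Finset.mem_erase.2 ⟨hee, he'⟩, hz⟩)))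
        · simp at hq'
      · intro h
        have := heg.1
        rw [h] at this
        simp at this
        omega
      · have h2 := hleaf e' (Finset.mem_of_mem_erase he')
        have h3 := Finset.ne_of_mem_erase he'
        exact ⟨fun h => h3 (h2 (Or.inl h)), fun h => h3 (h2 (Or.inr h))⟩
      · intro z hz
        rw [mem_gridComplex]
        by_cases hu0 : u.2 = 0
        · left
          refine hCe e heE.1 z (hue hz) ?_
          obtain ⟨ζ, ⟨h3, -⟩, rfl⟩ := hz
          rw [norm_polarMap_eq_iff hR hH hN0, mem_singleton_iff.1 h3, hu0]
          simp
        · refine Or.inr (Or.inl ⟨u, Finset.mem_erase.2 ⟨hu2.2, ?_⟩, hz⟩)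
          simp only [hX₀, Finset.mem_product, Finset.mem_univ, true_and, Finset.mem_Icc]
          omega
      · intro z hz
        rw [mem_gridComplex] at hz ⊢
        rcases hz with hz | ⟨v, hv, hz⟩ | hz
        · exact Or.inl hz
        · exact Or.inr (Or.inl ⟨v, Finset.mem_of_mem_erase hv, hz⟩)
        · exact Or.inr (Or.inr hz)
  refine ⟨C, hCc, fun z hz => ⟨hz.1, ?_⟩, ⋃ v ∈ X₀, gridVertex R H N v, fun z hz => ?_, ?_⟩
  · rcases hz.2 with h | h
    · simp only [mem_iUnion, exists_prop] at h
      obtain ⟨q, hq, h⟩ := h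
      exact disjoint_left.1 ((hQm q).1 hq).2 h
    · simp only [mem_iUnion, exists_prop] at h
      obtain ⟨e, he, h⟩ := h
      exact disjoint_left.1 ((hEm e).1 he).2 h
  · simp only [mem_iUnion, exists_prop] at hz
    obtain ⟨v, hv, ζ, ⟨h1, -⟩, rfl⟩ := hz
    rw [norm_polarMap hR, mem_singleton_iff.1 h1]
    have hv1 : 1 ≤ v.2 := by
      simp only [hX₀, Finset.mem_product, Finset.mem_univ, true_and, Finset.mem_Icc] at hv
      exact hv.1
    have : (1 : ℝ) ≤ v.2 := by exact_mod_cast hv1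
    gcongr
    exact le_mul_of_one_le_left (by positivity) this
  · refine ShrinksTo.trans (ShrinksTo.of_subset ?_) (ShrinksTo.trans
      (squares Q₀.card Q₀ rfl subset_rfl (by simp)) (ShrinksTo.trans (edges _ _ rfl subset_rfl)
        (ShrinksTo.of_subset ?_)))
    · rintro z ⟨q, hq, hz⟩
      exact mem_gridComplex.2 (Or.inr (Or.inr (Or.inr ⟨q, (hQm q).2 hq, hz⟩)))
    · intro z hz
      rw [mem_gridComplex] at hz
      rcases hz with hz | ⟨v, hv, hz⟩ | ⟨e, he, -⟩ | ⟨q, hq, -⟩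
      · exact Or.inl hz
      · exact Or.inr (mem_biUnion (x := v) hv hz)
      · simp at he
      · simp at hq

/-- A connected compact set containing the origin and disjoint from an endless closed set off the
open disc of radius `R` can be moved into this disc, fixing the closed set and any smaller disc. -/
theorem exists_collapse {R r : ℝ} (hR : 0 < R) (hr : r < R) {Z K : Set ℂ} (hZ : IsClosed Z)
    (hZe : IsEndless Z R) (hK : IsCompact K) (hKc : IsPreconnected K) (h0 : (0 : ℂ) ∈ K)
    (hKZ : ∀ z ∈ K, R ≤ ‖z‖ → z ∉ Z) :
    ∃ D : Equiv.Perm ℂ, IsDiffeo D ∧ (∀ z ∈ Z, D z = z) ∧ (∀ z, ‖z‖ ≤ r → D z = z) ∧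
      ∀ z ∈ K, ‖D z‖ < R := by
  -- a fine grid
  obtain ⟨B, hB, hKB⟩ : ∃ B > 0, ∀ z ∈ K, ‖z‖ ≤ B := by
    obtain ⟨B, hB⟩ := hK.isBounded.exists_norm_le
    exact ⟨max B 1, by positivity, fun z hz => (hB z hz).trans (le_max_left _ _)⟩
  set H : ℝ := Real.log (1 + B / R) with hHd
  have hH : 0 < H := Real.log_pos (by linarith [div_pos hB hR])
  have hHexp : R * Real.exp H = R + B := by
    rw [hHd, Real.exp_log (by positivity)]; field_simp
  set K' : Set ℂ := K ∩ {z | R ≤ ‖z‖} with hK'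
  have hK'c : IsCompact K' := hK.inter_right (isClosed_le continuous_const continuous_norm)
  obtain ⟨d, hd, hthick⟩ := hK'c.exists_thickening_subset_open hZ.isOpen_compl
    (fun z hz => hKZ z hz.1 hz.2)
  obtain ⟨N, hN⟩ := exists_nat_gt (max 3 (max (H + 2 * Real.pi)
    (R * Real.exp H * (2 * (H + 2 * Real.pi)) / d)))
  have hN3 : 3 ≤ N := by
    have : (3 : ℝ) < N := (le_max_left _ _).trans_lt hN
    exact_mod_cast this.le
  have hN0 : N ≠ 0 := by omega
  have hN' : (0 : ℝ) < N := by positivity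
  have hNH : H + 2 * Real.pi ≤ N :=
    ((le_max_left _ _).trans (le_max_right _ _)).trans hN.le
  have hNd : R * Real.exp H * (2 * ((H + 2 * Real.pi) / N)) < d := by
    have h1 : R * Real.exp H * (2 * (H + 2 * Real.pi)) / d < N :=
      ((le_max_right _ _).trans (le_max_right _ _)).trans_lt hN
    rw [div_lt_iff₀ hd] at h1
    rw [mul_div_assoc', mul_div_assoc', div_lt_iff₀ hN']
    linarith
  have hcover : ∀ z ∈ K, R ≤ ‖z‖ → ∃ q, IsGoodSquare R H N Z q ∧ z ∈ gridSquare R H N q := by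
    intro z hz hzR
    obtain ⟨ζ, hζ, rfl⟩ := exists_polarMap_eq hR hH hN0 hzR
    have hζN : ζ.re < N := by
      have h1 : ‖polarMap R H N ζ‖ < R * Real.exp H := by
        rw [hHexp]; linarith [hKB _ hz]
      rw [norm_polarMap hR, mul_lt_mul_iff_right₀ hR, Real.exp_lt_exp, mul_div_assoc',
        div_lt_iff₀ hN', mul_comm H, mul_lt_mul_iff_left₀ hH] at h1
      exact h1
    have hre : ζ.re ∈ Icc (⌊ζ.re⌋₊ : ℝ) (⌊ζ.re⌋₊ + 1) :=
      ⟨Nat.floor_le hζ, (Nat.lt_floor_add_one _).le⟩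
    have him : ζ.im ∈ Icc (⌊ζ.im⌋ : ℝ) (⌊ζ.im⌋ + 1) :=
      ⟨Int.floor_le _, (Int.lt_floor_add_one _).le⟩
    refine ⟨(((⌊ζ.im⌋ : ℤ) : ZMod N), ⌊ζ.re⌋₊), ⟨(Nat.floor_lt hζ).2 hζN, ?_⟩,
      (mem_gridSquare hR hH hN0).2 ⟨hre, ⌊ζ.im⌋, rfl, him⟩⟩
    rw [disjoint_left]
    intro w hw
    rw [gridSquare, polarBox_gridCol hR hH hN0] at hw
    obtain ⟨ξ, ⟨h1, h2⟩, rfl⟩ := hw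
    refine hthick (Metric.mem_thickening_iff.2 ⟨_, ⟨hz, hzR⟩, ?_⟩)
    refine (dist_polarMap_le hR hH hNH hζN.le ?_ ?_).trans_lt hNd
    · rw [abs_le]; constructor <;> linarith [h1.1, h1.2, hre.1, hre.2]
    · rw [abs_le]; constructor <;> linarith [h2.1, h2.2, him.1, him.2]
  obtain ⟨C, hCc, hC, X, hX, hshrink⟩ := exists_shrinksTo_circle hR hH hN3 hZ hZe
  -- the part of the circle is pushed into the disc
  have hCcomp : IsCompact C := (isCompact_closedBall (0 : ℂ) R).of_isClosed_subset hCc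
    (fun z hz => by rw [Metric.mem_closedBall, dist_zero_right]; exact (hC z hz).1.le)
  obtain ⟨β, hβ, h01, ⟨U, -, hCU, hU⟩, K₂, hK₂, hK₂O, hK₂0⟩ := exists_cutoff hCcomp
    (hZ.union Metric.isClosed_closedBall).isOpen_compl (O := (Z ∪ Metric.closedBall 0 r)ᶜ) (by
      rintro z hz (h | h)
      · exact (hC z hz).2 h
      · rw [Metric.mem_closedBall, dist_zero_right, (hC z hz).1] at h
        linarith)
  have hgs : ContDiff ℝ ∞ (fun z : ℂ => (β z : ℂ) * z) :=
    (Complex.ofRealCLM.contDiff.comp hβ).mul contDiff_id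
  obtain ⟨ε, hε, hsmall⟩ := exists_diffeo_small_mul hgs
    (HasCompactSupport.intro hK₂ (fun z hz => by simp [hK₂0 z hz]))
  set w : ℝ := min (ε / 2) (1 / 2) with hw
  have hw0 : 0 < w := by positivity
  have hw1 : w ≤ 1 / 2 := min_le_right _ _
  obtain ⟨D, hD, hDz, -⟩ := hsmall ((-w : ℝ) : ℂ) (by
    rw [Complex.norm_real, Real.norm_eq_abs, abs_neg, abs_of_pos hw0]
    linarith [min_le_left (ε / 2) (1 / 2 : ℝ)])
  have hDz' : ∀ z, D z = ((1 - w * β z : ℝ) : ℂ) * z := fun z => by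
    rw [hDz]; push_cast; ring
  have hDn : ∀ z, ‖D z‖ = (1 - w * β z) * ‖z‖ := fun z => by
    rw [hDz', norm_mul, Complex.norm_real, Real.norm_eq_abs, abs_of_nonneg]
    nlinarith [(h01 z).1, (h01 z).2]
  have hDle : ∀ z, ‖D z‖ ≤ ‖z‖ := fun z => by
    rw [hDn]
    exact mul_le_of_le_one_left (norm_nonneg z) (by nlinarith [(h01 z).1])
  have hDfix : ∀ z, z ∈ Z ∪ Metric.closedBall 0 r → D z = z := by
    intro z hz
    have : β z = 0 := hK₂0 z (fun h => hK₂O h hz)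
    rw [hDz', this]; simp
  have hq : 1 < Real.exp (H / N / 2) := Real.one_lt_exp_iff.2 (by positivity)
  have hq2 : Real.exp (H / N / 2) < Real.exp (H / N) := Real.exp_lt_exp.2 (by
    have : 0 < H / N := by positivity
    linarith)
  set ρ : ℝ := R * Real.exp (H / N / 2) with hρ
  have hRρ : R < ρ := lt_mul_of_one_lt_right hR hq
  set N₁ : Set ℂ := {z | ‖D z‖ < R} ∩ {z | ‖z‖ < ρ} with hN₁
  set N₂ : Set ℂ := {z | ρ < ‖z‖} with hN₂
  have hN₁o : IsOpen N₁ := (isOpen_lt hD.continuous.norm continuous_const).inter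
    (isOpen_lt continuous_norm continuous_const)
  have hN₂o : IsOpen N₂ := isOpen_lt continuous_const continuous_norm
  obtain ⟨E, hE, hEfix, hEN⟩ := hshrink (N₁ ∪ N₂) (hN₁o.union hN₂o) (by
    rintro z (hz | hz)
    · left
      refine ⟨?_, ?_⟩
      · change ‖D z‖ < R
        rw [hDn, hU z (hCU hz), (hC z hz).1]
        nlinarith
      · change ‖z‖ < ρ
        rw [(hC z hz).1]; exact hRρ
    · right
      exact lt_of_lt_of_le (by rw [hρ]; gcongr) (hX z hz))
  have hball : ∀ z : ℂ, ‖z‖ ≤ R → E z = z := fun z hz => hEfix z (Or.inr (by simpa using hz))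
  have hmaps : ∀ z ∈ E '' K, z ∈ N₁ ∪ N₂ := by
    rintro _ ⟨z, hz, rfl⟩
    by_cases hzR : R ≤ ‖z‖
    · exact hEN z (hcover z hz hzR)
    · push Not at hzR
      rw [hball z hzR.le]
      exact Or.inl ⟨(hDle z).trans_lt hzR, hzR.trans hRρ⟩
  have hE0 : (0 : ℂ) ∈ E '' K := ⟨0, h0, hball 0 (by simpa using hR.le)⟩
  have h0N : (0 : ℂ) ∈ N₁ :=
    ⟨by change ‖D 0‖ < R; rw [hDn]; simpa using hR, by change ‖(0 : ℂ)‖ < ρ; simp; linarith⟩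
  have hsub : E '' K ⊆ N₁ := (hKc.image E hE.continuous.continuousOn).subset_left_of_subset_union
    hN₁o hN₂o (disjoint_left.2 fun z h1 h2 => lt_asymm (show ‖z‖ < ρ from h1.2) h2) hmaps
    ⟨0, hE0, h0N⟩
  refine ⟨D * E, hD.mul hE, fun z hz => ?_, fun z hz => ?_, fun z hz => ?_⟩
  · rw [Equiv.Perm.mul_apply, hEfix z (Or.inl hz), hDfix z (Or.inl hz)]
  · rw [Equiv.Perm.mul_apply, hball z (hz.trans hr.le), hDfix z (Or.inr (by simpa using hz))]
  · exact (hsub ⟨z, hz, rfl⟩).1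

/-! ### Making a curve radial near a transversal crossing of a circle -/

/-- A shear along vertical lines, localized near the origin. -/
theorem exists_shear {O : Set ℂ} (hO : IsOpen O) (h0 : (0 : ℂ) ∈ O) {G : ℝ → ℝ} {V : Set ℝ}
    (hV : IsOpen V) (h0V : (0 : ℝ) ∈ V) (hG : ContDiffOn ℝ ∞ G V) (hG0 : G 0 = 0) :
    ∃ D : Equiv.Perm ℂ, IsDiffeo D ∧ (∃ K, IsCompact K ∧ K ⊆ O ∧ ∀ z, z ∉ K → D z = z) ∧
      (∀ z, (D z).re = z.re) ∧ ∀ᶠ z in 𝓝 (0 : ℂ), D z = z + G z.re * Complex.I := by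
  obtain ⟨β, hβ, -, ⟨U, hU, h0U, hUβ⟩, K, hK, hKO, hK0⟩ := exists_cutoff
    (isCompact_singleton (x := (0 : ℂ))) (hO.inter (hV.preimage Complex.continuous_re))
    (singleton_subset_iff.2 ⟨h0, h0V⟩)
  set g : ℂ → ℂ := fun z => ((β z * G z.re : ℝ) : ℂ) * Complex.I with hg
  have hgs : ContDiff ℝ ∞ g := by
    rw [contDiff_iff_contDiffAt]
    intro z
    by_cases hz : z ∈ K
    · have h1 : ContDiffAt ℝ ∞ (fun z : ℂ => G z.re) z :=
        (hG.contDiffAt (hV.mem_nhds (hKO hz).2)).comp z Complex.reCLM.contDiff.contDiffAt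
      exact (Complex.ofRealCLM.contDiff.contDiffAt.comp z (hβ.contDiffAt.mul h1)).mul
        contDiffAt_const
    · refine (contDiffAt_const (c := (0 : ℂ))).congr_of_eventuallyEq ?_
      filter_upwards [hK.isClosed.isOpen_compl.mem_nhds hz] with y hy
      simp [hg, hK0 y hy]
  obtain ⟨ε, hε, hsmall⟩ := exists_diffeo_small_mul hgs
    (HasCompactSupport.intro hK (fun z hz => by simp [hg, hK0 z hz]))
  obtain ⟨n, hn⟩ := exists_nat_gt (1 / ε)
  have hn0 : (0 : ℝ) < n := (by positivity : 0 < 1 / ε).trans hn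
  obtain ⟨D, hD, hDz, -⟩ := hsmall ((1 / n : ℝ) : ℂ) (by
    rw [Complex.norm_real, Real.norm_eq_abs, abs_of_pos (by positivity), div_lt_iff₀ hn0]
    rwa [div_lt_iff₀ hε, mul_comm] at hn)
  have hDz' : ∀ z, D z = z + ((1 / n * (β z * G z.re) : ℝ) : ℂ) * Complex.I := fun z => by
    rw [hDz]; simp only [hg]; push_cast; ring
  have hre : ∀ z, (D z).re = z.re := fun z => by
    rw [hDz', Complex.add_re, Complex.re_ofReal_mul]; simp
  have hren : ∀ (k : ℕ) (z : ℂ), ((D ^ k) z).re = z.re := by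
    intro k
    induction k with
    | zero => simp
    | succ k ih => intro z; rw [pow_succ', Equiv.Perm.mul_apply, hre, ih]
  refine ⟨D ^ n, hD.pow n, ⟨K, hK, fun z hz => (hKO hz).1, fun z hz => Equiv.Perm.pow_fix ?_ n⟩,
    hren n, ?_⟩
  · rw [hDz', hK0 z hz]; simp
  · obtain ⟨η, hη, hball⟩ := Metric.isOpen_iff.1 hU 0 (h0U rfl)
    have h1 : ContinuousAt (fun z : ℂ => G z.re) 0 :=
      ContinuousAt.comp (g := G) (f := Complex.re)
        (hG.continuousOn.continuousAt (hV.mem_nhds h0V)) Complex.continuous_re.continuousAt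
    have h2 : ∀ᶠ z : ℂ in 𝓝 0, |G z.re| < η / 2 := by
      have := h1.eventually (Metric.ball_mem_nhds _ (half_pos hη))
      filter_upwards [this] with z hz
      simpa [hG0, Real.dist_eq] using hz
    filter_upwards [h2, Metric.ball_mem_nhds (0 : ℂ) (half_pos hη)] with z hz1 hz2
    have key : ∀ k : ℕ, k ≤ n → (D ^ k) z = z + ((k / n * G z.re : ℝ) : ℂ) * Complex.I := by
      intro k
      induction k with
      | zero => simp
      | succ k ih =>
        intro hk
        have h3 := ih (by omega)
        have h4 : (D ^ k) z ∈ U := by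
          apply hball
          rw [mem_ball_zero_iff, h3]
          refine (norm_add_le _ _).trans_lt ?_
          rw [norm_mul, Complex.norm_I, mul_one, Complex.norm_real, Real.norm_eq_abs, abs_mul]
          rw [mem_ball_zero_iff] at hz2
          have h5 : |(k : ℝ) / n| ≤ 1 := by
            rw [abs_of_nonneg (by positivity), div_le_one hn0]
            exact_mod_cast (by omega : k ≤ n)
          nlinarith [abs_nonneg (G z.re)]
        rw [pow_succ', Equiv.Perm.mul_apply, hDz', hUβ _ h4, hren, h3]
        push_cast
        field_simp
        ring
    rw [key n le_rfl, div_self hn0.ne', one_mul]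

/-- A smooth curve crossing a circle around the origin transversally can be made radial near the
crossing, by a diffeomorphism preserving the distance to the origin. -/
theorem exists_make_radial {O : Set ℂ} (hO : IsOpen O) {b : ℝ → ℂ} (hb : ContDiff ℝ ∞ b) {t₀ : ℝ}
    (hbO : b t₀ ∈ O) (h0 : b t₀ ≠ 0) (hder : deriv (fun t => ‖b t‖ ^ 2) t₀ ≠ 0) :
    ∃ D : Equiv.Perm ℂ, IsDiffeo D ∧ (∀ z, z ∉ O → D z = z) ∧ (∀ z, ‖D z‖ = ‖z‖) ∧
      ∀ᶠ t in 𝓝 t₀, ∃ r : ℝ, 0 < r ∧ D (b t) = r • b t₀ := by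
  have hR : 0 < ‖b t₀‖ := norm_pos_iff.2 h0
  set R : ℝ := ‖b t₀‖ with hRd
  obtain ⟨ζ₀, -, hζ₀⟩ := exists_polarMap_eq (H := 1) (N := 3) hR one_pos (by norm_num)
    (z := b t₀) le_rfl
  have hζre : ζ₀.re = 0 := (norm_polarMap_eq_iff (N := 3) hR one_pos (by norm_num)).1 (by rw [hζ₀])
  set Γ : ℂ → ℂ := fun x => polarMap R 1 3 (ζ₀ + 1 * x) with hΓ
  have hchart : IsChart Γ (Metric.ball 0 (3 / 2)) :=
    isChart_polarMap hR one_pos (by norm_num) ζ₀ (by simp)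
  have hΓ0 : Γ 0 = b t₀ := by simp [hΓ, hζ₀]
  have hΓn : ∀ x, ‖Γ x‖ = R * Real.exp (x.re * (1 / 3)) := fun x => by
    rw [hΓ]
    simp only
    rw [norm_polarMap hR, Complex.add_re, hζre, one_mul, zero_add]
    simp
  have hΓr : ∀ y : ℝ, Γ y = Real.exp (y * (1 / 3)) • b t₀ := fun y => by
    rw [← hζ₀, hΓ]
    simp only [polarMap]
    simp only [Complex.add_re, Complex.add_im, one_mul, Complex.ofReal_re, Complex.ofReal_im,
      add_zero, Complex.real_smul, Complex.ofReal_exp]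
    symm
    rw [mul_left_comm, ← Complex.exp_add]
    congr 2
    push_cast
    ring
  obtain ⟨e, hes, het, heΓ, hesm⟩ := hchart.exists_partialHomeomorph
  have hb0 : b t₀ ∈ e.target := by rw [het]; exact ⟨0, by simp, hΓ0⟩
  -- the curve in logarithmic polar coordinates
  set T : Set ℝ := b ⁻¹' e.target with hT
  have hTo : IsOpen T := e.open_target.preimage hb.continuous
  set β : ℝ → ℂ := fun t => e.symm (b t) with hβ
  have hβs : ContDiffOn ℝ ∞ β T := hesm.comp hb.contDiffOn (fun t ht => ht)
  have hβ0 : β t₀ = 0 := by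
    have : e.symm (e 0) = 0 := e.left_inv (by rw [hes]; simp)
    rw [heΓ, hΓ0] at this
    exact this
  have hΓβ : ∀ t ∈ T, Γ (β t) = b t := fun t ht => by
    rw [← heΓ]; exact e.right_inv ht
  have hβre : ∀ t ∈ T, ‖b t‖ ^ 2 = R ^ 2 * Real.exp ((β t).re * (2 / 3)) := fun t ht => by
    rw [← hΓβ t ht, hΓn, mul_pow, ← Real.exp_nat_mul]
    congr 2
    push_cast
    ring
  have hres : ContDiffOn ℝ ∞ (fun t => (β t).re) T := Complex.reCLM.contDiff.comp_contDiffOn hβs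
  -- its radial coordinate is a local parameter
  have hreD : deriv (fun t => (β t).re) t₀ ≠ 0 := by
    intro h
    apply hder
    have h1 : HasDerivAt (fun t => (β t).re) 0 t₀ := by
      rw [← h]
      exact ((hres.contDiffAt (hTo.mem_nhds hb0)).differentiableAt (by simp)).hasDerivAt
    have h2 : HasDerivAt (fun t => R ^ 2 * Real.exp ((β t).re * (2 / 3))) 0 t₀ := by
      have := ((h1.mul_const (2 / 3 : ℝ)).exp).const_mul (R ^ 2)
      simpa using this
    have h3 : (fun t => ‖b t‖ ^ 2) =ᶠ[𝓝 t₀] fun t => R ^ 2 * Real.exp ((β t).re * (2 / 3)) := by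
      filter_upwards [hTo.mem_nhds hb0] with t ht
      exact hβre t ht
    exact (h2.congr_of_eventuallyEq h3).deriv
  -- a plane chart extending this parameter
  set Ψ : ℂ → ℂ := fun w => β w.re + Complex.I * w.im with hΨ
  obtain ⟨τ, V, hV, h0V, hτ, hτβ, hτ0⟩ : ∃ (τ : ℝ → ℝ) (V : Set ℝ), IsOpen V ∧ (0 : ℝ) ∈ V ∧
      ContDiffOn ℝ ∞ τ V ∧ (∀ᶠ t in 𝓝 t₀, τ (β t).re = t) ∧ ∀ y ∈ V, τ y ∈ T := by
    have hc : ContDiffAt ℝ ∞ (fun t => (β t).re) t₀ := hres.contDiffAt (hTo.mem_nhds hb0)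
    have hst : HasStrictDerivAt (fun t => (β t).re) (deriv (fun t => (β t).re) t₀) t₀ :=
      hc.hasStrictDerivAt (by simp)
    set f' : ℝ ≃L[ℝ] ℝ := ContinuousLinearEquiv.unitsEquivAut ℝ (Units.mk0 _ hreD) with hf'
    have hst' : HasStrictFDerivAt (fun t => (β t).re) (f' : ℝ →L[ℝ] ℝ) t₀ :=
      hst.hasStrictFDerivAt_equiv hreD
    set p := hst'.toOpenPartialHomeomorph (fun t => (β t).re) with hp
    have hpx : ∀ t, p t = (β t).re := fun t => rfl
    have hdc : ContinuousOn (fun t => deriv (fun t => (β t).re) t) T :=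
      hres.continuousOn_deriv_of_isOpen hTo (by simp)
    set W : Set ℝ := {t ∈ T | deriv (fun t => (β t).re) t ≠ 0} with hW
    have hWo : IsOpen W := hdc.isOpen_inter_preimage hTo isOpen_compl_singleton
    have ht₀ : t₀ ∈ p.source := hst'.mem_toOpenPartialHomeomorph_source
    have hp0 : p t₀ = 0 := by rw [hpx, hβ0]; rfl
    have h0t : (0 : ℝ) ∈ p.target := by rw [← hp0]; exact p.map_source ht₀
    have hs0 : p.symm 0 = t₀ := by rw [← hp0]; exact p.left_inv ht₀
    refine ⟨p.symm, p.target ∩ p.symm ⁻¹' W, p.isOpen_inter_preimage_symm hWo, ⟨h0t, ?_⟩, ?_, ?_,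
      fun y hy => hy.2.1⟩
    · rw [mem_preimage, hs0]; exact ⟨hb0, hreD⟩
    · intro y hy
      have h1 : ContDiffAt ℝ ∞ (fun t => (β t).re) (p.symm y) :=
        hres.contDiffAt (hTo.mem_nhds hy.2.1)
      have h2 := (h1.differentiableAt (by simp)).hasDerivAt
      exact (p.contDiffAt_symm_deriv hy.2.2 hy.1 h2 h1).contDiffWithinAt
    · filter_upwards [p.open_source.mem_nhds ht₀] with t ht
      exact p.left_inv ht
  set G : ℝ → ℝ := fun y => -(β (τ y)).im with hG
  have hGs : ContDiffOn ℝ ∞ G V :=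
    (Complex.imCLM.contDiff.comp_contDiffOn (hβs.comp hτ hτ0)).neg
  have hG0 : G 0 = 0 := by
    have := hτβ.self_of_nhds
    rw [hβ0, Complex.zero_re] at this
    simp [hG, this, hβ0]
  have hO' : IsOpen (Metric.ball (0 : ℂ) (3 / 2) ∩ Γ ⁻¹' O) :=
    hchart.smooth.continuousOn.isOpen_inter_preimage hchart.isOpen hO
  obtain ⟨ψ, hψ, ⟨K, hK, hKO, hK0⟩, hψre, hψG⟩ := exists_shear hO'
    ⟨by simp, by rw [mem_preimage, hΓ0]; exact hbO⟩ hV h0V hGs hG0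
  obtain ⟨D, hD, hDΓ, hDfix⟩ := hchart.transport hψ hK (hKO.trans inter_subset_left) hK0
  refine ⟨D, hD, fun z hz => hDfix z ?_, fun z => ?_, ?_⟩
  · rintro ⟨x, hx, rfl⟩
    exact hz (hKO hx).2
  · by_cases hz : z ∈ Γ '' K
    · obtain ⟨x, hx, rfl⟩ := hz
      rw [hDΓ x (hKO hx).1, hΓn, hΓn, hψre]
    · rw [hDfix z hz]
  · have hβc : Tendsto β (𝓝 t₀) (𝓝 0) := by
      have := (hβs.continuousOn.continuousAt (hTo.mem_nhds hb0)).tendsto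
      rwa [hβ0] at this
    filter_upwards [hτβ, hβc.eventually hψG, hTo.mem_nhds hb0] with t h1 h2 h3
    refine ⟨Real.exp ((β t).re * (1 / 3)), Real.exp_pos _, ?_⟩
    have h4 : β t ∈ Metric.ball (0 : ℂ) (3 / 2) := by
      have := e.map_target h3
      rwa [hes] at this
    have h5 : ψ (β t) = ((β t).re : ℂ) := by
      rw [h2]
      apply Complex.ext
      · simp
      · simp [hG, h1]
    rw [← hΓβ t h3, hDΓ _ h4, h5, hΓr]

/-! ### Moving the origin of a ray -/

namespace IsRayFamily

variable {S : Type*} [TopologicalSpace S] [DiscreteTopology S] {c : S → ℝ → ℂ}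

/-- Moving the origin of a ray along the curve that contains the ray. -/
theorem shift [DecidableEq S] (hc : IsRayFamily c) (j : S) {a : ℝ}
    (himm : ∀ t, a ≤ t → deriv (c j) t ≠ 0) (hinj : InjOn (c j) (Ici a))
    (hdis : ∀ t, a ≤ t → ∀ i, i ≠ j → ∀ u, 0 ≤ u → c i u ≠ c j t) :
    IsRayFamily (Function.update c j (fun t => c j (t + a))) := by
  have hsm : ∀ i, ContDiff ℝ ∞ (Function.update c j (fun t => c j (t + a)) i) := by
    intro i
    rcases eq_or_ne i j with rfl | hij
    · rw [Function.update_self]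
      exact (hc.smooth i).comp (contDiff_id.add contDiff_const)
    · rw [Function.update_of_ne hij]
      exact hc.smooth i
  refine ⟨hsm, fun i t ht => ?_, ?_, ?_⟩
  · rcases eq_or_ne i j with rfl | hij
    · rw [Function.update_self, deriv_comp_add_const]
      exact himm _ (by linarith)
    · rw [Function.update_of_ne hij]
      exact hc.immersive i t ht
  · rintro ⟨i, ⟨s, hs⟩⟩ ⟨k, ⟨t, ht⟩⟩ h
    simp only at h
    rw [mem_Ici] at hs ht
    rcases eq_or_ne i j with rfl | hij <;> rcases eq_or_ne k i with rfl | hki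
    · rw [Function.update_self] at h
      have h1 : s + a = t + a :=
        hinj (show a ≤ s + a by linarith) (show a ≤ t + a by linarith) h
      have h2 : s = t := by linarith
      subst h2
      rfl
    · rw [Function.update_self, Function.update_of_ne hki] at h
      exact absurd h.symm (hdis _ (by linarith) _ hki _ ht)
    · rw [Function.update_of_ne hij] at h
      obtain ⟨-, h2⟩ := hc.eq_of_apply_eq hs ht h
      subst h2
      rfl
    · rcases eq_or_ne k j with rfl | hkj
      · rw [Function.update_self, Function.update_of_ne hij] at h
        exact absurd h (hdis _ (by linarith) _ hij _ hs)
      · rw [Function.update_of_ne hij, Function.update_of_ne hkj] at h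
        exact absurd (hc.eq_of_apply_eq hs ht h).1.symm hki
  · have hcont : Continuous (fun p : S × Ici (0 : ℝ) =>
        Function.update c j (fun t => c j (t + a)) p.1 p.2) := by
      rw [continuous_prod_of_discrete_left]
      intro i
      exact (hsm i).continuous.comp continuous_subtype_val
    rw [isProperMap_iff_isCompact_preimage]
    refine ⟨hcont, fun K hK => ?_⟩
    obtain ⟨A, T, hT, hA⟩ := hc.finite_meeting hK
    have hcomp : IsCompact ((↑(insert j A) : Set S) ×ˢ
        ((fun x : Ici (0 : ℝ) => (x : ℝ)) ⁻¹' Icc 0 (T + |a|))) :=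
      (insert j A).finite_toSet.isCompact.prod
        (isClosed_Ici.isClosedEmbedding_subtypeVal.isCompact_preimage isCompact_Icc)
    refine hcomp.of_isClosed_subset (hK.isClosed.preimage hcont) ?_
    rintro ⟨i, ⟨t, ht⟩⟩ h
    rw [mem_preimage] at h
    simp only at h
    rw [mem_Ici] at ht
    refine ⟨?_, ht, ?_⟩
    · rcases eq_or_ne i j with rfl | hij
      · simp
      · rw [Function.update_of_ne hij] at h
        simp [(hA i t ht h).1]
    · change t ≤ T + |a|
      rcases eq_or_ne i j with rfl | hij
      · rw [Function.update_self] at h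
        by_cases h0 : 0 ≤ t + a
        · linarith [(hA i _ h0 h).2, neg_abs_le a]
        · linarith [neg_abs_le a]
      · rw [Function.update_of_ne hij] at h
        linarith [(hA i t ht h).2, abs_nonneg a]

/-- A ray can be extended a little beyond its origin. -/
theorem exists_extension (hc : IsRayFamily c) (j : S) :
    ∃ δ₀ > 0, (∀ t, -δ₀ ≤ t → t < 0 → c j t ∉ rayUnion c) ∧ InjOn (c j) (Ici (-δ₀)) ∧
      ∀ t, -δ₀ ≤ t → deriv (c j) t ≠ 0 := by
  obtain ⟨Γ, O, hΓ, ⟨δ, hδ, hδO⟩, hΓx, hΓc⟩ := hc.exists_tube j le_rfl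
  have hc1 : Continuous (deriv (c j)) := (hc.smooth j).continuous_deriv (by simp)
  have hev : ∀ᶠ t in 𝓝 (0 : ℝ), deriv (c j) t ≠ 0 :=
    hc1.continuousAt.eventually_ne (hc.immersive j 0 le_rfl)
  obtain ⟨η, hη, hball⟩ := Metric.eventually_nhds_iff.1 hev
  have hO : ∀ t : ℝ, -min δ (η / 2) ≤ t → t < 0 → (t : ℂ) ∈ O := fun t h1 h2 =>
    hδO t ⟨by linarith [min_le_left δ (η / 2)], h2.le⟩
  have hmix : ∀ t : ℝ, -min δ (η / 2) ≤ t → t < 0 → ∀ i u, 0 ≤ u → c j t ≠ c i u := by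
    intro t h1 h2 i u hu h
    rw [← hΓx] at h
    have h3 : t = u := by exact_mod_cast (hΓc _ (hO t h1 h2) i u hu h).2
    linarith
  refine ⟨min δ (η / 2), by positivity, ?_, ?_, fun t ht => ?_⟩
  · rintro t h1 h2 ⟨i, u, hu, h⟩
    exact hmix t h1 h2 i u hu h.symm
  · intro s hs t ht h
    rcases lt_or_ge s 0 with hs0 | hs0 <;> rcases lt_or_ge t 0 with ht0 | ht0
    · rw [← hΓx, ← hΓx] at h
      exact_mod_cast hΓ.injOn (hO s hs hs0) (hO t ht ht0) h
    · exact absurd h (hmix s hs hs0 j t ht0)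
    · exact absurd h.symm (hmix t ht ht0 j s hs0)
    · exact (hc.eq_of_apply_eq hs0 ht0 h).2
  · rcases lt_or_ge t 0 with ht0 | ht0
    · apply hball
      rw [Real.dist_eq, sub_zero, abs_of_neg ht0]
      linarith [min_le_right δ (η / 2)]
    · exact hc.immersive j t ht0

theorem isEndless (hc : IsRayFamily c) {R : ℝ} (hg : IsGoodFamily c R) :
    IsEndless (rayUnion c) R := by
  rintro _ ⟨i, t₀, ht₀, rfl⟩ hR
  refine ⟨c i '' Ici t₀, ?_, isPreconnected_Ici.image _ (hc.smooth i).continuous.continuousOn,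
    ⟨t₀, self_mem_Ici, rfl⟩, fun B => ?_⟩
  · rintro _ ⟨t, ht, rfl⟩
    rw [mem_Ici] at ht
    refine ⟨⟨i, t, ht₀.trans ht, rfl⟩, ?_⟩
    rcases hg i with h | ⟨s, -, h, -⟩
    · exact (h t (ht₀.trans ht)).le
    · have h1 := (h t₀ ht₀).not.1 hR.not_gt
      exact not_lt.1 ((h t (ht₀.trans ht)).not.2 (not_lt.2 ((not_lt.1 h1).trans ht)))
  · obtain ⟨T, -, hT⟩ := hc.exists_gt_norm i B
    exact ⟨_, ⟨max t₀ T, mem_Ici.2 (le_max_left t₀ T), rfl⟩, hT _ (le_max_right _ _)⟩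

end IsRayFamily

/-! ### Transversal crossing of a circle -/

/-- A curve leading from the open disc of radius `R` to its exterior is perturbed so that it crosses
the circle transversally when it leaves the disc for the last time.

The perturbation is a homothety near the crossings, and its ratio is chosen by means of the
one-dimensional Sard theorem. -/
theorem exists_regular_crossing {b : ℝ → ℂ} (hb : ContDiff ℝ ∞ b) {δ R r : ℝ} (hδ : 0 < δ)
    (hR : 0 < R) (hr : r < R) (h0 : ‖b 0‖ < R) (h1 : ∀ t, δ ≤ t → R < ‖b t‖) {Y : Set ℂ}
    (hY : IsClosed Y) (hbY : ∀ t ∈ Icc 0 δ, ‖b t‖ = R → b t ∉ Y) :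
    ∃ (D : Equiv.Perm ℂ) (t₂ : ℝ), IsDiffeo D ∧ (∀ z ∈ Y, D z = z) ∧ (∀ z, ‖z‖ ≤ r → D z = z) ∧
      0 < t₂ ∧ t₂ < δ ∧ ‖D (b t₂)‖ = R ∧ (∀ t, t₂ < t → R < ‖D (b t)‖) ∧
      0 < deriv (fun t => ‖D (b t)‖ ^ 2) t₂ := by
  have hbc := hb.continuous
  set A : Set ℂ := b '' (Icc 0 δ ∩ {t | ‖b t‖ = R}) with hA
  have hAc : IsCompact A :=
    (isCompact_Icc.inter_right (isClosed_eq hbc.norm continuous_const)).image hbc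
  obtain ⟨β, hβ, h01, ⟨U, hU, hAU, hUβ⟩, K, hK, hKO, hK0⟩ := exists_cutoff hAc
    (hY.union (Metric.isClosed_closedBall (x := (0 : ℂ)) (ε := r))).isOpen_compl (by
      rintro _ ⟨t, ⟨ht, htR⟩, rfl⟩ (h | h)
      · exact hbY t ht htR h
      · rw [Metric.mem_closedBall, dist_zero_right] at h
        have : ‖b t‖ = R := htR
        linarith)
  have hgs : ContDiff ℝ ∞ (fun z : ℂ => (β z : ℂ) * z) :=
    (Complex.ofRealCLM.contDiff.comp hβ).mul contDiff_id
  obtain ⟨ε, hε, hsmall⟩ := exists_diffeo_small_mul hgs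
    (HasCompactSupport.intro hK (fun z hz => by simp [hK0 z hz]))
  obtain ⟨B, hB, hbB⟩ : ∃ B > 0, ∀ t ∈ Icc 0 δ, ‖b t‖ ≤ B := by
    obtain ⟨B, hB⟩ := (isCompact_Icc (a := (0 : ℝ)) (b := δ)).exists_bound_of_continuousOn
      hbc.continuousOn
    exact ⟨max B 1, by positivity, fun t ht => (hB t ht).trans (le_max_left _ _)⟩
  obtain ⟨η, hη, hbη⟩ : ∃ η > 0, ∀ t ∈ Icc 0 δ, b t ∉ U → η ≤ |‖b t‖ - R| := by
    have hc : IsCompact (Icc 0 δ ∩ b ⁻¹' Uᶜ) :=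
      isCompact_Icc.inter_right (hU.isClosed_compl.preimage hbc)
    rcases (Icc 0 δ ∩ b ⁻¹' Uᶜ).eq_empty_or_nonempty with he | hne
    · refine ⟨1, one_pos, fun t ht htU => ?_⟩
      have : t ∈ Icc 0 δ ∩ b ⁻¹' Uᶜ := ⟨ht, htU⟩
      rw [he] at this
      exact absurd this (notMem_empty t)
    · obtain ⟨t₀, ht₀, hmin⟩ := hc.exists_isMinOn hne
        (f := fun t => |‖b t‖ - R|) (by fun_prop)
      refine ⟨|‖b t₀‖ - R|, abs_pos.2 (fun h => ?_), fun t ht htU => hmin ⟨ht, htU⟩⟩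
      exact ht₀.2 (hAU ⟨t₀, ⟨ht₀.1, sub_eq_zero.1 h⟩, rfl⟩)
  set w₁ : ℝ := min ε (min (η / B) ((R - ‖b 0‖) / B)) with hw₁
  have hw₁0 : 0 < w₁ := lt_min hε (lt_min (by positivity) (div_pos (by linarith) hB))
  -- a regular value of the squared norm slightly below the square of the radius
  set f : ℝ → ℝ := fun t => ‖b t‖ ^ 2 with hf
  have hfs : ContDiff ℝ ∞ f := hb.norm_sq ℝ
  have hnull : MeasureTheory.volume (f '' {t | deriv f t = 0}) = 0 := by
    refine MeasureTheory.addHaar_image_eq_zero_of_det_fderivWithin_eq_zero MeasureTheory.volume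
      (f' := fun t => fderiv ℝ f t)
      (fun t _ => ((hfs.differentiable (by simp)) t).hasFDerivAt.hasFDerivWithinAt) (fun t ht => ?_)
    have h2 : fderiv ℝ f t = 0 := by
      ext
      rw [fderiv_apply_one_eq_deriv]
      simpa using ht
    rw [h2]
    simp [ContinuousLinearMap.det]
  obtain ⟨v, hv, hvreg⟩ : ∃ v ∈ Ioo ((R / (1 + w₁)) ^ 2) (R ^ 2), v ∉ f '' {t | deriv f t = 0} := by
    by_contra hcon
    push Not at hcon
    have h2 := MeasureTheory.measure_mono (μ := MeasureTheory.volume) (show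
      Ioo ((R / (1 + w₁)) ^ 2) (R ^ 2) ⊆ f '' {t | deriv f t = 0} from hcon)
    rw [hnull, Real.volume_Ioo, nonpos_iff_eq_zero, ENNReal.ofReal_eq_zero, sub_nonpos] at h2
    have h3 : R / (1 + w₁) < R := div_lt_self hR (by linarith)
    have h4 : 0 < R / (1 + w₁) := by positivity
    nlinarith
  have hv0 : 0 < v := (by positivity : 0 < (R / (1 + w₁)) ^ 2).trans hv.1
  set u : ℝ := Real.sqrt v with hu
  have hu0 : 0 < u := Real.sqrt_pos.2 hv0
  have huv : u ^ 2 = v := Real.sq_sqrt hv0.le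
  have huR : u < R := by
    rw [← huv] at hv
    exact lt_of_pow_lt_pow_left₀ 2 hR.le hv.2
  have huw : R / (1 + w₁) < u := by
    rw [← huv] at hv
    exact lt_of_pow_lt_pow_left₀ 2 hu0.le hv.1
  set w : ℝ := R / u - 1 with hw
  have hw0 : 0 < w := by
    have : 1 < R / u := (one_lt_div hu0).2 huR
    linarith
  have hww₁ : w < w₁ := by
    rw [div_lt_iff₀ (by linarith)] at huw
    have : R / u < 1 + w₁ := by rw [div_lt_iff₀ hu0]; linarith
    linarith
  have hwu : (1 + w) * u = R := by rw [hw]; field_simp; ring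
  have hwη : w * B < η := by
    have := hww₁.trans_le ((min_le_right _ _).trans (min_le_left _ _))
    rwa [lt_div_iff₀ hB] at this
  have hwb : w * B < R - ‖b 0‖ := by
    have := hww₁.trans_le ((min_le_right _ _).trans (min_le_right _ _))
    rwa [lt_div_iff₀ hB] at this
  obtain ⟨D, hD, hDz, -⟩ := hsmall (w : ℂ) (by
    rw [Complex.norm_real, Real.norm_eq_abs, abs_of_pos hw0]
    exact hww₁.trans_le (min_le_left _ _))
  have hDn : ∀ z, ‖D z‖ = (1 + w * β z) * ‖z‖ := fun z => by
    have h2 : D z = ((1 + w * β z : ℝ) : ℂ) * z := by rw [hDz]; push_cast; ring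
    rw [h2, norm_mul, Complex.norm_real, Real.norm_eq_abs, abs_of_nonneg]
    nlinarith [(h01 z).1]
  have hDge : ∀ z, ‖z‖ ≤ ‖D z‖ := fun z => by
    rw [hDn]
    nlinarith [norm_nonneg z, mul_nonneg (mul_nonneg hw0.le (h01 z).1) (norm_nonneg z)]
  have hDle : ∀ t ∈ Icc 0 δ, ‖D (b t)‖ ≤ ‖b t‖ + w * B := fun t ht => by
    rw [hDn, add_mul, one_mul, mul_assoc]
    have h2 : β (b t) * ‖b t‖ ≤ B :=
      (mul_le_of_le_one_left (norm_nonneg _) (h01 _).2).trans (hbB t ht)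
    nlinarith
  have hDfix : ∀ z, z ∈ Y ∪ Metric.closedBall 0 r → D z = z := fun z hz => by
    rw [hDz, hK0 z (fun h => hKO h hz)]; simp
  have hDbc : Continuous (fun t => ‖D (b t)‖) := (hD.continuous.comp hbc).norm
  have hDb0 : ‖D (b 0)‖ < R := by
    have := hDle 0 ⟨le_rfl, hδ.le⟩
    linarith
  obtain ⟨t₂, ⟨ht₂, ht₂R⟩, hmax⟩ := (isCompact_Icc.inter_right (isClosed_le hDbc continuous_const) :
    IsCompact (Icc 0 δ ∩ {t | ‖D (b t)‖ ≤ R})).exists_isGreatest ⟨0, ⟨le_rfl, hδ.le⟩, hDb0.le⟩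
  have ht₂R' : ‖D (b t₂)‖ ≤ R := ht₂R
  have hafter : ∀ t, t₂ < t → R < ‖D (b t)‖ := by
    intro t ht
    by_contra h
    rcases le_total t δ with htδ | htδ
    · exact absurd (hmax ⟨⟨ht₂.1.trans ht.le, htδ⟩, not_lt.1 h⟩) ht.not_ge
    · exact h ((h1 t htδ).trans_le (hDge _))
  have ht₂δ : t₂ < δ := by
    refine lt_of_le_of_ne ht₂.2 (fun h => ?_)
    have := (h1 t₂ h.ge).trans_le (hDge _)
    linarith
  have hright : (𝓝[>] t₂).NeBot := inferInstance
  have ht₂eq : ‖D (b t₂)‖ = R := by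
    refine le_antisymm ht₂R' (ge_of_tendsto (hDbc.continuousAt.tendsto.mono_left
      (nhdsWithin_le_nhds (s := Ioi t₂))) ?_)
    filter_upwards [self_mem_nhdsWithin] with t ht
    exact (hafter t ht).le
  have ht₂0 : 0 < t₂ := by
    refine lt_of_le_of_ne ht₂.1 (fun h => ?_)
    rw [← h] at ht₂eq
    exact hDb0.ne ht₂eq
  have hbU : b t₂ ∈ U := by
    by_contra h
    have h2 := hbη t₂ ht₂ h
    have h3 := hDge (b t₂)
    have h4 := hDle t₂ ht₂
    rw [ht₂eq] at h3 h4
    rw [abs_of_nonpos (by linarith)] at h2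
    linarith
  have hloc : (fun t => ‖D (b t)‖ ^ 2) =ᶠ[𝓝 t₂] fun t => (1 + w) ^ 2 * f t := by
    filter_upwards [(hU.preimage hbc).mem_nhds hbU] with t ht
    rw [hDn, hUβ _ ht, mul_one, mul_pow]
  have hft₂ : f t₂ = v := by
    have h2 := hloc.self_of_nhds
    simp only [ht₂eq] at h2
    rw [← hwu, mul_pow, huv] at h2
    exact (mul_left_cancel₀ (by positivity) h2).symm
  have hfd : deriv f t₂ ≠ 0 := fun h => hvreg ⟨t₂, h, hft₂⟩
  have hder : HasDerivAt (fun t => ‖D (b t)‖ ^ 2) ((1 + w) ^ 2 * deriv f t₂) t₂ :=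
    (((hfs.differentiable (by simp)) t₂).hasDerivAt.const_mul _).congr_of_eventuallyEq hloc
  have hpos : 0 ≤ (1 + w) ^ 2 * deriv f t₂ := by
    have h2 := (hasDerivWithinAt_iff_tendsto_slope' (notMem_Ioi.2 le_rfl)).1
      (hder.hasDerivWithinAt (s := Ioi t₂))
    refine ge_of_tendsto h2 ?_
    filter_upwards [self_mem_nhdsWithin] with t ht
    rw [slope_def_field]
    refine div_nonneg ?_ (sub_nonneg.2 (le_of_lt ht))
    have h3 := hafter t ht
    rw [ht₂eq]
    nlinarith
  refine ⟨D, t₂, hD, fun z hz => hDfix z (Or.inl hz),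
    fun z hz => hDfix z (Or.inr (by simpa using hz)),
    ht₂0, ht₂δ, ht₂eq, hafter, ?_⟩
  rw [hder.deriv]
  exact lt_of_le_of_ne hpos (mul_ne_zero (by positivity) hfd).symm

/-! ### Attaching a free ray, and engulfing a continuum -/

namespace IsRayFamily

variable {S : Type*} [TopologicalSpace S] [DiscreteTopology S] {c : S → ℝ → ℂ}

/-- A free ray is prolonged slightly beyond its initial point, and the new piece is pulled into the
disc of radius `R` without moving the rays. The prolonged ray, parametrized by `[0, ∞)` with `δ`
the parameter of the original initial point, leaves the disc for the last time at `t₂`, along a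
radius. -/
theorem exists_radial_crossing (hc : IsRayFamily c) {R r : ℝ} (hg : IsGoodFamily c R)
    (hR : 0 < R) (hr0 : 0 ≤ r) (hr : r < R) {j : S} (hj : IsFreeRay (c j) R) :
    ∃ (M : Equiv.Perm ℂ) (δ t₂ : ℝ), IsDiffeo M ∧ (∀ z ∈ rayUnion c, M z = z) ∧
      (∀ z, ‖z‖ ≤ r → M z = z) ∧
      (∀ t, -δ ≤ t → t < 0 → c j t ∉ rayUnion c) ∧ InjOn (c j) (Ici (-δ)) ∧
      (∀ t, -δ ≤ t → deriv (c j) t ≠ 0) ∧ 0 < t₂ ∧ t₂ < δ ∧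
      ‖M (c j (t₂ - δ))‖ = R ∧ (∀ t, t₂ < t → R < ‖M (c j (t - δ))‖) ∧
      ∃ a > 0, ∀ t, t₂ - a < t → t ≤ t₂ → (t < t₂ → ‖M (c j (t - δ))‖ < R) ∧
        ∃ q : ℝ, 0 < q ∧ M (c j (t - δ)) = q • M (c j (t₂ - δ)) := by
  obtain ⟨δ, hδ, hext, hinj, hder⟩ := hc.exists_extension j
  set p := c j (-δ) with hp
  have hpL : p ∉ rayUnion c := hext _ le_rfl (by linarith)
  -- a path from the origin to the new initial point, disjoint from the rays outside the disc
  obtain ⟨D₁, hD₁, hD₁F, -, -, hD₁K⟩ := hc.exists_avoid hg (K := segment ℝ 0 p)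
    (F := Metric.closedBall 0 r ∪ {p}) (by
      rw [segment_eq_image_lineMap]
      exact isCompact_Icc.image AffineMap.lineMap_continuous)
    (Metric.isClosed_closedBall.union isClosed_singleton) (by
      rintro z ⟨h1, h2⟩ (h | h)
      · rw [mem_closedBall_zero_iff] at h
        linarith
      · exact hpL (h ▸ h2))
  obtain ⟨Φ, hΦ, hΦL, hΦr, hΦK⟩ := exists_collapse hR hr (Z := rayUnion c)
    (K := D₁ '' segment ℝ 0 p) hc.isClosed_rayUnion (hc.isEndless hg) (by
      rw [segment_eq_image_lineMap]
      exact (isCompact_Icc.image AffineMap.lineMap_continuous).image hD₁.continuous)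
    ((convex_segment 0 p).isPreconnected.image _ hD₁.continuous.continuousOn)
    ⟨0, left_mem_segment ℝ 0 p, hD₁F 0 (.inl (by simpa using hr0))⟩ (by
      rintro _ ⟨z, hz, rfl⟩ h1 h2
      exact hD₁K z hz ⟨h1, h2⟩)
  have hb₀ : ContDiff ℝ ∞ (fun t => Φ (c j (t - δ))) :=
    hΦ.1.comp ((hc.smooth j).comp (contDiff_id.sub contDiff_const))
  have hmem : ∀ t, δ ≤ t → c j (t - δ) ∈ rayUnion c := fun t ht => ⟨j, t - δ, by linarith, rfl⟩
  obtain ⟨Dw, t₂, hDw, hDwY, hDwr, ht₂, ht₂δ, hnorm, hout, hderiv⟩ :=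
    exists_regular_crossing hb₀ hδ hR hr (by
      simp only [zero_sub]
      exact hΦK p ⟨p, right_mem_segment ℝ 0 p, hD₁F p (.inr rfl)⟩) (fun t ht => by
      rw [hΦL _ (hmem t ht)]
      exact hj _ (by linarith)) hc.isClosed_rayUnion (by
      intro t ht hn hL
      rw [Φ.injective (hΦL _ hL)] at hL
      have h1 : δ ≤ t := by
        by_contra! h
        exact hext _ (by linarith [ht.1]) (by linarith) hL
      rw [hΦL _ hL] at hn
      exact (hj (t - δ) (by linarith)).ne' hn)
  have hfix : ∀ z ∈ rayUnion c, Dw (Φ z) = z := fun z hz => by rw [hΦL z hz, hDwY z hz]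
  have hb : ContDiff ℝ ∞ (fun t => Dw (Φ (c j (t - δ)))) := hDw.1.comp hb₀
  obtain ⟨D, hD, hDO, hDn, hDev⟩ := exists_make_radial (b := fun t => Dw (Φ (c j (t - δ))))
    (O := (rayUnion c ∪ Metric.closedBall 0 r)ᶜ) (t₀ := t₂)
    (hc.isClosed_rayUnion.union Metric.isClosed_closedBall).isOpen_compl hb (by
      rintro (h | h)
      · have h1 := hfix _ h
        rw [Φ.injective (Dw.injective h1)] at h
        exact hext _ (by linarith) (by linarith) h
      · rw [mem_closedBall_zero_iff] at h
        linarith) (by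
      intro h
      rw [h, norm_zero] at hnorm
      exact hR.ne hnorm) hderiv.ne'
  have hself : D (Dw (Φ (c j (t₂ - δ)))) = Dw (Φ (c j (t₂ - δ))) := by
    obtain ⟨q, hq, hq'⟩ := hDev.self_of_nhds
    have h1 := hDn (Dw (Φ (c j (t₂ - δ))))
    rw [hq', norm_smul, hnorm, Real.norm_of_nonneg hq.le] at h1
    have h2 : q = 1 := by
      field_simp at h1
      exact h1
    rw [hq', h2, one_smul]
  have hsign := eventually_nhdsWithin_sign_eq_of_deriv_pos
    (f := fun t => ‖Dw (Φ (c j (t - δ)))‖ ^ 2 - R ^ 2) (x₀ := t₂)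
    (by rw [deriv_sub_const]; exact hderiv) (by simp [hnorm])
  obtain ⟨a, ha, hball⟩ := Metric.eventually_nhds_iff.1 (hsign.and hDev)
  refine ⟨D * (Dw * Φ), δ, t₂, hD.mul (hDw.mul hΦ), fun z hz => ?_, fun z hz => ?_, hext, hinj,
    hder, ht₂, ht₂δ, ?_, fun t ht => ?_, a, ha, fun t h1 h2 => ⟨fun h3 => ?_, ?_⟩⟩
  · simp only [Equiv.Perm.mul_apply]
    rw [hfix z hz]
    exact hDO z fun h => h (.inl hz)
  · simp only [Equiv.Perm.mul_apply]
    rw [hΦr z hz, hDwr z hz]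
    exact hDO z fun h => h (.inr (by simpa using hz))
  · simp only [Equiv.Perm.mul_apply]
    rw [hDn, hnorm]
  · simp only [Equiv.Perm.mul_apply]
    rw [hDn]
    exact hout t ht
  · have h4 := (hball (y := t) (by
      rw [Real.dist_eq, abs_of_neg (by linarith)]
      linarith)).1
    rw [sign_neg (show t - t₂ < 0 by linarith), sign_eq_neg_one_iff] at h4
    simp only [Equiv.Perm.mul_apply]
    rw [hDn]
    exact lt_of_pow_lt_pow_left₀ 2 hR.le (by linarith)
  · obtain ⟨q, hq, hq'⟩ := (hball (y := t) (by
      rw [Real.dist_eq, abs_of_nonpos (by linarith)]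
      linarith)).2
    refine ⟨q, hq, ?_⟩
    simp only [Equiv.Perm.mul_apply]
    rw [hself, hq']

/-- A free ray can be made attached by a diffeomorphism that fixes the other rays. -/
theorem exists_attach (hc : IsRayFamily c) {R r : ℝ} (hg : IsGoodFamily c R)
    (hR : 0 < R) (hr0 : 0 ≤ r) (hr : r < R) {j : S} (hj : IsFreeRay (c j) R) :
    ∃ D : Equiv.Perm ℂ, IsDiffeo D ∧ (∀ z, ‖z‖ ≤ r → D z = z) ∧
      (∀ i, i ≠ j → ∀ t, 0 ≤ t → D (c i t) = c i t) ∧ IsAttachedRay (fun t => D (c j t)) R := by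
  classical
  obtain ⟨M, δ, t₂, hM, hML, hMr, hext, hinj, hder, ht₂, ht₂δ, hnorm, hout, a, ha, hrad⟩ :=
    hc.exists_radial_crossing hg hR hr0 hr hj
  have hce := hc.shift j hder hinj (fun t ht i hij u hu h => by
    rcases lt_or_ge t 0 with h0 | h0
    · exact hext t ht h0 ⟨i, u, hu, h⟩
    · exact hij (hc.eq_of_apply_eq hu h0 h).1)
  have hc' := hce.comp hM
  -- the prolonged ray, now shortened so that it starts on the radius
  obtain ⟨t₃, h3a, h30, h32⟩ : ∃ t₃, t₂ - a < t₃ ∧ 0 < t₃ ∧ t₃ < t₂ :=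
    ⟨max (t₂ - a / 2) (t₂ / 2), lt_max_of_lt_left (by linarith), lt_max_of_lt_right (by linarith),
      max_lt (by linarith) (by linarith)⟩
  have hf := hc'.shift j (a := t₃) (fun t ht => hc'.immersive j t (h30.le.trans ht))
    (fun x hx y hy h => (hc'.eq_of_apply_eq (h30.le.trans hx) (h30.le.trans hy) h).2)
    (fun t ht i hij u hu h => hij (hc'.eq_of_apply_eq hu (h30.le.trans ht) h).1)
  set f := Function.update (fun i t => M (Function.update c j (fun t => c j (t + -δ)) i t)) j
    (fun t => M (Function.update c j (fun t => c j (t + -δ)) j (t + t₃))) with hfdef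
  have hfj : ∀ t, f j t = M (c j (t + t₃ - δ)) := fun t => by
    simp [hfdef, sub_eq_add_neg]
  have hfi : ∀ i, i ≠ j → ∀ t, 0 ≤ t → f i t = c i t := fun i hij t ht => by
    simp only [hfdef, Function.update_of_ne hij]
    exact hML _ ⟨i, t, ht, rfl⟩
  obtain ⟨E, m, hE, hEW, hEj, hmT, hm0, hEi⟩ := hf.exists_slide j (s := t₂ - t₃) (T := δ - t₃)
    (by linarith) (by linarith) (W := {z | r < ‖z‖}) (isOpen_lt continuous_const continuous_norm)
    (fun t ht => by
      rw [mem_ofPred_eq, hfj]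
      rcases (show t₂ ≤ t + t₃ by linarith [ht.1]).eq_or_lt with h | h
      · rw [← h, hnorm]
        exact hr
      · exact hr.trans (hout _ h))
  replace hm0 := hm0 (by linarith)
  have hEM : ∀ t, 0 ≤ t → E (M (c j t)) = f j (m (t + (δ - t₃))) := fun t ht => by
    rw [← hEj _ (by linarith), hfj]
    congr 3
    ring
  have hmnn : ∀ t, 0 ≤ t → 0 ≤ m (t + (δ - t₃)) := fun t ht => by
    rw [← hm0]
    exact m.monotone (by linarith)
  have hs : ∀ t, m (t + (δ - t₃)) < t₂ - t₃ ↔ t < m.symm (t₂ - t₃) - (δ - t₃) := fun t => by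
    rw [← m.lt_symm_apply, lt_sub_iff_add_lt]
  have hs' : 0 < m.symm (t₂ - t₃) - (δ - t₃) := by
    rw [← hs, zero_add]
    exact hmT
  refine ⟨E * M, hE.mul hM, fun z hz => ?_, fun i hij t ht => ?_,
    m.symm (t₂ - t₃) - (δ - t₃), hs', fun t ht => ?_, ?_⟩
  · simp only [Equiv.Perm.mul_apply]
    rw [hMr z hz]
    exact hEW z (by simpa using hz)
  · simp only [Equiv.Perm.mul_apply]
    rw [hML _ ⟨i, t, ht, rfl⟩]
    have := hEi i hij t ht
    rwa [hfi i hij t ht] at this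
  · simp only [Equiv.Perm.mul_apply]
    rw [hEM t ht, ← hs, hfj]
    have h0 := hmnn t ht
    rcases lt_trichotomy (m (t + (δ - t₃)) + t₃) t₂ with h | h | h
    · simp only [(hrad _ (by linarith) h.le).1 h, true_iff]
      linarith
    · rw [h, hnorm]
      simp only [lt_self_iff_false, false_iff]
      linarith
    · simp only [(hout _ h).not_gt, false_iff]
      linarith
  · have key : ∀ t ∈ Icc 0 (m.symm (t₂ - t₃) - (δ - t₃)), ∃ q : ℝ, 0 < q ∧
        E (M (c j t)) = q • M (c j (t₂ - δ)) := by
      intro t ht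
      rw [hEM t ht.1, hfj]
      have h0 := hmnn t ht.1
      have h1 : m (t + (δ - t₃)) ≤ t₂ - t₃ := by
        rw [← m.le_symm_apply]
        linarith [ht.2]
      exact (hrad _ (by linarith) (by linarith)).2
    obtain ⟨q₀, hq₀, h0⟩ := key 0 (left_mem_Icc.2 hs'.le)
    intro t ht
    obtain ⟨q, -, h⟩ := key t ht
    refine ⟨q / q₀, ?_⟩
    simp only [Equiv.Perm.mul_apply]
    rw [h, h0, smul_smul, div_mul_cancel₀ _ hq₀.ne']

/-- A continuum that contains the origin and misses the free rays can be moved into the disc of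
radius `R`, keeping the free rays fixed and the attached rays attached. -/
theorem exists_engulf (hc : IsRayFamily c) {R r : ℝ} (hg : IsGoodFamily c R)
    (hR : 0 < R) (hr0 : 0 ≤ r) (hr : r < R) {K : Set ℂ} (hK : IsCompact K) (hKc : IsPreconnected K)
    (h0 : 0 ∈ K) (hfree : ∀ i, IsFreeRay (c i) R → ∀ t, 0 ≤ t → c i t ∉ K) :
    ∃ D : Equiv.Perm ℂ, IsDiffeo D ∧ (∀ z, ‖z‖ ≤ r → D z = z) ∧
      (∀ i, IsFreeRay (c i) R → ∀ t, 0 ≤ t → D (c i t) = c i t) ∧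
      (∀ i, IsAttachedRay (c i) R → IsAttachedRay (fun t => D (c i t)) R) ∧
      ∀ z ∈ K, ‖D z‖ < R := by
  obtain ⟨D₁, hD₁, hD₁F, hD₁f, hD₁a, hD₁K⟩ := hc.exists_avoid hg hK
    (F := Metric.closedBall 0 r) Metric.isClosed_closedBall (by
      rintro z ⟨h1, -⟩ h
      rw [mem_closedBall_zero_iff] at h
      linarith)
  have hD₁r : ∀ z, ‖z‖ ≤ r → D₁ z = z := fun z hz => hD₁F z (by simpa using hz)
  obtain ⟨Φ, hΦ, hΦL, hΦr, hΦK⟩ := exists_collapse hR hr (Z := rayUnion c) (K := D₁ '' K)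
    hc.isClosed_rayUnion (hc.isEndless hg) (hK.image hD₁.continuous)
    (hKc.image _ hD₁.continuous.continuousOn) ⟨0, h0, hD₁r 0 (by simpa using hr0)⟩ (by
      rintro _ ⟨z, hz, rfl⟩ h1 h2
      exact hD₁K z hz ⟨h1, h2⟩)
  refine ⟨Φ * D₁, hΦ.mul hD₁, fun z hz => ?_, fun i hi t ht => ?_, fun i hi => ?_,
    fun z hz => hΦK _ ⟨z, hz, rfl⟩⟩
  · rw [Equiv.Perm.mul_apply, hD₁r z hz, hΦr z hz]
  · rw [Equiv.Perm.mul_apply, hD₁f i (hfree i hi) t ht, hΦL _ ⟨i, t, ht, rfl⟩]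
  · obtain ⟨m, hm, hm'⟩ := hD₁a i hi
    refine hi.slide hm fun t ht => ?_
    rw [Equiv.Perm.mul_apply, hm' t ht]
    exact hΦL _ ⟨i, m t, by rw [← hm]; exact m.monotone ht, rfl⟩

end IsRayFamily

/-! ### The exhaustion -/

/-- A sequence of diffeomorphisms which, together with their inverses, stabilize on discs converges
to a diffeomorphism. -/
theorem exists_limit {G : ℕ → Equiv.Perm ℂ} (hG : ∀ n, IsDiffeo (G n))
    (h1 : ∀ (n : ℕ) z, ‖z‖ ≤ n → G (n + 1) z = G n z)
    (h2 : ∀ (n : ℕ) z, ‖z‖ ≤ n → (G (n + 1))⁻¹ z = (G n)⁻¹ z) :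
    ∃ G' : Equiv.Perm ℂ, IsDiffeo G' ∧ ∀ (n : ℕ) z, ‖z‖ ≤ n → G' z = G n z := by
  have stab : ∀ H : ℕ → Equiv.Perm ℂ, (∀ (n : ℕ) z, ‖z‖ ≤ n → H (n + 1) z = H n z) →
      ∀ (n : ℕ) z, ‖z‖ ≤ n → H ⌈‖z‖⌉₊ z = H n z := by
    intro H h n z hz
    have h3 : ⌈‖z‖⌉₊ ≤ n := Nat.ceil_le.2 hz
    induction n, h3 using Nat.le_induction with
    | base => rfl
    | succ m hm ih =>
      have h4 : ‖z‖ ≤ m := Nat.ceil_le.1 hm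
      rw [h m z h4, ih h4]
  have smooth : ∀ H : ℕ → Equiv.Perm ℂ, (∀ n, IsDiffeo (H n)) →
      (∀ (n : ℕ) z, ‖z‖ ≤ n → H (n + 1) z = H n z) → ContDiff ℝ ∞ (fun z => H ⌈‖z‖⌉₊ z) := by
    intro H hH h
    rw [contDiff_iff_contDiffAt]
    intro z
    obtain ⟨n, hn⟩ := exists_nat_gt ‖z‖
    refine (hH n).1.contDiffAt.congr_of_eventuallyEq ?_
    filter_upwards [(isOpen_lt continuous_norm continuous_const).mem_nhds hn] with w hw
    exact stab H h n w (le_of_lt hw)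
  have key : ∀ H : ℕ → Equiv.Perm ℂ, (∀ (n : ℕ) z, ‖z‖ ≤ n → H (n + 1) z = H n z) →
      (∀ (n : ℕ) z, ‖z‖ ≤ n → (H (n + 1))⁻¹ z = (H n)⁻¹ z) →
      Function.LeftInverse (fun z => (H ⌈‖z‖⌉₊)⁻¹ z) (fun z => H ⌈‖z‖⌉₊ z) := by
    intro H h h' z
    obtain ⟨n, hn⟩ := exists_nat_gt (max ‖z‖ ‖H ⌈‖z‖⌉₊ z‖)
    have e1 := stab (fun n => (H n)⁻¹) h' n _ ((le_max_right _ _).trans hn.le)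
    have e2 := stab H h n z ((le_max_left _ _).trans hn.le)
    simp only at e1 ⊢
    rw [e1, e2]
    exact (H n).symm_apply_apply z
  refine ⟨⟨fun z => G ⌈‖z‖⌉₊ z, fun z => (G ⌈‖z‖⌉₊)⁻¹ z, key G h1 h2, ?_⟩,
    ⟨smooth G hG h1, smooth (fun n => (G n)⁻¹) (fun n => (hG n).inv) h2⟩, stab G h1⟩
  have := key (fun n => (G n)⁻¹) h2 (by simpa using h1)
  simp only [inv_inv] at this
  exact this

theorem IsFreeRay.congr {γ γ' : ℝ → ℂ} {R : ℝ} (h : IsFreeRay γ R)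
    (hγ : ∀ t, 0 ≤ t → γ' t = γ t) : IsFreeRay γ' R := fun t ht => by
  rw [hγ t ht]
  exact h t ht

theorem IsAttachedRay.congr {γ γ' : ℝ → ℂ} {R : ℝ} (h : IsAttachedRay γ R)
    (hγ : ∀ t, 0 ≤ t → γ' t = γ t) : IsAttachedRay γ' R :=
  h.slide (m := OrderIso.refl ℝ) rfl hγ

theorem IsAttachedRay.not_isFreeRay {γ : ℝ → ℂ} {R : ℝ} (h : IsAttachedRay γ R) :
    ¬ IsFreeRay γ R := fun hf => by
  obtain ⟨s, hs, h1, -⟩ := h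
  exact (hf 0 le_rfl).not_gt ((h1 0 le_rfl).2 hs)

/-- Diffeomorphisms that preserve the radial lines and map the disc of radius `R` onto the disc of
radius `R'` keep attached rays attached. -/
theorem IsAttachedRay.stretch {γ : ℝ → ℂ} {R R' : ℝ} (h : IsAttachedRay γ R) {D : ℂ → ℂ}
    (h1 : ∀ z, ∃ a : ℝ, D z = a • z) (h2 : ∀ z, ∃ a : ℝ, z = a • D z)
    (h3 : ∀ z, ‖D z‖ < R' ↔ ‖z‖ < R) : IsAttachedRay (fun t => D (γ t)) R' := by
  obtain ⟨s, hs, hsR, hrad⟩ := h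
  refine ⟨s, hs, fun t ht => (h3 _).trans (hsR t ht), fun t ht => ?_⟩
  obtain ⟨a, ha⟩ := h1 (γ t)
  obtain ⟨b, hb⟩ := h2 (γ 0)
  obtain ⟨q, hq⟩ := hrad t ht
  refine ⟨a * q * b, ?_⟩
  simp only
  rw [ha, hq, mul_smul, mul_smul, ← hb]

namespace IsRayFamily

variable {S : Type*} [TopologicalSpace S] [DiscreteTopology S] {c : S → ℝ → ℂ}

theorem exists_attach_finset (hc : IsRayFamily c) {R r : ℝ} (hg : IsGoodFamily c R)
    (hR : 0 < R) (hr0 : 0 ≤ r) (hr : r < R) (F : Finset S) :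
    ∃ D : Equiv.Perm ℂ, IsDiffeo D ∧ (∀ z, ‖z‖ ≤ r → D z = z) ∧
      IsGoodFamily (fun i t => D (c i t)) R ∧
      (∀ i, IsAttachedRay (c i) R → IsAttachedRay (fun t => D (c i t)) R) ∧
      ∀ i ∈ F, IsAttachedRay (fun t => D (c i t)) R := by
  classical
  induction F using Finset.induction_on with
  | empty => exact ⟨1, .one, fun _ _ => rfl, hg, fun _ h => h, by simp⟩
  | insert j F hj ih =>
    obtain ⟨A, hA, hAr, hAg, hAa, hAF⟩ := ih
    rcases hAg j with hjf | hja
    · obtain ⟨D, hD, hDr, hDi, hDj⟩ := (hc.comp hA).exists_attach hAg hR hr0 hr hjf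
      have hkeep : ∀ i, IsAttachedRay (fun t => A (c i t)) R →
          IsAttachedRay (fun t => (D * A) (c i t)) R := fun i hi => by
        by_cases hij : i = j
        · exact hij ▸ hDj
        · exact hi.congr (hDi i hij)
      refine ⟨D * A, hD.mul hA, fun z hz => ?_, fun i => ?_, fun i hi => hkeep i (hAa i hi),
        fun i hi => ?_⟩
      · rw [Equiv.Perm.mul_apply, hAr z hz, hDr z hz]
      · by_cases hij : i = j
        · exact .inr (hij ▸ hDj)
        · exact (hAg i).imp (fun h => h.congr (hDi i hij)) (fun h => hkeep i h)
      · rcases Finset.mem_insert.1 hi with rfl | hi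
        · exact hDj
        · exact hkeep i (hAF i hi)
    · refine ⟨A, hA, hAr, hAg, hAa, fun i hi => ?_⟩
      rcases Finset.mem_insert.1 hi with rfl | hi
      · exact hja
      · exact hAF i hi

end IsRayFamily

/-- `G` has straightened the family `c` inside the disc of radius `R`, and this disc contains the
image of the disc of radius `n`. -/
structure IsStage {S : Type*} (c : S → ℝ → ℂ) (n : ℕ) (R : ℝ) (G : Equiv.Perm ℂ) : Prop where
  diffeo : IsDiffeo G
  zero : G 0 = 0
  good : IsGoodFamily (fun i t => G (c i t)) R
  engulfs : ∀ z, ‖z‖ ≤ n → ‖G z‖ < R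
  attached : ∀ i t, 0 ≤ t → ‖c i t‖ ≤ n → IsAttachedRay (fun t => G (c i t)) R

namespace IsRayFamily

variable {S : Type*} [TopologicalSpace S] [DiscreteTopology S] {c : S → ℝ → ℂ}

theorem exists_isStage_succ (hc : IsRayFamily c) {n : ℕ} {R ρ : ℝ} {G : Equiv.Perm ℂ}
    (h : IsStage c n R G) (hR : 0 < R) (hρ0 : 0 ≤ ρ) (hρ : ρ < R) :
    ∃ E : Equiv.Perm ℂ, (∀ z, ‖z‖ ≤ ρ → E z = z) ∧ IsStage c (n + 1) (R + 1) (E * G) := by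
  obtain ⟨F, _, -, hF⟩ := hc.finite_meeting (isCompact_closedBall (0 : ℂ) ((n + 1 : ℕ) : ℝ))
  obtain ⟨A, hA, hAr, hAg, hAa, hAF⟩ := (hc.comp h.diffeo).exists_attach_finset h.good hR hρ0 hρ F
  have hAG : (A * G) 0 = 0 := by
    rw [Equiv.Perm.mul_apply, h.zero, hAr 0 (by simpa using hρ0)]
  obtain ⟨D, hD, hDr, hDf, hDa, hDK⟩ :=
    ((hc.comp h.diffeo).comp hA).exists_engulf hAg hR hρ0 hρ
      (K := (A * G) '' Metric.closedBall (0 : ℂ) ((n + 1 : ℕ) : ℝ))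
      ((isCompact_closedBall _ _).image (hA.mul h.diffeo).continuous)
      ((convex_closedBall _ _).isPreconnected.image _ (hA.mul h.diffeo).continuous.continuousOn)
      ⟨0, Metric.mem_closedBall_self (Nat.cast_nonneg _), hAG⟩ (by
        rintro i hi t ht ⟨z, hz, hzt⟩
        have h1 : z = c i t := (A * G).injective hzt
        exact (hAF i (hF i t ht (h1 ▸ hz)).1).not_isFreeRay hi)
  obtain ⟨T, hT, hTρ, hT1, hT2, hT3, hT4⟩ := exists_stretch hρ0 hρ
  have hatt : ∀ i, IsAttachedRay (fun t => A (G (c i t))) R →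
      IsAttachedRay (fun t => (T * D * A * G) (c i t)) (R + 1) := fun i hi =>
    (hDa i hi).stretch hT1 hT2 hT3
  refine ⟨T * D * A, fun z hz => ?_, ((hT.mul hD).mul hA).mul h.diffeo, ?_, fun i => ?_,
    fun z hz => ?_, fun i t ht hn => ?_⟩
  · simp only [Equiv.Perm.mul_apply]
    rw [hAr z hz, hDr z hz, hTρ z hz]
  · simp only [Equiv.Perm.mul_apply] at hAG ⊢
    rw [hAG, hDr 0 (by simpa using hρ0), hTρ 0 (by simpa using hρ0)]
  · refine (hAg i).imp (fun hi t ht => hT4 _ ?_) (hatt i)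
    rw [hDf i hi t ht]
    exact hi t ht
  · exact (hT3 _).2 (hDK _ ⟨z, by simpa using hz, rfl⟩)
  · exact hatt i (hAF i (hF i t ht (by simpa using hn)).1)

/-- A family of rays that avoids a neighbourhood of the origin can be made radial by a
diffeomorphism that is the identity near the origin. -/
theorem exists_radialize (hc : IsRayFamily c) {r : ℝ} (hr : 0 < r)
    (hcr : ∀ i t, 0 ≤ t → r < ‖c i t‖) :
    ∃ G : Equiv.Perm ℂ, IsDiffeo G ∧ (∀ z, ‖z‖ ≤ r / 2 → G z = z) ∧
      ∀ i t, 0 ≤ t → ∃ q : ℝ, G (c i t) = q • G (c i 0) := by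
  have step : ∀ (n : ℕ) (G : Equiv.Perm ℂ), IsStage c n (r + n) G →
      ∃ G' : Equiv.Perm ℂ, IsStage c (n + 1) (r + (n + 1 : ℕ)) G' ∧
        (∀ z, ‖z‖ ≤ n → G' z = G z) ∧ ∀ z, ‖z‖ ≤ n + r / 2 → G'⁻¹ z = G⁻¹ z := by
    intro n G h
    have hn : (0 : ℝ) ≤ n := n.cast_nonneg
    obtain ⟨z₀, hz₀, hmax⟩ := (isCompact_closedBall (0 : ℂ) (n : ℝ)).exists_isMaxOn
      ⟨0, by simp⟩ h.diffeo.continuous.norm.continuousOn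
    obtain ⟨E, hEρ, hE⟩ := hc.exists_isStage_succ h (by positivity)
      (ρ := max ‖G z₀‖ (n + r / 2)) (by positivity)
      (max_lt (h.engulfs z₀ (by simpa using hz₀)) (by linarith))
    refine ⟨E * G, ?_, fun z hz => ?_, fun z hz => ?_⟩
    · convert hE using 1
      push_cast
      ring
    · exact hEρ _ ((hmax (by simpa using hz)).trans (le_max_left _ _))
    · rw [mul_inv_rev, Equiv.Perm.mul_apply,
        Equiv.Perm.inv_fix (hEρ z (hz.trans (le_max_right _ _)))]
  choose! next hnext1 hnext2 hnext3 using step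
  set G : ℕ → Equiv.Perm ℂ := fun n => Nat.rec 1 next n with hGdef
  have hsucc : ∀ n, G (n + 1) = next n (G n) := fun n => rfl
  have hG : ∀ n : ℕ, IsStage c n (r + n) (G n) := by
    intro n
    induction n with
    | zero =>
      refine ⟨.one, rfl, fun i => .inl fun t ht => ?_, fun z hz => ?_, fun i t ht h0 => ?_⟩
      · rw [Nat.cast_zero, add_zero]
        exact hcr i t ht
      · simp only [Nat.cast_zero] at hz
        rw [Nat.cast_zero, add_zero]
        exact hz.trans_lt hr
      · simp only [Nat.cast_zero] at h0
        linarith [hcr i t ht]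
    | succ n ih => exact hnext1 n _ ih
  obtain ⟨G', hG', hlim⟩ := exists_limit (G := G) (fun n => (hG n).diffeo)
    (fun n z hz => hnext2 n _ (hG n) z hz)
    (fun n z hz => hnext3 n _ (hG n) z (by linarith))
  have hid : ∀ (n : ℕ) z, ‖z‖ ≤ r / 2 → (G n)⁻¹ z = z := by
    intro n z hz
    induction n with
    | zero => rfl
    | succ n ih =>
      rw [hsucc, hnext3 n _ (hG n) z (by linarith [n.cast_nonneg (α := ℝ)]), ih]
  refine ⟨G', hG', fun z hz => ?_, fun i t ht => ?_⟩
  · obtain ⟨n, hn⟩ := exists_nat_gt ‖z‖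
    rw [hlim n z hn.le, ← Equiv.Perm.eq_inv_iff_eq, hid n z hz]
  · obtain ⟨n, hn⟩ := exists_nat_gt (max ‖c i t‖ ‖c i 0‖)
    have ht' : ‖c i t‖ ≤ n := (le_max_left _ _).trans hn.le
    have h0' : ‖c i 0‖ ≤ n := (le_max_right _ _).trans hn.le
    rw [hlim n _ ht', hlim n _ h0']
    obtain ⟨s, hs, hsR, hrad⟩ := (hG n).attached i t ht ht'
    exact hrad t ⟨ht, ((hsR t ht).1 ((hG n).engulfs _ ht')).le⟩

end IsRayFamily

/-! ### The isotopy -/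

namespace IsRayFamily

variable {S : Type*} [TopologicalSpace S] [DiscreteTopology S] {c : S → ℝ → ℂ}

theorem exists_notMem_rayUnion (hc : IsRayFamily c) : ∃ z, z ∉ rayUnion c := by
  rcases isEmpty_or_nonempty S with hS | ⟨⟨j⟩⟩
  · exact ⟨0, fun ⟨i, _⟩ => hS.elim i⟩
  · obtain ⟨δ, hδ, h, -⟩ := hc.exists_extension j
    exact ⟨c j (-δ), h _ le_rfl (by linarith)⟩

/-- Up to a translation, every family of rays can be made radial by a diffeomorphism that is the
identity near the origin. -/
theorem exists_radialize_sub (hc : IsRayFamily c) :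
    ∃ (G : Equiv.Perm ℂ) (z₀ : ℂ) (ε : ℝ), IsDiffeo G ∧ 0 < ε ∧ (∀ z, ‖z‖ < ε → G z = z) ∧
      IsRayFamily (fun i t => G (c i t - z₀)) ∧
      (∀ i t, 0 ≤ t → G (c i t - z₀) ≠ 0) ∧
      ∀ i t, 0 ≤ t → ∃ q : ℝ, G (c i t - z₀) = q • G (c i 0 - z₀) := by
  obtain ⟨z₀, hz₀⟩ := hc.exists_notMem_rayUnion
  obtain ⟨r, hr, hball⟩ := Metric.isOpen_iff.1 hc.isClosed_rayUnion.isOpen_compl z₀ hz₀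
  have hT : IsDiffeo (Equiv.subRight z₀) :=
    ⟨contDiff_id.sub contDiff_const, contDiff_id.add contDiff_const⟩
  have hcT : IsRayFamily (fun i t => c i t - z₀) := hc.comp hT
  obtain ⟨G, hG, hGr, hGc⟩ := hcT.exists_radialize (r := r / 2) (by positivity) (fun i t ht => by
    by_contra! h
    refine hball (?_ : c i t ∈ Metric.ball z₀ r) ⟨i, t, ht, rfl⟩
    rw [Metric.mem_ball, dist_eq_norm]
    linarith)
  have h0 : G 0 = 0 := hGr 0 (by rw [norm_zero]; positivity)
  refine ⟨G, z₀, r / 4, hG, by positivity, fun z hz => hGr z (by linarith), hcT.comp hG,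
    fun i t ht h => ?_, hGc⟩
  rw [← h0] at h
  have h1 := sub_eq_zero.1 (G.injective h)
  exact hz₀ ⟨i, t, ht, h1⟩

end IsRayFamily

/-- A variant of the Alexander trick, in which `G` is conjugated by homotheties: the map
`z ↦ G (z - z₀)` is isotopic to the identity if `G` is the identity near the origin. -/
theorem exists_isotopy {G : Equiv.Perm ℂ} (hG : IsDiffeo G) {ε : ℝ} (hε : 0 < ε)
    (hGε : ∀ z, ‖z‖ < ε → G z = z) (z₀ : ℂ) :
    ∃ H : ℝ → Equiv.Perm ℂ, ContDiff ℝ ∞ (fun p : ℝ × ℂ => H p.1 p.2) ∧ (∀ t, IsDiffeo (H t)) ∧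
      H 0 = 1 ∧ ∀ z, H 1 z = G (z - z₀) := by
  classical
  have key : ∀ t : ℝ, ∃ D : Equiv.Perm ℂ, IsDiffeo D ∧
      ∀ z, D z = if t = 0 then z else t⁻¹ • G (t • (z - z₀)) + (1 - t) • z₀ := by
    intro t
    by_cases ht : t = 0
    · exact ⟨1, .one, fun z => by simp [ht]⟩
    · refine ⟨⟨fun z => t⁻¹ • G (t • (z - z₀)) + (1 - t) • z₀,
        fun w => t⁻¹ • G⁻¹ (t • (w - (1 - t) • z₀)) + z₀, fun z => ?_, fun w => ?_⟩, ⟨?_, ?_⟩,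
        fun z => by simp [ht]⟩
      · simp [ht]
      · simp [ht]
      · have h1 : ContDiff ℝ ∞ fun z : ℂ => t • (z - z₀) :=
          (contDiff_id.sub contDiff_const).const_smul t
        exact ((hG.1.comp h1).const_smul t⁻¹).add contDiff_const
      · have h1 : ContDiff ℝ ∞ fun w : ℂ => t • (w - (1 - t) • z₀) :=
          (contDiff_id.sub contDiff_const).const_smul t
        exact ((hG.2.comp h1).const_smul t⁻¹).add contDiff_const
  choose H hH hHz using key
  refine ⟨H, ?_, hH, ?_, fun z => by simp [hHz]⟩
  · rw [contDiff_iff_contDiffAt]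
    rintro ⟨t, z⟩
    by_cases ht : t = 0
    · subst ht
      have h1 : ContDiffAt ℝ ∞ (fun p : ℝ × ℂ => p.2 - p.1 • z₀) (0, z) :=
        (contDiff_snd.sub (contDiff_fst.smul contDiff_const)).contDiffAt
      refine h1.congr_of_eventuallyEq ?_
      have h2 : Continuous fun p : ℝ × ℂ => ‖p.1 • (p.2 - z₀)‖ := by fun_prop
      filter_upwards [(isOpen_lt h2 continuous_const).mem_nhds
        (show ‖((0 : ℝ), z).1 • (((0 : ℝ), z).2 - z₀)‖ < ε by simpa using hε)] with p hp
      rw [hHz]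
      split_ifs with h
      · simp [h]
      · rw [hGε _ hp, smul_smul, inv_mul_cancel₀ h, one_smul, sub_smul, one_smul]
        abel
    · have h1 : ContDiffAt ℝ ∞
          (fun p : ℝ × ℂ => p.1⁻¹ • G (p.1 • (p.2 - z₀)) + (1 - p.1) • z₀) (t, z) := by
        refine ((contDiffAt_fst.inv ht).smul (hG.1.contDiffAt.comp (t, z) ?_)).add ?_
        · exact (contDiff_fst.smul (contDiff_snd.sub contDiff_const)).contDiffAt
        · exact ((contDiff_const.sub contDiff_fst).smul contDiff_const).contDiffAt
      refine h1.congr_of_eventuallyEq ?_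
      filter_upwards [(isOpen_ne.preimage continuous_fst).mem_nhds
        (show (t, z) ∈ (Prod.fst : ℝ × ℂ → ℝ) ⁻¹' {x | x ≠ 0} from ht)] with p hp
      rw [hHz, if_neg hp]
  · ext1 z
    simp [hHz]

/-- The identification of `ℂ` with the Euclidean plane. -/
noncomputable def planeEquiv : ℂ ≃ₗᵢ[ℝ] Plane := Complex.orthonormalBasisOneI.repr

theorem IsSmoothProperRayEmbedding.isRayFamily {S : Type*} [TopologicalSpace S]
    [DiscreteTopology S] {γ : S → ℝ → Plane} (h : IsSmoothProperRayEmbedding γ) :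
    IsRayFamily (fun i t => planeEquiv.symm (γ i t)) where
  smooth i := planeEquiv.symm.contDiff.comp (h.smooth i)
  immersive i t ht := by
    have h1 : HasDerivAt (fun t => planeEquiv.symm (γ i t)) (planeEquiv.symm (deriv (γ i) t)) t :=
      planeEquiv.symm.toContinuousLinearEquiv.hasFDerivAt.comp_hasDerivAt t
        ((h.smooth i).differentiable (by simp) t).hasDerivAt
    rw [h1.deriv]
    simpa using h.immersive i t ht
  injective := planeEquiv.symm.injective.comp h.injective
  proper := planeEquiv.symm.toHomeomorph.isProperMap.comp h.proper

theorem IsRayFamily.isSmoothProperRayEmbedding {S : Type*} [TopologicalSpace S]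
    [DiscreteTopology S] {c : S → ℝ → ℂ} (h : IsRayFamily c) :
    IsSmoothProperRayEmbedding (fun i t => planeEquiv (c i t)) where
  smooth i := planeEquiv.contDiff.comp (h.smooth i)
  immersive i t ht := by
    have h1 : HasDerivAt (fun t => planeEquiv (c i t)) (planeEquiv (deriv (c i) t)) t :=
      planeEquiv.toContinuousLinearEquiv.hasFDerivAt.comp_hasDerivAt t
        ((h.smooth i).differentiable (by simp) t).hasDerivAt
    rw [h1.deriv]
    simpa using h.immersive i t ht
  injective := planeEquiv.injective.comp h.injective
  proper := planeEquiv.toHomeomorph.isProperMap.comp h.proper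

theorem theorem9p8 (L : Set Plane) (hL : IsSmoothProperMultiray L) :
    ∃ L' : Set Plane, IsRadialMultiray L' ∧ SmoothlyAmbientIsotopic L L' := by
  obtain ⟨S, γ, hγ, rfl⟩ := hL
  obtain ⟨G, z₀, ε, hG, hε, hGε, hfam, hne, hrad⟩ := hγ.isRayFamily.exists_radialize_sub
  obtain ⟨H, hH, hHt, hH0, hH1⟩ := exists_isotopy hG hε hGε z₀
  refine ⟨_, ⟨S, fun i t => planeEquiv (G (planeEquiv.symm (γ i t) - z₀)),
    hfam.isSmoothProperRayEmbedding, rfl, fun i => ⟨⟨planeEquiv (G (planeEquiv.symm (γ i 0) - z₀)),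
    ?_, ?_⟩, ?_⟩⟩, fun t x => planeEquiv (H t (planeEquiv.symm x)),
    ⟨?_, fun t _ => ?_, fun x => ?_⟩, ?_⟩
  · simpa using hne i 0 le_rfl
  · rintro _ ⟨t, ht, rfl⟩
    obtain ⟨q, hq⟩ := hrad i t ht
    refine Submodule.mem_span_singleton.2 ⟨q, ?_⟩
    simp only [hq, map_smul]
  · rintro ⟨t, ht, h⟩
    exact hne i t ht (by simpa using h)
  · exact planeEquiv.contDiff.comp
      (hH.comp (contDiff_fst.prodMk (planeEquiv.symm.contDiff.comp contDiff_snd)))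
  · refine ⟨⟨planeEquiv.symm.toEquiv.trans ((H t).trans planeEquiv.toEquiv), ?_, ?_⟩,
      fun x => rfl⟩
    · exact contMDiff_iff_contDiff.2 (planeEquiv.contDiff.comp
        ((hHt t).1.comp planeEquiv.symm.contDiff))
    · exact contMDiff_iff_contDiff.2 (planeEquiv.contDiff.comp
        ((hHt t).2.comp planeEquiv.symm.contDiff))
  · simp [hH0]
  · rw [image_iUnion]
    refine iUnion_congr fun i => ?_
    rw [rayOf, rayOf, image_image]
    simp only [hH1]
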